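/- Let $\mathbb{F}$ be the field with two elements, let $\mathcal{A}(1)$ be the subalgebra of the mod-$2$ Steenrod algebra generated by $Sq^1,Sq^2$, and let $\mathcal{A}(1)/\!/\mathcal{A}(0)=\mathcal{A}(1)/\mathcal{A}(1)Sq^1$. Let $\mathfrak{C}$ be the periodic complex of graded $\mathcal{A}(1)$-modules $\cdots\to\mathfrak{C}[n+1]\to\mathfrak{C}[n]\to\cdots$ ($n\in\mathbb{Z}$) with $$\mathfrak{C}[0]=\mathcal{A}(1)/\!/\mathcal{A}(0),\quad \mathfrak{C}[1]=\Sigma\mathcal{A}(1),\quad \mathfrak{C}[2]=\Sigma^2\mathcal{A}(1),\quad \mathfrak{C}[3]=\Sigma^4\mathcal{A}(1)/\!/\mathcal{A}(0),\quad \mathfrak{C}[4k+i]=\Sigma^{8k}\mathfrak{C}[i],$$ whose differential $\mathfrak{C}[n+1]\to\mathfrak{C}[n]$, of internal degree $1$, is induced by right multiplication by $Sq^2,\ Sq^2,\ Sq^3=Sq^1Sq^2,\ Sq^2Sq^1Sq^2$ for $n\equiv 0,1,2,3 \pmod 4$ respectively. For a finite-dimensional $\mathbb{F}$-vector space $V$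 with dual $V^\sharp$, let $H\mathbb{F}^*(BV^\sharp)$ be the reduced mod-$2$ cohomology of $BV^\sharp$, that is, the augmentation ideal of the symmetric algebra $S^*(V)$, with $V$ in degree $1$, equipped with the $\mathcal{A}(1)$-action given by the Steenrod squares (so $\sum_k Sq^k$ is multiplicative, and is $v\mapsto v+v^2$ on $V$). For $n,d\in\mathbb{Z}$ let $H^{n,d}$ be the functor $$V\mapsto H^n\big(\mathrm{Hom}_{\mathcal{A}(1)}(\mathfrak{C},H\mathbb{F}^*(BV^\sharp))\big)^d$$ from finite-dimensional $\mathbb{F}$-vector spaces to $\mathbb{F}$-vector spaces, where $n$ is the cohomological degree, and the internal degree $d$ part of $\mathrm{Hom}_{\mathcal{A}(1)}$ consists of the $\mathcal{A}(1)$-linear maps raising internal degree by $d$ (thus the differential has internal degree $1$). A functor is finite if it has a finite composition series; $[F]$ denotes the class of a finite functor $F$ in the Grothendieck group of finite functors. Let $\Lambda^m$ be the $m$th exterior power functor, let $\overline{I}_{\mathbb{F}}$ be the functor sending $V$ to the space of maps of sets $V^\sharp\to\mathbb{F}$ which send $0$ to $0$, and let $p_m\overline{I}_{\mathbb{F}}$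 be its largest subfunctor of polynomial degree at most $m$. For $m\leq 0$, read $[\Lambda^m]$ and $[p_m\overline{I}_{\mathbb{F}}]$ as $0$. Then the functors $\Lambda^m$, $p_m\overline{I}_{\mathbb{F}}$ ($m\ge 0$) and $H^{n,d}$ ($n,d\in\mathbb{Z}$) are finite and, for all $n,l\in\mathbb{Z}$, in the Grothendieck group of finite functors, $$[H^{n,8l}]=[p_{n+4l}\overline{I}_{\mathbb{F}}],\qquad [H^{n,8l+4}]=[p_{n+4l+1}\overline{I}_{\mathbb{F}}],$$ $$[H^{n,8l+6}]=[\Lambda^{n+4l+2}],\qquad [H^{n,8l+7}]=[\Lambda^{n+4l+3}],$$ while $[H^{n,d}]=0$ for every $d$ not congruent to $0,4,6,7$ modulo $8$. -/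

import Mathlib

open CategoryTheory

noncomputable section

namespace A1Cohomology

/-- The prime field with two elements. -/
abbrev 𝔽 : Type := ZMod 2

/-! ### The algebra `A(1)` -/

/-- The generators `Sq¹` and `Sq²`. -/
inductive Gen : Type
  | sq1
  | sq2

/-- The degrees of the generators. -/
def Gen.deg : Gen → ℕ
  | .sq1 => 1
  | .sq2 => 2

/-- The Adem relations `Sq¹ Sq¹ = 0` and `Sq² Sq² = Sq¹ Sq² Sq¹`, which present the subalgebra
of the mod-2 Steenrod algebra generated by `Sq¹` and `Sq²`. -/
inductive A1Rel : FreeAlgebra 𝔽 Gen → FreeAlgebra 𝔽 Gen → Prop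
  | sq1_sq1 : A1Rel (FreeAlgebra.ι 𝔽 Gen.sq1 * FreeAlgebra.ι 𝔽 Gen.sq1) 0
  | sq2_sq2 : A1Rel (FreeAlgebra.ι 𝔽 Gen.sq2 * FreeAlgebra.ι 𝔽 Gen.sq2)
      (FreeAlgebra.ι 𝔽 Gen.sq1 * FreeAlgebra.ι 𝔽 Gen.sq2 * FreeAlgebra.ι 𝔽 Gen.sq1)

/-- The algebra `A(1)`, of dimension 8, generated by `Sq¹` and `Sq²`. -/
def A1 : Type := RingQuot A1Rel

instance : Ring A1 := inferInstanceAs (Ring (RingQuot A1Rel))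
instance : Algebra 𝔽 A1 := inferInstanceAs (Algebra 𝔽 (RingQuot A1Rel))

/-- The class in `A(1)` of a generator. -/
def A1.gen (g : Gen) : A1 := RingQuot.mkAlgHom 𝔽 A1Rel (FreeAlgebra.ι 𝔽 g)

/-- `Sq¹` in `A(1)`. -/
def A1.sq1 : A1 := A1.gen .sq1

/-- `Sq²` in `A(1)`. -/
def A1.sq2 : A1 := A1.gen .sq2

/-- `Sq³ = Sq¹ Sq²` in `A(1)`. -/
def A1.sq3 : A1 := A1.sq1 * A1.sq2

theorem A1.sq1_mul_sq1 : A1.sq1 * A1.sq1 = 0 := by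
  have h := RingQuot.mkAlgHom_rel 𝔽 A1Rel.sq1_sq1
  rw [map_mul, map_zero] at h
  exact h

theorem A1.sq2_mul_sq2 : A1.sq2 * A1.sq2 = A1.sq1 * A1.sq2 * A1.sq1 := by
  have h := RingQuot.mkAlgHom_rel 𝔽 A1Rel.sq2_sq2
  rw [map_mul, map_mul, map_mul] at h
  exact h

/-- The component of degree `d` of `A(1)`: the span of the words of degree `d` in the
generators. -/
def A1.grading (d : ℤ) : Submodule 𝔽 A1 :=
  Submodule.span 𝔽 {x | ∃ w : List Gen, ((w.map Gen.deg).sum : ℤ) = d ∧ x = (w.map A1.gen).prod}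

theorem A1.mul_gen_mem {d : ℤ} {x : A1} (hx : x ∈ A1.grading d) (g : Gen) :
    x * A1.gen g ∈ A1.grading (d + g.deg) := by
  induction hx using Submodule.span_induction with
  | mem x h =>
    obtain ⟨w, hw, rfl⟩ := h
    refine Submodule.subset_span ⟨w ++ [g], ?_, by simp⟩
    simp [← hw]
  | zero => simp
  | add x y _ _ hx hy => rw [add_mul]; exact add_mem hx hy
  | smul c x _ hx => rw [smul_mul_assoc]; exact Submodule.smul_mem _ _ hx

theorem A1.mul_sq1_mem {d : ℤ} {x : A1} (hx : x ∈ A1.grading d) :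
    x * A1.sq1 ∈ A1.grading (d + 1) := A1.mul_gen_mem hx .sq1

theorem A1.mul_sq2_mem {d : ℤ} {x : A1} (hx : x ∈ A1.grading d) :
    x * A1.sq2 ∈ A1.grading (d + 2) := A1.mul_gen_mem hx .sq2

/-! ### The periodic complex of `A(1)`-modules -/

/-- The left ideal `J n` such that the underlying module of the `n`th term is `A(1) / J n`:
`A(1) Sq¹` if `n` is 0 or 3 modulo 4, so that the quotient is `A(1)//A(0)`, and zero if `n` is
1 or 2 modulo 4. -/
def fundIdeal (n : ℤ) : Submodule A1 A1 :=
  if n % 4 = 0 ∨ n % 4 = 3 then Submodule.span A1 {A1.sq1} else ⊥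

/-- The degree of the generator of the `n`th term: `8k, 8k+1, 8k+2, 8k+4` for
`n = 4k, 4k+1, 4k+2, 4k+3` respectively. -/
def fundShift (n : ℤ) : ℤ :=
  8 * (n / 4) + (if n % 4 = 0 then 0 else if n % 4 = 1 then 1 else if n % 4 = 2 then 2 else 4)

/-- The element of `A(1)` which defines the map from the `(n+1)`st term to the `n`th term. -/
def fundElt (n : ℤ) : A1 :=
  if n % 4 = 0 then A1.sq2 else if n % 4 = 1 then A1.sq2 else if n % 4 = 2 then A1.sq3
    else A1.sq2 * A1.sq1 * A1.sq2

/-- The `n`th term of the complex, as an ungraded `A(1)`-module. -/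
abbrev Fund (n : ℤ) : Type := A1 ⧸ fundIdeal n

/-- The grading of the `n`th term, which is the suspension `Σ^(fundShift n)` of
`A(1) / fundIdeal n`. -/
def fundGrading (n d : ℤ) : Submodule 𝔽 (Fund n) :=
  (A1.grading (d - fundShift n)).map ((fundIdeal n).mkQ.restrictScalars 𝔽)

theorem mod_four_cases (n : ℤ) :
    (n % 4 = 0 ∧ (n + 1) % 4 = 1) ∨ (n % 4 = 1 ∧ (n + 1) % 4 = 2) ∨
      (n % 4 = 2 ∧ (n + 1) % 4 = 3) ∨ (n % 4 = 3 ∧ (n + 1) % 4 = 0) := by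
  lia

theorem fundIdeal_le (n : ℤ) :
    fundIdeal (n + 1) ≤ (fundIdeal n).comap (LinearMap.toSpanSingleton A1 A1 (fundElt n)) := by
  rcases mod_four_cases n with ⟨h, h'⟩ | ⟨h, h'⟩ | ⟨h, h'⟩ | ⟨h, h'⟩
  · simp [fundIdeal, h']
  · simp [fundIdeal, h']
  · simp only [fundIdeal, h, h', fundElt]
    simp [Submodule.span_le, A1.sq3, ← mul_assoc, A1.sq1_mul_sq1]
  · simp only [fundIdeal, h, h', fundElt]
    norm_num
    have e : A1.sq1 * (A1.sq2 * A1.sq1 * A1.sq2) = (A1.sq2 * A1.sq1 * A1.sq2) * A1.sq1 := by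
      calc _ = (A1.sq1 * A1.sq2 * A1.sq1) * A1.sq2 := by simp only [mul_assoc]
        _ = A1.sq2 * (A1.sq2 * A1.sq2) := by rw [← A1.sq2_mul_sq2, mul_assoc]
        _ = _ := by rw [A1.sq2_mul_sq2]; simp only [mul_assoc]
    rw [e]
    exact Submodule.smul_mem _ _ (Submodule.mem_span_singleton_self _)

/-- The differential of the complex, given by right multiplication by `fundElt n`. -/
def fundD (n : ℤ) : Fund (n + 1) →ₗ[A1] Fund n :=
  Submodule.mapQ _ _ (LinearMap.toSpanSingleton A1 A1 (fundElt n)) (fundIdeal_le n)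

theorem fundD_mk (n : ℤ) (x : A1) :
    fundD n ((fundIdeal (n + 1)).mkQ x) = (fundIdeal n).mkQ (x * fundElt n) := by
  simp [fundD]

theorem fundElt_mul_mem (n : ℤ) : fundElt (n + 1) * fundElt n ∈ fundIdeal n := by
  have b4 : A1.sq2 * A1.sq2 * A1.sq2 * A1.sq2 = 0 := by
    calc _ = (A1.sq2 * A1.sq2) * (A1.sq2 * A1.sq2) := by simp only [mul_assoc]
      _ = A1.sq1 * A1.sq2 * (A1.sq1 * A1.sq1) * A1.sq2 * A1.sq1 := by
        rw [A1.sq2_mul_sq2]; simp only [mul_assoc]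
      _ = 0 := by rw [A1.sq1_mul_sq1]; simp
  have baba : A1.sq2 * A1.sq1 * A1.sq2 * A1.sq1 = A1.sq2 * A1.sq2 * A1.sq2 := by
    calc _ = A1.sq2 * (A1.sq1 * A1.sq2 * A1.sq1) := by simp only [mul_assoc]
      _ = _ := by rw [← A1.sq2_mul_sq2, mul_assoc]
  rcases mod_four_cases n with ⟨h, h'⟩ | ⟨h, h'⟩ | ⟨h, h'⟩ | ⟨h, h'⟩
  · simp only [fundIdeal, h, h', fundElt]
    norm_num
    rw [A1.sq2_mul_sq2]
    exact Submodule.smul_mem _ _ (Submodule.mem_span_singleton_self _)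
  · simp only [fundIdeal, h, h', fundElt]
    norm_num
    rw [A1.sq3, mul_assoc, A1.sq2_mul_sq2, ← mul_assoc, ← mul_assoc, A1.sq1_mul_sq1]
    simp
  · simp only [fundIdeal, h, h', fundElt]
    norm_num
    rw [A1.sq3, ← mul_assoc, baba, b4]
  · simp only [fundIdeal, h, h', fundElt]
    norm_num
    rw [← mul_assoc, ← mul_assoc, A1.sq2_mul_sq2, mul_assoc _ A1.sq1 A1.sq1, A1.sq1_mul_sq1]
    simp

theorem fundD_comp (n : ℤ) : fundD n ∘ₗ fundD (n + 1) = 0 := by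
  apply Submodule.linearMap_qext
  apply LinearMap.ext_ring
  simp only [LinearMap.comp_apply, fundD_mk, one_mul, LinearMap.zero_apply]
  simpa using fundElt_mul_mem n

/-- The differential raises the internal degree by one. -/
theorem fundD_mem {n d : ℤ} {x : Fund (n + 1)} (hx : x ∈ fundGrading (n + 1) d) :
    fundD n x ∈ fundGrading n (d + 1) := by
  obtain ⟨a, ha, rfl⟩ := hx
  refine ⟨a * fundElt n, ?_, (fundD_mk n a).symm⟩
  have ha' : a ∈ A1.grading (d - fundShift (n + 1)) := ha
  change a * fundElt n ∈ A1.grading (d + 1 - fundShift n)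
  rcases mod_four_cases n with ⟨h, h'⟩ | ⟨h, h'⟩ | ⟨h, h'⟩ | ⟨h, h'⟩
  · have e : d + 1 - fundShift n = d - fundShift (n + 1) + 2 := by
      simp [fundShift, h, h']; lia
    rw [e, show fundElt n = A1.sq2 by simp [fundElt, h]]
    exact A1.mul_sq2_mem ha'
  · have e : d + 1 - fundShift n = d - fundShift (n + 1) + 2 := by
      simp [fundShift, h, h']; lia
    rw [e, show fundElt n = A1.sq2 by simp [fundElt, h]]
    exact A1.mul_sq2_mem ha'
  · have e : d + 1 - fundShift n = d - fundShift (n + 1) + 1 + 2 := by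
      simp [fundShift, h, h']; lia
    rw [e, show fundElt n = A1.sq1 * A1.sq2 by simp [fundElt, h, A1.sq3], ← mul_assoc]
    exact A1.mul_sq2_mem (A1.mul_sq1_mem ha')
  · have e : d + 1 - fundShift n = d - fundShift (n + 1) + 2 + 1 + 2 := by
      simp [fundShift, h, h']; lia
    rw [e, show fundElt n = A1.sq2 * A1.sq1 * A1.sq2 by simp [fundElt, h], ← mul_assoc,
      ← mul_assoc]
    exact A1.mul_sq2_mem (A1.mul_sq1_mem (A1.mul_sq2_mem ha'))

/-! ### The cohomology of `B V^♯` -/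

section Cohomology

variable (V : Type) [AddCommGroup V] [Module 𝔽 V]

/-- The unreduced mod-2 cohomology of the classifying space of the dual of `V`, which is the
symmetric algebra `S^*(V)` on `V = H¹(B V^♯)`. -/
abbrev Sym : Type := SymmetricAlgebra 𝔽 V

/-- The total Steenrod square `∑ Sq^k t^k`: the algebra morphism (Cartan formula) such that
`Sq(v) = v + v² t` on classes `v` of degree one. -/
def totalSq : Sym V →ₐ[𝔽] Polynomial (Sym V) :=
  SymmetricAlgebra.lift
    { toFun := fun v => Polynomial.C (SymmetricAlgebra.ι 𝔽 V v) +
        Polynomial.C (SymmetricAlgebra.ι 𝔽 V v ^ 2) * Polynomial.X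
      map_add' := fun v w => by
        have : CharP (Sym V) 2 := charP_of_injective_algebraMap
          (algebraMap 𝔽 (Sym V)).injective 2
        rw [map_add, add_pow_char, map_add, map_add]
        ring
      map_smul' := fun c v => by
        have hc : c ^ 2 = c := ZMod.pow_card c
        rw [map_smul, smul_pow, hc, RingHom.id_apply, smul_add, ← Polynomial.smul_C,
          ← Polynomial.smul_C, smul_mul_assoc] }

/-- The Steenrod square `Sq^k`. -/
def Sq (k : ℕ) : Sym V →ₗ[𝔽] Sym V where
  toFun x := (totalSq V x).coeff k
  map_add' x y := by simp
  map_smul' c x := by simp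


theorem totalSq_ι (v : V) : totalSq V (SymmetricAlgebra.ι 𝔽 V v) =
    Polynomial.C (SymmetricAlgebra.ι 𝔽 V v) +
        Polynomial.C (SymmetricAlgebra.ι 𝔽 V v ^ 2) * Polynomial.X :=
  SymmetricAlgebra.lift_ι_apply _ v

theorem Sq_apply (k : ℕ) (x : Sym V) : Sq V k x = (totalSq V x).coeff k := rfl

theorem Sq_algebraMap (k : ℕ) (hk : k ≠ 0) (r : 𝔽) : Sq V k (algebraMap 𝔽 (Sym V) r) = 0 := by
  rw [Sq_apply, AlgHom.commutes, Polynomial.algebraMap_apply, Polynomial.coeff_C_of_ne_zero hk]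

theorem Sq_zero_eq (x : Sym V) : Sq V 0 x = x := by
  induction x using SymmetricAlgebra.induction with
  | algebraMap r => rw [Sq_apply, AlgHom.commutes, Polynomial.algebraMap_apply]; simp
  | ι v => rw [Sq_apply, totalSq_ι]; simp
  | mul a b ha hb =>
    rw [Sq_apply] at *
    rw [map_mul, Polynomial.mul_coeff_zero, ha, hb]
  | add a b ha hb => rw [map_add, ha, hb]

theorem Sq_one_ι (v : V) :
    Sq V 1 (SymmetricAlgebra.ι 𝔽 V v) = SymmetricAlgebra.ι 𝔽 V v ^ 2 := by
  rw [Sq_apply, totalSq_ι, Polynomial.coeff_add, Polynomial.coeff_C_mul]; simp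

theorem Sq_two_ι (v : V) : Sq V 2 (SymmetricAlgebra.ι 𝔽 V v) = 0 := by
  rw [Sq_apply, totalSq_ι, Polynomial.coeff_add, Polynomial.coeff_C_mul]
  simp [Polynomial.coeff_X]

theorem Sq_one_mul (x y : Sym V) : Sq V 1 (x * y) = Sq V 1 x * y + x * Sq V 1 y := by
  have h0 := Sq_zero_eq V x
  have h0' := Sq_zero_eq V y
  simp only [Sq_apply] at *
  rw [map_mul, Polynomial.mul_coeff_one, h0, h0']
  ring

theorem Sq_two_mul (x y : Sym V) :
    Sq V 2 (x * y) = Sq V 2 x * y + Sq V 1 x * Sq V 1 y + x * Sq V 2 y := by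
  have h0 := Sq_zero_eq V x
  have h0' := Sq_zero_eq V y
  simp only [Sq_apply] at *
  rw [map_mul, Polynomial.coeff_mul, Finset.Nat.sum_antidiagonal_succ,
    Finset.Nat.sum_antidiagonal_succ]
  simp [h0, h0']
  ring

theorem two_eq_zero' : (2 : Sym V) = 0 := by
  have h : algebraMap 𝔽 (Sym V) 2 = 0 := by
    rw [show (2 : 𝔽) = 0 from rfl, map_zero]
  rwa [map_ofNat] at h

theorem Sq_one_Sq_one (x : Sym V) : Sq V 1 (Sq V 1 x) = 0 := by
  have h2 := two_eq_zero' V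
  induction x using SymmetricAlgebra.induction with
  | algebraMap r => rw [Sq_algebraMap V 1 one_ne_zero, map_zero]
  | ι v => 
    rw [Sq_one_ι, sq, Sq_one_mul, Sq_one_ι]
    linear_combination (SymmetricAlgebra.ι 𝔽 V v ^ 3) * h2
  | mul a b ha hb =>
    simp only [Sq_one_mul, map_add, ha, hb]
    linear_combination (Sq V 1 a * Sq V 1 b) * h2
  | add a b ha hb => rw [map_add, map_add, ha, hb, add_zero]

theorem Sq_two_Sq_two (x : Sym V) : Sq V 2 (Sq V 2 x) = Sq V 1 (Sq V 2 (Sq V 1 x)) := by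
  have h2 := two_eq_zero' V
  induction x using SymmetricAlgebra.induction with
  | algebraMap r =>
    rw [Sq_algebraMap V 1 one_ne_zero, Sq_algebraMap V 2 two_ne_zero, map_zero, map_zero]
  | ι v =>
    rw [Sq_one_ι, Sq_two_ι, sq, Sq_two_mul, Sq_one_ι, Sq_two_ι]
    simp only [sq, mul_zero, zero_mul, zero_add, add_zero, map_zero, Sq_one_mul, Sq_one_ι]
    linear_combination (-2 * SymmetricAlgebra.ι 𝔽 V v ^ 5) * h2
  | mul a b ha hb =>
    simp only [Sq_one_mul, Sq_two_mul, map_add, ha, hb, Sq_one_Sq_one, map_zero]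
    linear_combination (Sq V 2 a * Sq V 2 b) * h2
  | add a b ha hb => simp only [map_add, ha, hb]

/-- The action of the generators of `A(1)` on cohomology. -/
def genAct : Gen → Module.End 𝔽 (Sym V)
  | .sq1 => Sq V 1
  | .sq2 => Sq V 2

/-- The action of `A(1)` on cohomology, in which `Sq¹` and `Sq²` act as the Steenrod squares. -/
def A1.act : A1 →ₐ[𝔽] Module.End 𝔽 (Sym V) :=
  RingQuot.liftAlgHom 𝔽 ⟨FreeAlgebra.lift 𝔽 (genAct V), by
    intro x y h
    cases h with
    | sq1_sq1 =>
      ext1 x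
      simpa [genAct] using Sq_one_Sq_one V x
    | sq2_sq2 =>
      ext1 x
      simpa [genAct] using Sq_two_Sq_two V x⟩

theorem A1.act_gen (g : Gen) : A1.act V (A1.gen g) = genAct V g := by
  rw [A1.act, A1.gen]
  exact (RingQuot.liftAlgHom_mkAlgHom_apply _ _ _ _).trans (FreeAlgebra.lift_ι_apply _ _)

instance : Module A1 (Sym V) := Module.compHom (Sym V) (A1.act V).toRingHom

theorem smul_def (a : A1) (x : Sym V) : a • x = A1.act V a x := rfl

instance : IsScalarTower 𝔽 A1 (Sym V) where
  smul_assoc c a x := by simp only [smul_def, map_smul, LinearMap.smul_apply]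

theorem sq1_smul (x : Sym V) : A1.sq1 • x = Sq V 1 x := by
  rw [smul_def, A1.sq1, A1.act_gen]; rfl

theorem sq2_smul (x : Sym V) : A1.sq2 • x = Sq V 2 x := by
  rw [smul_def, A1.sq2, A1.act_gen]; rfl

end Cohomology

/-- An induction principle for `A(1)`. -/
theorem A1.induction {p : A1 → Prop} (algebraMap : ∀ r, p (algebraMap 𝔽 A1 r))
    (gen : ∀ g, p (A1.gen g)) (mul : ∀ a b, p a → p b → p (a * b))
    (add : ∀ a b, p a → p b → p (a + b)) (a : A1) : p a := by
  obtain ⟨a, rfl⟩ := RingQuot.mkAlgHom_surjective 𝔽 A1Rel a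
  induction a using FreeAlgebra.induction with
  | grade0 r => rw [AlgHom.commutes]; exact algebraMap r
  | grade1 g => exact gen g
  | mul a b ha hb => rw [map_mul]; exact mul _ _ ha hb
  | add a b ha hb => rw [map_add]; exact add _ _ ha hb

section Cohomology

variable (V : Type) [AddCommGroup V] [Module 𝔽 V]

theorem aug_totalSq (x : Sym V) :
    Polynomial.mapAlgHom (SymmetricAlgebra.algebraMapInv (R := 𝔽) (M := V)) (totalSq V x) =
      Polynomial.C (SymmetricAlgebra.algebraMapInv (R := 𝔽) (M := V) x) := by
  induction x using SymmetricAlgebra.induction with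
  | algebraMap r => rw [AlgHom.commutes, AlgHom.commutes, AlgHom.commutes]; rfl
  | ι v => rw [totalSq_ι]; simp [SymmetricAlgebra.algebraMapInv_ι]
  | mul a b ha hb => rw [map_mul, map_mul, map_mul, ha, hb, map_mul]
  | add a b ha hb => rw [map_add, map_add, map_add, ha, hb, map_add]

theorem aug_Sq (k : ℕ) (hk : k ≠ 0) (x : Sym V) :
    SymmetricAlgebra.algebraMapInv (R := 𝔽) (M := V) (Sq V k x) = 0 := by
  have h := congrArg (fun q => Polynomial.coeff q k) (aug_totalSq V x)
  rw [Polynomial.coeff_C_of_ne_zero hk] at h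
  rw [Polynomial.coe_mapAlgHom, Polynomial.coeff_map] at h
  exact h

/-- The augmentation of cohomology to cohomology of the base point. -/
abbrev aug : Sym V →ₐ[𝔽] 𝔽 := SymmetricAlgebra.algebraMapInv

/-- The reduced mod-2 cohomology of `B V^♯` (the augmentation ideal of `S^*(V)`), as an
`A(1)`-submodule. -/
def reduced : Submodule A1 (Sym V) where
  carrier := {x | aug V x = 0}
  add_mem' {x y} hx hy := by
    simp only [Set.mem_ofPred_eq] at *
    rw [map_add, hx, hy, add_zero]
  zero_mem' := map_zero _
  smul_mem' a x hx := by
    simp only [Set.mem_ofPred_eq] at *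
    induction a using A1.induction generalizing x with
    | algebraMap r => rw [algebraMap_smul, map_smul, hx, smul_zero]
    | gen g =>
      cases g with
      | sq1 => exact (congrArg _ (sq1_smul V x)).trans (aug_Sq V 1 one_ne_zero x)
      | sq2 => exact (congrArg _ (sq2_smul V x)).trans (aug_Sq V 2 two_ne_zero x)
    | mul a b ha hb => rw [mul_smul]; exact ha _ (hb _ hx)
    | add a b ha hb => rw [add_smul, map_add, ha _ hx, hb _ hx, add_zero]

/-- Reduced mod-2 cohomology `HF^*(B V^♯)`. -/
abbrev HF : Type := reduced V

/-- The degree `d` part of `HF^*(B V^♯)`: the symmetric power `S^d(V)` if `d > 0`, and zero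
otherwise. -/
def HF.grading (d : ℤ) : Submodule 𝔽 (HF V) :=
  if 0 < d then
    (LinearMap.range (SymmetricAlgebra.ι 𝔽 V) ^ d.toNat).comap
      ((reduced V).subtype.restrictScalars 𝔽)
  else ⊥

variable {V} {W : Type} [AddCommGroup W] [Module 𝔽 W]

/-- The algebra morphism `S^*(V) → S^*(W)` induced by a linear map. -/
def Sym.map (f : V →ₗ[𝔽] W) : Sym V →ₐ[𝔽] Sym W :=
  SymmetricAlgebra.lift (SymmetricAlgebra.ι 𝔽 W ∘ₗ f)

theorem Sym.map_ι (f : V →ₗ[𝔽] W) (v : V) :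
    Sym.map f (SymmetricAlgebra.ι 𝔽 V v) = SymmetricAlgebra.ι 𝔽 W (f v) :=
  SymmetricAlgebra.lift_ι_apply _ v

theorem Sym.map_id : Sym.map (LinearMap.id : V →ₗ[𝔽] V) = AlgHom.id 𝔽 _ := by
  apply SymmetricAlgebra.algHom_ext
  ext v
  exact Sym.map_ι _ v

theorem Sym.map_comp {U : Type} [AddCommGroup U] [Module 𝔽 U] (g : W →ₗ[𝔽] U) (f : V →ₗ[𝔽] W) :
    Sym.map (g ∘ₗ f) = (Sym.map g).comp (Sym.map f) := by
  apply SymmetricAlgebra.algHom_ext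
  ext v
  change Sym.map (g ∘ₗ f) (SymmetricAlgebra.ι 𝔽 V v) =
    Sym.map g (Sym.map f (SymmetricAlgebra.ι 𝔽 V v))
  rw [Sym.map_ι, Sym.map_ι, Sym.map_ι]
  rfl

theorem totalSq_map (f : V →ₗ[𝔽] W) (x : Sym V) :
    totalSq W (Sym.map f x) = Polynomial.mapAlgHom (Sym.map f) (totalSq V x) := by
  induction x using SymmetricAlgebra.induction with
  | algebraMap r => rw [AlgHom.commutes, AlgHom.commutes, AlgHom.commutes, AlgHom.commutes]
  | ι v => rw [Sym.map_ι, totalSq_ι, totalSq_ι]; simp [Sym.map_ι]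
  | mul a b ha hb => rw [map_mul, map_mul, map_mul, map_mul, ha, hb]
  | add a b ha hb => rw [map_add, map_add, map_add, map_add, ha, hb]

theorem Sq_map (f : V →ₗ[𝔽] W) (k : ℕ) (x : Sym V) :
    Sq W k (Sym.map f x) = Sym.map f (Sq V k x) := by
  have h := congrArg (fun q => Polynomial.coeff q k) (totalSq_map f x)
  rw [Polynomial.coe_mapAlgHom, Polynomial.coeff_map] at h
  exact h

theorem aug_map (f : V →ₗ[𝔽] W) (x : Sym V) : aug W (Sym.map f x) = aug V x := by
  induction x using SymmetricAlgebra.induction with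
  | algebraMap r => rw [AlgHom.commutes, AlgHom.commutes, AlgHom.commutes]
  | ι v => rw [Sym.map_ι, aug, SymmetricAlgebra.algebraMapInv_ι, SymmetricAlgebra.algebraMapInv_ι]
  | mul a b ha hb => rw [map_mul, map_mul, map_mul, ha, hb]
  | add a b ha hb => rw [map_add, map_add, map_add, ha, hb]

theorem Sym.map_A1_smul (f : V →ₗ[𝔽] W) (a : A1) (x : Sym V) :
    Sym.map f (a • x) = a • Sym.map f x := by
  induction a using A1.induction generalizing x with
  | algebraMap r => rw [algebraMap_smul, algebraMap_smul, map_smul]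
  | gen g =>
    rw [smul_def, smul_def, A1.act_gen, A1.act_gen]
    cases g with
    | sq1 => exact (Sq_map f 1 x).symm
    | sq2 => exact (Sq_map f 2 x).symm
  | mul a b ha hb => rw [mul_smul, ha, hb, mul_smul]
  | add a b ha hb => rw [add_smul, map_add, ha, hb, add_smul]

/-- The morphism of `A(1)`-modules `HF^*(B V^♯) → HF^*(B W^♯)` induced by a linear map
`V → W`. -/
def HF.map (f : V →ₗ[𝔽] W) : HF V →ₗ[A1] HF W :=
  LinearMap.restrict
    ({ toFun := Sym.map f
       map_add' := map_add _
       map_smul' := Sym.map_A1_smul f } : Sym V →ₗ[A1] Sym W)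
    (fun x hx => (aug_map f x).trans hx)

theorem HF.coe_map (f : V →ₗ[𝔽] W) (x : HF V) : (HF.map f x : Sym W) = Sym.map f x := rfl

theorem HF.map_id : HF.map (LinearMap.id : V →ₗ[𝔽] V) = LinearMap.id := by
  refine LinearMap.ext fun x => Subtype.ext ?_
  rw [HF.coe_map, Sym.map_id]
  rfl

theorem HF.map_comp {U : Type} [AddCommGroup U] [Module 𝔽 U] (g : W →ₗ[𝔽] U) (f : V →ₗ[𝔽] W) :
    HF.map (g ∘ₗ f) = HF.map g ∘ₗ HF.map f := by
  refine LinearMap.ext fun x => Subtype.ext ?_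
  rw [HF.coe_map, Sym.map_comp]
  rfl

theorem HF.map_mem (f : V →ₗ[𝔽] W) {d : ℤ} {x : HF V} (hx : x ∈ HF.grading V d) :
    HF.map f x ∈ HF.grading W d := by
  unfold HF.grading at *
  split_ifs with h
  · rw [if_pos h] at hx
    rw [Submodule.mem_comap] at *
    have h1 : (Sym.map f).toLinearMap x.1 ∈
        ((LinearMap.range (SymmetricAlgebra.ι 𝔽 V) ^ d.toNat).map (Sym.map f).toLinearMap) :=
      Submodule.mem_map_of_mem hx
    rw [Submodule.map_pow] at h1
    have h2 : (LinearMap.range (SymmetricAlgebra.ι 𝔽 V)).map (Sym.map f).toLinearMap ≤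
        LinearMap.range (SymmetricAlgebra.ι 𝔽 W) := by
      rintro _ ⟨_, ⟨v, rfl⟩, rfl⟩
      exact ⟨f v, (Sym.map_ι f v).symm⟩
    have h3 := pow_le_pow_left' h2 d.toNat
    exact h3 h1
  · rw [if_neg h, Submodule.mem_bot] at hx
    rw [hx, map_zero]
    exact zero_mem _

end Cohomology

/-! ### Graded morphisms and the cochain complex -/

section GradedHom

variable {M M' N N' : Type} [AddCommGroup M] [Module A1 M] [Module 𝔽 M] [IsScalarTower 𝔽 A1 M]
  [AddCommGroup M'] [Module A1 M'] [Module 𝔽 M'] [IsScalarTower 𝔽 A1 M']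
  [AddCommGroup N] [Module A1 N] [Module 𝔽 N] [AddCommGroup N'] [Module A1 N'] [Module 𝔽 N']

/-- The degree `d` part of the graded vector space `hom_{A(1)}(N, M)`, for graded
`A(1)`-modules `N` and `M`: the `A(1)`-linear maps which raise degrees by `d`. -/
def gradedHom (gN : ℤ → Submodule 𝔽 N) (gM : ℤ → Submodule 𝔽 M) (d : ℤ) :
    Submodule 𝔽 (N →ₗ[A1] M) where
  carrier := {f | ∀ i, ∀ x ∈ gN i, f x ∈ gM (i + d)}
  add_mem' hf hg i x hx := add_mem (hf i x hx) (hg i x hx)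
  zero_mem' _ _ _ := zero_mem _
  smul_mem' c _ hf i x hx := Submodule.smul_mem _ c (hf i x hx)

variable (gN : ℤ → Submodule 𝔽 N) (gM : ℤ → Submodule 𝔽 M) (d : ℤ)

instance : AddCommGroup (gradedHom gN gM d) := inferInstance

instance : Module 𝔽 (gradedHom gN gM d) := inferInstance

variable {gN gM d}

/-- Composition with a morphism of degree zero `g : M → M'`. -/
def gradedHomPost {gM' : ℤ → Submodule 𝔽 M'} (g : M →ₗ[A1] M')
    (hg : ∀ i, ∀ x ∈ gM i, g x ∈ gM' i) : gradedHom gN gM d →ₗ[𝔽] gradedHom gN gM' d where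
  toFun φ := ⟨g ∘ₗ φ.1, fun i x hx => hg _ _ (φ.2 i x hx)⟩
  map_add' _ _ := Subtype.ext (LinearMap.comp_add _ _ _)
  map_smul' c φ := Subtype.ext <| LinearMap.ext fun x =>
    (g.restrictScalars 𝔽).map_smul c (φ.1 x)

/-- Composition with a morphism of degree one `h : N' → N`. -/
def gradedHomPre {gN' : ℤ → Submodule 𝔽 N'} (h : N' →ₗ[A1] N)
    (hh : ∀ i, ∀ x ∈ gN' i, h x ∈ gN (i + 1)) {d' : ℤ} (hd : d' = d + 1) :
    gradedHom gN gM d →ₗ[𝔽] gradedHom gN' gM d' where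
  toFun φ := ⟨φ.1 ∘ₗ h, fun i x hx => by
    have h1 := φ.2 (i + 1) _ (hh i x hx)
    rwa [show i + 1 + d = i + d' by lia] at h1⟩
  map_add' φ ψ := Subtype.ext (LinearMap.add_comp _ _ _)
  map_smul' c φ := Subtype.ext (LinearMap.smul_comp _ _ _)

end GradedHom

/-- The category of functors from finite-dimensional `𝔽`-vector spaces to `𝔽`-vector spaces. -/
abbrev Fct : Type 1 := FGModuleCat.{0} 𝔽 ⥤ ModuleCat.{0} 𝔽

/-- The functor sending `V` to the degree `d` part of `hom_{A(1)}(Fund n, HF^*(B V^♯))`. -/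
def homFunctor (n d : ℤ) : Fct where
  obj V := ModuleCat.of 𝔽 (gradedHom (fundGrading n) (HF.grading V) d)
  map f := ModuleCat.ofHom
    (gradedHomPost (HF.map f.hom.hom) (fun _ _ hx => HF.map_mem f.hom.hom hx))
  map_id V := by
    refine ModuleCat.hom_ext (LinearMap.ext fun φ => Subtype.ext ?_)
    change HF.map LinearMap.id ∘ₗ φ.1 = φ.1
    rw [HF.map_id, LinearMap.id_comp]
  map_comp f g := by
    refine ModuleCat.hom_ext (LinearMap.ext fun φ => Subtype.ext ?_)
    change HF.map (g.hom.hom ∘ₗ f.hom.hom) ∘ₗ φ.1 =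
      HF.map g.hom.hom ∘ₗ (HF.map f.hom.hom ∘ₗ φ.1)
    rw [HF.map_comp, LinearMap.comp_assoc]

/-- The differential of `hom_{A(1)}(Fund, HF^*(B V^♯))`, given by composition with the
differential of the complex of `A(1)`-modules; it has internal degree one. -/
def homD (n d d' : ℤ) (h : d' = d + 1) : homFunctor n d ⟶ homFunctor (n + 1) d' where
  app V := ModuleCat.ofHom (gradedHomPre (fundD n) (fun _ _ hx => fundD_mem hx) h)
  naturality V W f := by
    refine ModuleCat.hom_ext (LinearMap.ext fun φ => Subtype.ext ?_)
    exact LinearMap.comp_assoc _ _ _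

theorem homD_comp (n d d' d'' : ℤ) (h : d' = d + 1) (h' : d'' = d' + 1) :
    homD n d d' h ≫ homD (n + 1) d' d'' h' = 0 := by
  refine NatTrans.ext (funext fun V => ModuleCat.hom_ext (LinearMap.ext fun φ => Subtype.ext ?_))
  change (φ.1 ∘ₗ fundD n) ∘ₗ fundD (n + 1) = 0
  rw [LinearMap.comp_assoc, fundD_comp, LinearMap.comp_zero]

/-- The part of `V ↦ hom_{A(1)}(Fund, HF^*(B V^♯))` in the bidegrees `(n, n + e)`, as a cochain
complex of functors indexed by `n`. -/
def homComplex (e : ℤ) : CochainComplex Fct ℤ :=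
  CochainComplex.of (fun n => homFunctor n (n + e))
    (fun n => homD n (n + e) (n + 1 + e) (by lia))
    (fun n => homD_comp n _ _ _ _ _)

/-- The functor `V ↦ H^n(hom_{A(1)}(Fund, HF^*(B V^♯)))^d`, in cohomological degree `n` and
internal degree `d`. -/
def cohomologyFunctor (n d : ℤ) : Fct := (homComplex (d - n)).homology n

/-! ### Finite functors and their Grothendieck group -/

/-- A functor is finite if it has a finite composition series: a finite chain of subfunctors
from zero to the whole functor, each maximal in the next one. -/
def IsFinite (F : Fct) : Prop :=
  ∃ s : RelSeries {p : Subobject F × Subobject F | p.1 ⋖ p.2}, s.head = ⊥ ∧ s.last = ⊤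

/-- Finite functors. -/
abbrev FiniteFct : Type 1 := {F : Fct // IsFinite F}

/-- The relations `[F] = [F'] + [F'']` for short exact sequences `0 → F' → F → F'' → 0` of finite
functors. -/
def exactRelations : Set (FreeAbelianGroup FiniteFct) :=
  {x | ∃ (S : ShortComplex Fct) (h₁ : IsFinite S.X₁) (h₂ : IsFinite S.X₂) (h₃ : IsFinite S.X₃),
    S.ShortExact ∧ x = FreeAbelianGroup.of ⟨S.X₂, h₂⟩ -
      (FreeAbelianGroup.of ⟨S.X₁, h₁⟩ + FreeAbelianGroup.of ⟨S.X₃, h₃⟩)}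

/-- The Grothendieck group of finite functors. -/
abbrev K₀ : Type 1 := FreeAbelianGroup FiniteFct ⧸ AddSubgroup.closure exactRelations

/-- The class of a finite functor in the Grothendieck group. -/
def cls (F : Fct) (hF : IsFinite F) : K₀ := QuotientAddGroup.mk (FreeAbelianGroup.of ⟨F, hF⟩)

/-! ### Exterior powers and the functors `p_m Ī` -/

/-- The exterior power functor `Λ^m`. -/
def extPower (m : ℕ) : Fct :=
  forget₂ (FGModuleCat 𝔽) (ModuleCat 𝔽) ⋙ ModuleCat.exteriorPower.functor 𝔽 m

/-- A functor has polynomial degree at most `n` if the deviation of any `n + 1` morphisms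
`f₀, …, fₙ : V ⟶ W`, that is `∑_S (-1)^|S| F(∑_{i ∈ S} f_i)`, is zero. -/
def HasPolyDegreeLE (F : Fct) (n : ℕ) : Prop :=
  ∀ (V W : FGModuleCat.{0} 𝔽) (f : Fin (n + 1) → (V ⟶ W)),
    ∑ S : Finset (Fin (n + 1)), (-1 : ℤ) ^ S.card • F.map (∑ i ∈ S, f i) = 0

/-- A subfunctor of a functor: a family of subspaces stable under the induced maps. -/
structure Subfct (F : Fct) where
  /-- The subspaces. -/
  obj (V : FGModuleCat.{0} 𝔽) : Submodule 𝔽 (F.obj V)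
  map_mem {V W : FGModuleCat.{0} 𝔽} (f : V ⟶ W) (x : F.obj V) (hx : x ∈ obj V) :
    F.map f x ∈ obj W

/-- The functor underlying a subfunctor. -/
def Subfct.toFct {F : Fct} (G : Subfct F) : Fct where
  obj V := ModuleCat.of 𝔽 (G.obj V)
  map f := ModuleCat.ofHom ((F.map f).hom.restrict (G.map_mem f))
  map_id V := by
    ext x
    change F.map (𝟙 V) x.1 = x.1
    simp
  map_comp f g := by
    ext x
    change F.map (f ≫ g) x.1 = F.map g (F.map f x.1)
    simp

/-- The largest subfunctor of polynomial degree at most `n`: the sum of all the subfunctors of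
polynomial degree at most `n`. -/
def polyPart (F : Fct) (n : ℕ) : Subfct F where
  obj V := ⨆ G ∈ {G : Subfct F | HasPolyDegreeLE G.toFct n}, G.obj V
  map_mem {V W} f x hx := by
    have h : (⨆ G ∈ {G : Subfct F | HasPolyDegreeLE G.toFct n}, G.obj V) ≤
        (⨆ G ∈ {G : Subfct F | HasPolyDegreeLE G.toFct n}, G.obj W).comap (F.map f).hom :=
      iSup₂_le fun G hG y hy =>
        (le_iSup₂_of_le (f := fun (G : Subfct F) (_ : G ∈ {G : Subfct F |
          HasPolyDegreeLE G.toFct n}) => G.obj W) G hG le_rfl) (G.map_mem f y hy)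
    exact h hx

/-- The functor `Ī : V ↦ {φ : V^♯ → 𝔽 | φ(0) = 0}`. -/
def Ibar : Fct where
  obj V := ModuleCat.of 𝔽
    (LinearMap.ker (LinearMap.proj 0 : (Module.Dual 𝔽 V → 𝔽) →ₗ[𝔽] 𝔽))
  map {V W} f := ModuleCat.ofHom
    ((LinearMap.funLeft 𝔽 𝔽 (Module.Dual.transpose (R := 𝔽) f.hom.hom)).restrict
      (fun φ hφ => by
        simp only [LinearMap.mem_ker, LinearMap.proj_apply] at *
        rw [LinearMap.funLeft_apply, map_zero, hφ]))
  map_id V := by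
    ext φ
    rfl
  map_comp f g := by
    ext φ
    rfl

/-- The functor `p_m Ī`: the largest subfunctor of `Ī` of polynomial degree at most `m`. -/
def pIbar (m : ℕ) : Fct := (polyPart Ibar m).toFct

/-- Given the values `c m` for `m : ℕ`, the element `c m` if the integer `m` is positive, and zero
if `m ≤ 0`. -/
def atPos (c : ℕ → K₀) (m : ℤ) : K₀ := if 0 < m then c m.toNat else 0

end A1Cohomology

end

open A1Cohomology

/-!
Each term of the periodic complex is generated by one element, on which the only relation is
`Sq¹ = 0` (or no relation). Evaluation at the generator (`range_evalOne`, `evalOne_comp`) therefore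
replaces the complex of morphisms by the complex of subspaces

`⋯ → ker Sq¹ → S^* → S^* → ker Sq¹ → ker Sq¹ → ⋯`

of the reduced cohomology `S^*` of `B V^♯`, with differentials `Sq²`, `Sq²`, `Sq³` and
`Sq² Sq¹ Sq²`. Write `T` for its cohomology, in cohomological degree `s` and internal degree `d`,
and `U` for the homology of `Q₁ = Sq¹ Sq² + Sq² Sq¹` on `ker Sq¹`. Since `Sq¹` is exact on reduced
cohomology (`symMod_acyclic`), there is a long exact sequence

`⋯ → T → U → T → T → U → T → ⋯`

in which the map `T → T` raises `s` by one and lowers `d` by one. Its pieces are the lemmas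
`SqMod.corr_A_U`, …, `SqMod.corr_E_A`, which hold for every graded `A(1)`-module on which `Sq¹` is
exact.

*Vanishing.* `T = 0` if `d` is congruent to 1, 2, 3 or 5 modulo 8 (`symMod_exactAt`), by induction on
the dimension of `V`: the cohomology of `W ⊕ 𝔽` is the direct sum of that of `W`, of the cohomology
`P = x 𝔽[x]` of `B(ℤ/2)`, and of the tensor product of the two. For `P` the claim is a computation
(`unitMod_tens_exactAt`). As for `M ⊗ P`, the `A(1)`-module with basis `x⁻¹, x, x², …` is an extension
of a one-dimensional module by `P` on which `Q₁` is exact; its tensor product with `M` has `U = 0`,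
hence `T = 0`, so that the connecting map sends the `T` of `M` onto that of `M ⊗ P`, without changing
`d` (`SqMod.tens_exactAt`).

*The remaining degrees.* Also `U = 0` in odd degrees (`symMod_ZU_le_BU`). In the Grothendieck group
the long exact sequence then expresses the class of `T` by those of `U`: it is `[U]` for a single
degree if `d` is 0 or 4 modulo 8, and a difference `[U_{2k}] - [U_{2k-2}]` if `d` is 6 or 7 modulo 8
(`valT_zero_mod`, `valT_four_mod`, `valT_six_mod`, `valT_seven_mod`).

*The classes of `U`.* By exactness of `Sq¹` once more, `[U_{2m}] - [U_{2m-2}]` is the class of the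
homology of `Q₁` in degree `2m`. The derivation `Q₁` sends `v` to `v⁴`, and its homology in degree
`2m` is `Λ^m`, by `v₁ ∧ ⋯ ∧ v_m ↦ v₁² ⋯ v_m²` (`wedgeSq_injective`, `range_wedgeSq`). On the other
hand `p_{m+1} Ī / p_m Ī` is `Λ^{m+1}` as well, by `v₀ ∧ ⋯ ∧ v_m ↦ v₀ ⋯ v_m`, a function on `V^♯`
(`wedgeFun_injective`, `range_wedgeFun`). Hence `[U_{2m}] = [p_m Ī]` (`valU_eq_cls_pIbar`).

*Finiteness.* A functor of polynomial degree at most `n` with finite-dimensional values is determined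
by its value at `𝔽ⁿ`, so that its subfunctors form a poset of finite length
(`isSmall_of_hasPolyDegreeLE`, `IsSmall.isFinite`). This applies to `S^d` and `p_m Ī`, and `Λ^m` and
the cohomology functors are subquotients of the `S^d`.
-/

noncomputable section

namespace A1Cohomology

/-! ### Graded modules over `A(1)` and the groups attached to them -/

/-- A graded `𝔽`-vector space with operators `a` (acting as `Sq¹`) and `b` (acting as `Sq²`) which
satisfy the relations of `A(1)`. The family `g` of subspaces is not required to decompose the
ambient space `X`: only homogeneous elements are ever used. -/
structure SqMod (X : Type*) [AddCommGroup X] [Module 𝔽 X] where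
  /-- The action of `Sq¹`. -/
  a : X →ₗ[𝔽] X
  /-- The action of `Sq²`. -/
  b : X →ₗ[𝔽] X
  /-- The homogeneous components. -/
  g : ℤ → Submodule 𝔽 X
  a_mem' : ∀ {d : ℤ} {x : X}, x ∈ g d → a x ∈ g (d + 1)
  b_mem' : ∀ {d : ℤ} {x : X}, x ∈ g d → b x ∈ g (d + 2)
  aa : ∀ x, a (a x) = 0
  bb : ∀ x, b (b x) = a (b (a x))

/-- The map `φ` induces an isomorphism from `Q / I` to `Q' / I'`. -/
structure Corr {X Y : Type*} [AddCommGroup X] [Module 𝔽 X] [AddCommGroup Y] [Module 𝔽 Y]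
    (φ : X →ₗ[𝔽] Y) (Q I : Submodule 𝔽 X) (Q' I' : Submodule 𝔽 Y) : Prop where
  le : I ≤ Q
  le' : I' ≤ Q'
  map : ∀ x ∈ Q, φ x ∈ Q'
  iff : ∀ x ∈ Q, φ x ∈ I' ↔ x ∈ I
  surj : ∀ y ∈ Q', ∃ x ∈ Q, y - φ x ∈ I'

theorem mem_comap_of_eq_zero {X Y : Type*} [AddCommGroup X] [Module 𝔽 X] [AddCommGroup Y]
    [Module 𝔽 Y] {φ : X →ₗ[𝔽] Y} {S : Submodule 𝔽 Y} {x : X} (h : φ x = 0) :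
    x ∈ S.comap φ := by
  rw [Submodule.mem_comap, h]; exact zero_mem S

namespace SqMod

variable {X : Type*} [AddCommGroup X] [Module 𝔽 X] (M : SqMod X)

theorem a_mem {d d' : ℤ} {x : X} (h : x ∈ M.g d) (e : d' = d + 1) : M.a x ∈ M.g d' :=
  e ▸ M.a_mem' h

theorem b_mem {d d' : ℤ} {x : X} (h : x ∈ M.g d) (e : d' = d + 2) : M.b x ∈ M.g d' :=
  e ▸ M.b_mem' h

theorem g_mem {d d' : ℤ} {x : X} (h : x ∈ M.g d) (e : d' = d) : x ∈ M.g d' := e ▸ h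

theorem aba (x : X) : M.a (M.b (M.a x)) = M.b (M.b x) := (M.bb x).symm

theorem abb (x : X) : M.a (M.b (M.b x)) = 0 := by rw [M.bb, M.aa]

theorem bba (x : X) : M.b (M.b (M.a x)) = 0 := by rw [M.bb, M.aa, map_zero, map_zero]

theorem bbbb (x : X) : M.b (M.b (M.b (M.b x))) = 0 := by
  rw [M.bb x, M.bba]

/-- The Milnor primitive `Q₁ = Sq¹ Sq² + Sq² Sq¹`. -/
def q : X →ₗ[𝔽] X := M.a ∘ₗ M.b + M.b ∘ₗ M.a

theorem q_apply (x : X) : M.q x = M.a (M.b x) + M.b (M.a x) := rfl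

theorem q_mem {d d' : ℤ} {x : X} (h : x ∈ M.g d) (e : d' = d + 3) : M.q x ∈ M.g d' :=
  add_mem (M.a_mem (M.b_mem h rfl) (by lia)) (M.b_mem (M.a_mem h rfl) (by lia))

theorem aq (x : X) : M.a (M.q x) = M.b (M.b x) := by
  simp [q_apply, M.aa, M.aba]

theorem qa (x : X) : M.q (M.a x) = M.b (M.b x) := by
  simp [q_apply, M.aa, M.aba]

theorem qq (x : X) : M.q (M.q x) = 0 := by
  rw [M.q_apply (M.q x), M.aq, q_apply, map_add, map_add, M.abb, add_zero, M.aba,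
    ZModModule.add_self]

/-- The kernel of `Sq¹` in degree `d`. -/
def K (d : ℤ) : Submodule 𝔽 X := M.g d ⊓ LinearMap.ker M.a

/-! The complex has four kinds of terms, `A` and `E` (kernels of `Sq¹`), `B` and `C` (whole
components), with differentials `Sq²`, `Sq²`, `Sq³` and `Sq² Sq¹ Sq²` out of `A`, `B`, `C` and
`E`. Below, `Z?` and `B?` denote cycles and boundaries at a term of kind `?` in degree `d`, and
`ZU`, `BU` those of `Q₁` on the kernel of `Sq¹`. -/

/-- The cycles at a term of kind `A`. -/
def ZA (d : ℤ) : Submodule 𝔽 X := M.K d ⊓ LinearMap.ker M.b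

/-- The boundaries at a term of kind `A`. -/
def BA (d : ℤ) : Submodule 𝔽 X := (M.K (d - 5)).map (M.b ∘ₗ M.a ∘ₗ M.b)

/-- The cycles at a term of kind `B`. -/
def ZB (d : ℤ) : Submodule 𝔽 X := M.g d ⊓ LinearMap.ker M.b

/-- The boundaries at a term of kind `B`. -/
def BB (d : ℤ) : Submodule 𝔽 X := (M.K (d - 2)).map M.b

/-- The cycles at a term of kind `C`. -/
def ZC (d : ℤ) : Submodule 𝔽 X := M.g d ⊓ LinearMap.ker (M.a ∘ₗ M.b)

/-- The boundaries at a term of kind `C`. -/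
def BC (d : ℤ) : Submodule 𝔽 X := (M.g (d - 2)).map M.b

/-- The cycles at a term of kind `E`. -/
def ZE (d : ℤ) : Submodule 𝔽 X := M.K d ⊓ LinearMap.ker (M.b ∘ₗ M.a ∘ₗ M.b)

/-- The boundaries at a term of kind `E`. -/
def BE (d : ℤ) : Submodule 𝔽 X := (M.g (d - 3)).map (M.a ∘ₗ M.b)

/-- The cycles for `Q₁` on the kernel of `Sq¹`. -/
def ZU (d : ℤ) : Submodule 𝔽 X := M.K d ⊓ LinearMap.ker M.q

/-- The boundaries for `Q₁` on the kernel of `Sq¹`. -/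
def BU (d : ℤ) : Submodule 𝔽 X := (M.K (d - 3)).map M.q

/-! The groups `T = Z / B` and `U = ZU / BU` form a long exact sequence
`A → U → A → B → U → B → C → U → C → E → U → E → A → ⋯`, in which each kind of term stands for the
group `T` at that term. The maps are induced by `1`, `Sq²`, `1`, `Sq¹`, `*`, `1`, `Sq²`, `1`, `Sq¹`,
`*`, `1`, `Sq³`, where the maps `*` are not induced by elements of `A(1)`, but by the
correspondences `Sq¹ y ↦ Sq² y` from `U` to `B` and `Sq¹ y ↦ Sq³ y` from `E` to `U`, with graphs
parametrised by `VB` and `VE`. The kernels of the maps `T → U`, `T → T` and `U → T` are induced by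
the subspaces `J?`, `L?` and `W?`. -/

/-- The kernel of `T → U` at a term of kind `A`. -/
def JA (d : ℤ) : Submodule 𝔽 X := M.ZA d ⊓ M.BU d

/-- The kernel of `T → T` at a term of kind `A`. -/
def LA (d : ℤ) : Submodule 𝔽 X := M.ZA d ⊓ M.BB d

/-- The kernel of `T → U` at a term of kind `B`. -/
def JB (d : ℤ) : Submodule 𝔽 X := M.ZB d ⊓ (M.BU (d + 1)).comap M.a

/-- The kernel of `T → T` at a term of kind `B`. -/
def LB (d : ℤ) : Submodule 𝔽 X := M.ZB d ⊓ M.BC d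

/-- The kernel of `T → U` at a term of kind `C`. -/
def JC (d : ℤ) : Submodule 𝔽 X := M.ZC d ⊓ (M.BU (d + 2)).comap M.b

/-- The kernel of `T → T` at a term of kind `C`. -/
def LC (d : ℤ) : Submodule 𝔽 X := M.ZC d ⊓ (M.BE (d + 1)).comap M.a

/-- The source of the correspondence `Sq¹ y ↦ Sq³ y` from a term of kind `E` to `U`. -/
def VE (d : ℤ) : Submodule 𝔽 X := M.g (d - 1) ⊓ LinearMap.ker (M.b ∘ₗ M.a ∘ₗ M.b ∘ₗ M.a)

/-- The kernel of the correspondence with source `VE`. -/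
def IE (d : ℤ) : Submodule 𝔽 X := M.g (d - 1) ⊓ (M.BU (d + 2)).comap (M.a ∘ₗ M.b)

/-- The kernel of `T → U` at a term of kind `E`. -/
def JE (d : ℤ) : Submodule 𝔽 X := (M.IE d).map M.a

/-- The kernel of `T → T` at a term of kind `E`. -/
def LE (d : ℤ) : Submodule 𝔽 X := M.ZE d ⊓ (M.BA (d + 3)).comap (M.a ∘ₗ M.b)

/-- The kernel of `U → T` to a term of kind `A`. -/
def WA (d : ℤ) : Submodule 𝔽 X := M.ZU d ⊓ (M.BA (d + 2)).comap M.b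

/-- The source of the correspondence `Sq¹ y ↦ Sq² y` from `U` to a term of kind `B`. -/
def VB (d : ℤ) : Submodule 𝔽 X := M.g (d - 1) ⊓ LinearMap.ker (M.a ∘ₗ M.b ∘ₗ M.a)

/-- The kernel of the correspondence with source `VB`. -/
def IB (d : ℤ) : Submodule 𝔽 X := M.g (d - 1) ⊓ (M.BB (d + 1)).comap M.b

/-- The kernel of `U → T` to a term of kind `B`. -/
def WB (d : ℤ) : Submodule 𝔽 X := (M.IB d).map M.a

/-- The kernel of `U → T` to a term of kind `C`. -/
def WC (d : ℤ) : Submodule 𝔽 X := M.ZU d ⊓ M.BC d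

/-- The kernel of `U → T` to a term of kind `E`. -/
def WE (d : ℤ) : Submodule 𝔽 X := M.ZU d ⊓ M.BE d

/-- `Sq¹` is exact: `ker Sq¹ = im Sq¹` in each degree. -/
def Acyclic : Prop := ∀ {d : ℤ} {x : X}, x ∈ M.g d → M.a x = 0 → ∃ y ∈ M.g (d - 1), M.a y = x

/-- `Q₁` is exact. -/
def QAcyclic : Prop := ∀ {d : ℤ} {x : X}, x ∈ M.g d → M.q x = 0 → ∃ y ∈ M.g (d - 3), M.q y = x

/-- The components of degree at most `d` vanish. -/
def VanishesBelow (d : ℤ) : Prop := ∀ i ≤ d, M.g i = ⊥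

theorem mem_K {d : ℤ} {x : X} : x ∈ M.K d ↔ x ∈ M.g d ∧ M.a x = 0 := Iff.rfl

theorem mem_ZA {d : ℤ} {x : X} : x ∈ M.ZA d ↔ x ∈ M.g d ∧ M.a x = 0 ∧ M.b x = 0 := and_assoc

theorem mem_ZB {d : ℤ} {x : X} : x ∈ M.ZB d ↔ x ∈ M.g d ∧ M.b x = 0 := Iff.rfl

theorem mem_ZC {d : ℤ} {x : X} : x ∈ M.ZC d ↔ x ∈ M.g d ∧ M.a (M.b x) = 0 := Iff.rfl

theorem mem_ZE {d : ℤ} {x : X} :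
    x ∈ M.ZE d ↔ x ∈ M.g d ∧ M.a x = 0 ∧ M.b (M.a (M.b x)) = 0 := and_assoc

theorem mem_ZU {d : ℤ} {x : X} : x ∈ M.ZU d ↔ x ∈ M.g d ∧ M.a x = 0 ∧ M.a (M.b x) = 0 := by
  rw [ZU, Submodule.mem_inf, mem_K, and_assoc, LinearMap.mem_ker, q_apply]
  refine and_congr_right fun _ => and_congr_right fun h => ?_
  rw [h, map_zero, add_zero]

theorem mem_BE {d : ℤ} {x : X} : x ∈ M.BE d ↔ ∃ y ∈ M.g (d - 3), M.a (M.b y) = x := Iff.rfl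

/-! The lemma `corr_P_Q` expresses the exactness of the sequence at the end `Q` of the map `P → Q`:
the coimage of the map is its image, which is the kernel of the next map. The two correspondences
have two lemmas each, one for either end of the graph. All of this but the case of `U → C` rests on
the exactness of `Sq¹`. -/

theorem corr_U_C (d : ℤ) : Corr LinearMap.id (M.ZU d) (M.WC d) (M.LC d) (M.BC d) where
  le := inf_le_left
  le' x hx := by
    obtain ⟨s, hs, rfl⟩ := hx
    exact ⟨M.mem_ZC.2 ⟨M.b_mem hs (by lia), M.abb s⟩, s, M.g_mem hs (by lia), rfl⟩
  map x hx := by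
    obtain ⟨h1, h2, h3⟩ := M.mem_ZU.1 hx
    refine ⟨M.mem_ZC.2 ⟨h1, h3⟩, ?_⟩
    exact mem_comap_of_eq_zero h2
  iff x hx := ⟨fun h => ⟨hx, h⟩, fun h => h.2⟩
  surj x hx := by
    obtain ⟨h1, s, hs, e⟩ := hx
    have e : M.a (M.b s) = M.a x := e
    have h2 : M.a (M.b x) = 0 := h1.2
    refine ⟨x - M.b s, M.mem_ZU.2 ⟨sub_mem h1.1 (M.b_mem hs (by lia)), ?_, ?_⟩, ?_⟩
    · rw [map_sub, e, sub_self]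
    · rw [map_sub, map_sub, h2, M.abb, sub_zero]
    · rw [LinearMap.id_apply, sub_sub_cancel]; exact ⟨s, M.g_mem hs (by lia), rfl⟩

section

variable {M}
variable (hM : M.Acyclic)
include hM

/-- By exactness of `Sq¹`, the image of the kernel of `Sq¹` under an operator is the image of a
whole component. -/
theorem map_K {d d' : ℤ} (e : d = d' - 1) (φ : X →ₗ[𝔽] X) :
    (M.K d').map φ = (M.g d).map (φ ∘ₗ M.a) := by
  ext x
  constructor
  · rintro ⟨k, ⟨hk, hk'⟩, rfl⟩
    obtain ⟨y, hy, rfl⟩ := hM hk hk'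
    exact ⟨y, e ▸ hy, rfl⟩
  · rintro ⟨y, hy, rfl⟩
    exact ⟨M.a y, ⟨M.a_mem hy (by lia), M.aa y⟩, rfl⟩

theorem mem_BA {d : ℤ} {x : X} :
    x ∈ M.BA d ↔ ∃ y ∈ M.g (d - 6), M.b (M.b (M.b y)) = x := by
  rw [BA, map_K hM (d := d - 6) (by lia)]
  simp only [Submodule.mem_map, LinearMap.comp_apply, M.aba]

theorem mem_BB {d : ℤ} {x : X} : x ∈ M.BB d ↔ ∃ y ∈ M.g (d - 3), M.b (M.a y) = x := by
  rw [BB, map_K hM (d := d - 3) (by lia)]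
  rfl

theorem mem_BU {d : ℤ} {x : X} : x ∈ M.BU d ↔ ∃ y ∈ M.g (d - 4), M.b (M.b y) = x := by
  rw [BU, map_K hM (d := d - 4) (by lia)]
  simp only [Submodule.mem_map, LinearMap.comp_apply, M.qa]

theorem corr_A_U (d : ℤ) : Corr LinearMap.id (M.ZA d) (M.JA d) (M.WA d) (M.BU d) where
  le := inf_le_left
  le' x hx := by
    obtain ⟨y, hy, rfl⟩ := (mem_BU hM).1 hx
    refine ⟨M.mem_ZU.2 ⟨M.b_mem (M.b_mem hy rfl) (by lia), M.abb y, M.abb _⟩, ?_⟩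
    exact (mem_BA hM).2 ⟨y, M.g_mem hy (by lia), rfl⟩
  map x hx := by
    obtain ⟨h1, h2, h3⟩ := M.mem_ZA.1 hx
    refine ⟨M.mem_ZU.2 ⟨h1, h2, ?_⟩, ?_⟩
    · rw [LinearMap.id_apply, h3, map_zero]
    · exact mem_comap_of_eq_zero h3
  iff x hx := ⟨fun h => ⟨hx, h⟩, fun h => h.2⟩
  surj x hx := by
    obtain ⟨h1, h2⟩ := hx
    obtain ⟨g1, g2, g3⟩ := M.mem_ZU.1 h1
    obtain ⟨y, hy, e⟩ := (mem_BA hM).1 h2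
    refine ⟨x - M.b (M.b y), M.mem_ZA.2 ⟨sub_mem g1 (M.b_mem (M.b_mem hy rfl) (by lia)), ?_, ?_⟩,
      ?_⟩
    · rw [map_sub, g2, M.abb, sub_zero]
    · rw [map_sub, e, sub_self]
    · rw [LinearMap.id_apply, sub_sub_cancel]
      exact (mem_BU hM).2 ⟨y, M.g_mem hy (by lia), rfl⟩

theorem corr_U_A (d : ℤ) : Corr M.b (M.ZU d) (M.WA d) (M.LA (d + 2)) (M.BA (d + 2)) where
  le := inf_le_left
  le' x hx := by
    obtain ⟨y, hy, rfl⟩ := (mem_BA hM).1 hx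
    refine ⟨M.mem_ZA.2 ⟨M.b_mem (M.b_mem (M.b_mem hy rfl) rfl) (by lia), M.abb _, M.bbbb y⟩, ?_⟩
    exact (mem_BB hM).2 ⟨M.b (M.a y), M.b_mem (M.a_mem hy rfl) (by lia), by rw [M.aba]⟩
  map x hx := by
    obtain ⟨h1, h2, h3⟩ := M.mem_ZU.1 hx
    refine ⟨M.mem_ZA.2 ⟨M.b_mem h1 rfl, h3, ?_⟩, ?_⟩
    · rw [M.bb, h2, map_zero, map_zero]
    · exact ⟨x, ⟨M.g_mem h1 (by lia), h2⟩, rfl⟩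
  iff x hx := ⟨fun h => ⟨hx, h⟩, fun h => h.2⟩
  surj x hx := by
    obtain ⟨h1, k, ⟨hk, hk'⟩, rfl⟩ := hx
    refine ⟨k, M.mem_ZU.2 ⟨M.g_mem hk (by lia), hk', (M.mem_ZA.1 h1).2.1⟩, ?_⟩
    rw [sub_self]; exact zero_mem _

theorem corr_A_B (d : ℤ) : Corr LinearMap.id (M.ZA d) (M.LA d) (M.JB d) (M.BB d) where
  le := inf_le_left
  le' x hx := by
    obtain ⟨y, hy, rfl⟩ := (mem_BB hM).1 hx
    refine ⟨M.mem_ZB.2 ⟨M.b_mem (M.a_mem hy rfl) (by lia), M.bba y⟩, ?_⟩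
    exact (mem_BU hM).2 ⟨y, M.g_mem hy (by lia), (M.aba y).symm⟩
  map x hx := by
    obtain ⟨h1, h2, h3⟩ := M.mem_ZA.1 hx
    refine ⟨⟨h1, h3⟩, ?_⟩
    exact mem_comap_of_eq_zero h2
  iff x hx := ⟨fun h => ⟨hx, h⟩, fun h => h.2⟩
  surj x hx := by
    obtain ⟨⟨h1, h1'⟩, h2⟩ := hx
    obtain ⟨y, hy, e⟩ := (mem_BU hM).1 h2
    have h1' : M.b x = 0 := h1'
    refine ⟨x - M.b (M.a y), M.mem_ZA.2 ⟨sub_mem h1 (M.b_mem (M.a_mem hy rfl) (by lia)), ?_, ?_⟩,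
      ?_⟩
    · rw [map_sub, M.aba, e, sub_self]
    · rw [map_sub, h1', M.bba, sub_zero]
    · rw [LinearMap.id_apply, sub_sub_cancel]
      exact (mem_BB hM).2 ⟨y, M.g_mem hy (by lia), rfl⟩

theorem corr_B_U (d : ℤ) : Corr M.a (M.ZB d) (M.JB d) (M.WB (d + 1)) (M.BU (d + 1)) where
  le := inf_le_left
  le' x hx := by
    obtain ⟨y, hy, rfl⟩ := (mem_BU hM).1 hx
    refine ⟨M.b (M.a y), ⟨M.b_mem (M.a_mem hy rfl) (by lia), ?_⟩, M.aba y⟩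
    exact mem_comap_of_eq_zero (M.bba y)
  map x hx := by
    obtain ⟨h1, h2⟩ := M.mem_ZB.1 hx
    refine ⟨x, ⟨M.g_mem h1 (by lia), ?_⟩, rfl⟩
    exact mem_comap_of_eq_zero h2
  iff x hx := ⟨fun h => ⟨hx, h⟩, fun h => h.2⟩
  surj x hx := by
    obtain ⟨s, ⟨hs, hs'⟩, rfl⟩ := hx
    obtain ⟨y, hy, e⟩ := (mem_BB hM).1 hs'
    refine ⟨s - M.a y, M.mem_ZB.2 ⟨sub_mem (M.g_mem hs (by lia)) (M.a_mem hy (by lia)), ?_⟩, ?_⟩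
    · rw [map_sub, e, sub_self]
    · rw [map_sub, M.aa, sub_zero, sub_self]; exact zero_mem _

theorem corr_VB_U (d : ℤ) : Corr M.a (M.VB d) (M.IB d) (M.ZU d) (M.WB d) where
  le x hx := by
    obtain ⟨hs, hs'⟩ := hx
    obtain ⟨y, hy, e⟩ := (mem_BB hM).1 hs'
    refine ⟨hs, ?_⟩
    change M.a (M.b (M.a x)) = 0
    rw [M.aba, ← e, M.bba]
  le' x hx := by
    obtain ⟨s, ⟨hs, hs'⟩, rfl⟩ := hx
    obtain ⟨y, hy, e⟩ := (mem_BB hM).1 hs'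
    refine M.mem_ZU.2 ⟨M.a_mem hs (by lia), M.aa s, ?_⟩
    rw [M.aba, ← e, M.bba]
  map x hx := M.mem_ZU.2 ⟨M.a_mem hx.1 (by lia), M.aa x, hx.2⟩
  iff x hx := by
    refine ⟨fun h => ?_, fun h => ⟨x, h, rfl⟩⟩
    obtain ⟨s, ⟨hs, hs'⟩, e⟩ := h
    obtain ⟨w, hw, e'⟩ := hM (sub_mem hx.1 hs) (by rw [map_sub, e, sub_self])
    refine ⟨hx.1, ?_⟩
    rw [show x = s + M.a w by rw [e']; abel]
    exact Submodule.add_mem (Submodule.comap _ _) hs' ((mem_BB hM).2 ⟨w, M.g_mem hw (by lia), rfl⟩)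
  surj x hx := by
    obtain ⟨h1, h2, h3⟩ := M.mem_ZU.1 hx
    obtain ⟨s, hs, rfl⟩ := hM h1 h2
    refine ⟨s, ⟨hs, h3⟩, ?_⟩
    rw [sub_self]; exact zero_mem _

theorem corr_VB_B (d : ℤ) : Corr M.b (M.VB d) (M.IB d) (M.LB (d + 1)) (M.BB (d + 1)) where
  le := (corr_VB_U hM d).le
  le' x hx := by
    obtain ⟨y, hy, rfl⟩ := (mem_BB hM).1 hx
    exact ⟨M.mem_ZB.2 ⟨M.b_mem (M.a_mem hy rfl) (by lia), M.bba y⟩,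
      M.a y, M.a_mem hy (by lia), rfl⟩
  map x hx := by
    have h2 : M.a (M.b (M.a x)) = 0 := hx.2
    exact ⟨M.mem_ZB.2 ⟨M.b_mem hx.1 (by lia), by rw [M.bb, h2]⟩, x, M.g_mem hx.1 (by lia), rfl⟩
  iff x hx := ⟨fun h => ⟨hx.1, h⟩, fun h => h.2⟩
  surj x hx := by
    obtain ⟨⟨_, h1⟩, s, hs, rfl⟩ := hx
    refine ⟨s, ⟨M.g_mem hs (by lia), ?_⟩, ?_⟩
    · change M.a (M.b (M.a s)) = 0
      rw [M.aba]; exact h1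
    · rw [sub_self]; exact zero_mem _

theorem corr_B_C (d : ℤ) : Corr LinearMap.id (M.ZB d) (M.LB d) (M.JC d) (M.BC d) where
  le := inf_le_left
  le' x hx := by
    obtain ⟨s, hs, rfl⟩ := hx
    exact ⟨M.mem_ZC.2 ⟨M.b_mem hs (by lia), M.abb s⟩,
      (mem_BU hM).2 ⟨s, M.g_mem hs (by lia), rfl⟩⟩
  map x hx := by
    obtain ⟨h1, h2⟩ := M.mem_ZB.1 hx
    refine ⟨M.mem_ZC.2 ⟨h1, ?_⟩, ?_⟩
    · rw [LinearMap.id_apply, h2, map_zero]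
    · exact mem_comap_of_eq_zero h2
  iff x hx := ⟨fun h => ⟨hx, h⟩, fun h => h.2⟩
  surj x hx := by
    obtain ⟨h1, h2⟩ := hx
    obtain ⟨y, hy, e⟩ := (mem_BU hM).1 h2
    refine ⟨x - M.b y, M.mem_ZB.2 ⟨sub_mem h1.1 (M.b_mem hy (by lia)), ?_⟩, ?_⟩
    · rw [map_sub, e, sub_self]
    · rw [LinearMap.id_apply, sub_sub_cancel]; exact ⟨y, M.g_mem hy (by lia), rfl⟩

theorem corr_C_U (d : ℤ) : Corr M.b (M.ZC d) (M.JC d) (M.WC (d + 2)) (M.BU (d + 2)) where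
  le := inf_le_left
  le' x hx := by
    obtain ⟨y, hy, rfl⟩ := (mem_BU hM).1 hx
    exact ⟨M.mem_ZU.2 ⟨M.b_mem (M.b_mem hy rfl) (by lia), M.abb y, M.abb _⟩,
      M.b y, M.b_mem hy (by lia), rfl⟩
  map x hx := by
    obtain ⟨h1, h2⟩ := M.mem_ZC.1 hx
    exact ⟨M.mem_ZU.2 ⟨M.b_mem h1 rfl, h2, M.abb x⟩, x, M.g_mem h1 (by lia), rfl⟩
  iff x hx := ⟨fun h => ⟨hx, h⟩, fun h => h.2⟩
  surj x hx := by
    obtain ⟨h1, s, hs, rfl⟩ := hx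
    refine ⟨s, M.mem_ZC.2 ⟨M.g_mem hs (by lia), (M.mem_ZU.1 h1).2.1⟩, ?_⟩
    rw [sub_self]; exact zero_mem _

theorem corr_C_E (d : ℤ) : Corr M.a (M.ZC d) (M.LC d) (M.JE (d + 1)) (M.BE (d + 1)) where
  le := inf_le_left
  le' x hx := by
    obtain ⟨y, hy, rfl⟩ := hx
    refine ⟨M.b y, ⟨M.b_mem hy (by lia), ?_⟩, rfl⟩
    exact mem_comap_of_eq_zero (M.abb y)
  map x hx := by
    obtain ⟨h1, h2⟩ := M.mem_ZC.1 hx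
    refine ⟨x, ⟨M.g_mem h1 (by lia), ?_⟩, rfl⟩
    exact mem_comap_of_eq_zero h2
  iff x hx := ⟨fun h => ⟨hx, h⟩, fun h => h.2⟩
  surj x hx := by
    obtain ⟨y, ⟨hy, hy'⟩, rfl⟩ := hx
    obtain ⟨w, hw, e⟩ := (mem_BU hM).1 hy'
    have e : M.b (M.b w) = M.a (M.b y) := e
    refine ⟨y - M.a w, M.mem_ZC.2 ⟨sub_mem (M.g_mem hy (by lia)) (M.a_mem hw (by lia)), ?_⟩, ?_⟩
    · rw [map_sub, map_sub, M.aba, e, sub_self]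
    · rw [map_sub, M.aa, sub_zero, sub_self]; exact zero_mem _

theorem corr_VE_E (d : ℤ) : Corr M.a (M.VE d) (M.IE d) (M.ZE d) (M.JE d) where
  le x hx := by
    obtain ⟨w, hw, e⟩ := (mem_BU hM).1 hx.2
    have e : M.b (M.b w) = M.a (M.b x) := e
    refine ⟨hx.1, ?_⟩
    change M.b (M.a (M.b (M.a x))) = 0
    rw [M.aba, ← M.aba, ← e, M.abb]
  le' x hx := by
    obtain ⟨y, hy, rfl⟩ := hx
    obtain ⟨w, hw, e⟩ := (mem_BU hM).1 hy.2
    have e : M.b (M.b w) = M.a (M.b y) := e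
    refine M.mem_ZE.2 ⟨M.a_mem hy.1 (by lia), M.aa y, ?_⟩
    rw [M.aba, ← M.aba, ← e, M.abb]
  map x hx := M.mem_ZE.2 ⟨M.a_mem hx.1 (by lia), M.aa x, hx.2⟩
  iff x hx := by
    refine ⟨fun h => ?_, fun h => ⟨x, h, rfl⟩⟩
    obtain ⟨s, ⟨hs, hs'⟩, e⟩ := h
    obtain ⟨w, hw, e'⟩ := hM (sub_mem hx.1 hs) (by rw [map_sub, e, sub_self])
    refine ⟨hx.1, ?_⟩
    rw [show x = s + M.a w by rw [e']; abel]
    exact Submodule.add_mem (Submodule.comap _ _) hs' ((mem_BU hM).2 ⟨w, M.g_mem hw (by lia),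
      (M.aba w).symm⟩)
  surj x hx := by
    obtain ⟨h1, h2, h3⟩ := M.mem_ZE.1 hx
    obtain ⟨s, hs, rfl⟩ := hM h1 h2
    refine ⟨s, ⟨hs, h3⟩, ?_⟩
    rw [sub_self]; exact zero_mem _

theorem corr_VE_U (d : ℤ) :
    Corr (M.a ∘ₗ M.b) (M.VE d) (M.IE d) (M.WE (d + 2)) (M.BU (d + 2)) where
  le := (corr_VE_E hM d).le
  le' x hx := by
    obtain ⟨y, hy, rfl⟩ := (mem_BU hM).1 hx
    exact ⟨M.mem_ZU.2 ⟨M.b_mem (M.b_mem hy rfl) (by lia), M.abb y, M.abb _⟩,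
      M.a y, M.a_mem hy (by lia), M.aba y⟩
  map x hx := by
    have h2 : M.b (M.a (M.b (M.a x))) = 0 := hx.2
    refine ⟨M.mem_ZU.2 ⟨M.a_mem (M.b_mem hx.1 rfl) (by lia), M.aa _, ?_⟩,
      x, M.g_mem hx.1 (by lia), rfl⟩
    rw [LinearMap.comp_apply, M.aba, ← h2, M.aba]
  iff x hx := ⟨fun h => ⟨hx.1, h⟩, fun h => h.2⟩
  surj x hx := by
    obtain ⟨h1, y, hy, rfl⟩ := hx
    refine ⟨y, ⟨M.g_mem hy (by lia), ?_⟩, ?_⟩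
    · have h2 := (M.mem_ZU.1 h1).2.2
      change M.b (M.a (M.b (M.a y))) = 0
      rw [M.aba]
      rwa [LinearMap.comp_apply, M.aba] at h2
    · rw [sub_self]; exact zero_mem _

theorem corr_U_E (d : ℤ) : Corr LinearMap.id (M.ZU d) (M.WE d) (M.LE d) (M.BE d) where
  le := inf_le_left
  le' x hx := by
    obtain ⟨y, hy, rfl⟩ := hx
    refine ⟨M.mem_ZE.2 ⟨M.a_mem (M.b_mem hy rfl) (by lia), M.aa _, ?_⟩, ?_⟩
    · rw [LinearMap.comp_apply, M.aba, M.bbbb]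
    · exact (mem_BA hM).2 ⟨y, M.g_mem hy (by lia), (M.aba _).symm⟩
  map x hx := by
    obtain ⟨h1, h2, h3⟩ := M.mem_ZU.1 hx
    refine ⟨M.mem_ZE.2 ⟨h1, h2, ?_⟩, ?_⟩
    · rw [LinearMap.id_apply, h3, map_zero]
    · exact mem_comap_of_eq_zero h3
  iff x hx := ⟨fun h => ⟨hx, h⟩, fun h => h.2⟩
  surj x hx := by
    obtain ⟨h1, h2⟩ := hx
    obtain ⟨g1, g2, g3⟩ := M.mem_ZE.1 h1
    obtain ⟨y, hy, e⟩ := (mem_BA hM).1 h2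
    have e : M.b (M.b (M.b y)) = M.a (M.b x) := e
    refine ⟨x - M.a (M.b y), M.mem_ZU.2 ⟨sub_mem g1 (M.a_mem (M.b_mem hy rfl) (by lia)), ?_, ?_⟩,
      ?_⟩
    · rw [map_sub, g2, M.aa, sub_zero]
    · rw [map_sub, map_sub, M.aba, e, sub_self]
    · rw [LinearMap.id_apply, sub_sub_cancel]; exact ⟨y, M.g_mem hy (by lia), rfl⟩

theorem corr_E_A (d : ℤ) :
    Corr (M.a ∘ₗ M.b) (M.ZE d) (M.LE d) (M.JA (d + 3)) (M.BA (d + 3)) where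
  le := inf_le_left
  le' x hx := by
    obtain ⟨y, hy, rfl⟩ := (mem_BA hM).1 hx
    refine ⟨M.mem_ZA.2 ⟨M.b_mem (M.b_mem (M.b_mem hy rfl) rfl) (by lia), M.abb _, M.bbbb y⟩, ?_⟩
    exact (mem_BU hM).2 ⟨M.b y, M.b_mem hy (by lia), rfl⟩
  map x hx := by
    obtain ⟨g1, g2, g3⟩ := M.mem_ZE.1 hx
    refine ⟨M.mem_ZA.2 ⟨M.a_mem (M.b_mem g1 rfl) (by lia), M.aa _, g3⟩, ?_⟩
    obtain ⟨y, hy, rfl⟩ := hM g1 g2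
    exact (mem_BU hM).2 ⟨y, M.g_mem hy (by lia), (M.aba y).symm⟩
  iff x hx := ⟨fun h => ⟨hx, h⟩, fun h => h.2⟩
  surj x hx := by
    obtain ⟨h1, h2⟩ := hx
    obtain ⟨y, hy, rfl⟩ := (mem_BU hM).1 h2
    refine ⟨M.a y, M.mem_ZE.2 ⟨M.a_mem hy (by lia), M.aa y, ?_⟩, ?_⟩
    · rw [M.aba]; exact (M.mem_ZA.1 h1).2.2
    · rw [LinearMap.comp_apply, M.aba, sub_self]; exact zero_mem _

end

end SqMod

/-! ### Vanishing of corresponding subquotients -/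

theorem Corr.le_of_le' {X Y : Type*} [AddCommGroup X] [Module 𝔽 X] [AddCommGroup Y] [Module 𝔽 Y]
    {φ : X →ₗ[𝔽] Y} {Q I : Submodule 𝔽 X} {Q' I' : Submodule 𝔽 Y} (h : Corr φ Q I Q' I')
    (h' : Q' ≤ I') : Q ≤ I :=
  fun x hx => (h.iff x hx).1 (h' (h.map x hx))

theorem Corr.le'_of_le {X Y : Type*} [AddCommGroup X] [Module 𝔽 X] [AddCommGroup Y] [Module 𝔽 Y]
    {φ : X →ₗ[𝔽] Y} {Q I : Submodule 𝔽 X} {Q' I' : Submodule 𝔽 Y} (h : Corr φ Q I Q' I')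
    (h' : Q ≤ I) : Q' ≤ I' := fun y hy => by
  obtain ⟨x, hx, e⟩ := h.surj y hy
  rw [← sub_add_cancel y (φ x)]
  exact add_mem e ((h.iff x hx).2 (h' hx))

namespace SqMod

variable {X : Type*} [AddCommGroup X] [Module 𝔽 X] (M : SqMod X)

/-! ### The groups `U` and the homology of `Q₁` -/

/-- The cycles for `Q₁`. -/
def ZH (d : ℤ) : Submodule 𝔽 X := M.g d ⊓ LinearMap.ker M.q
/-- The boundaries for `Q₁`. -/
def BH (d : ℤ) : Submodule 𝔽 X := (M.g (d - 3)).map M.q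

/-- The source of the correspondence `Sq¹ z ↦ Q₁ z` between `U` in degrees `d - 2` and `d`. -/
def VH (d : ℤ) : Submodule 𝔽 X := M.g (d - 3) ⊓ LinearMap.ker (M.a ∘ₗ M.q)
/-- The kernel of the correspondence with source `VH`. -/
def IH (d : ℤ) : Submodule 𝔽 X := M.g (d - 3) ⊓ (M.BU (d - 2)).comap M.a

variable {M}

theorem BU_le_ZU (hM : M.Acyclic) (d : ℤ) : M.BU d ≤ M.ZU d := by
  intro x hx
  obtain ⟨y, hy, rfl⟩ := (mem_BU hM).1 hx
  exact M.mem_ZU.2 ⟨M.b_mem (M.b_mem hy rfl) (by lia), M.abb y, M.abb _⟩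

/-- If `U` vanishes in degree `d + 1`, then every `Q₁`-cycle in degree `d` is homologous to one in
the kernel of `Sq¹`. -/
theorem corr_U_H (hM : M.Acyclic) {d : ℤ} (hd : M.ZU (d + 1) ≤ M.BU (d + 1)) :
    Corr LinearMap.id (M.ZU d) (M.ZU d ⊓ M.BH d) (M.ZH d) (M.BH d) where
  le := inf_le_left
  le' x hx := by
    obtain ⟨y, hy, rfl⟩ := hx
    exact ⟨M.q_mem hy (by lia), M.qq y⟩
  map x hx := ⟨hx.1.1, hx.2⟩
  iff x hx := ⟨fun h => ⟨hx, h⟩, fun h => h.2⟩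
  surj z hz := by
    have hq : M.q z = 0 := hz.2
    have h1 : M.a z ∈ M.ZU (d + 1) := by
      refine ⟨⟨M.a_mem hz.1 rfl, M.aa z⟩, ?_⟩
      exact LinearMap.mem_ker.2 (by rw [M.qa, ← M.aq, hq, map_zero])
    obtain ⟨w, hw, e⟩ := (mem_BU hM).1 (hd h1)
    refine ⟨z - M.q w, ⟨⟨sub_mem hz.1 (M.q_mem hw (by lia)), ?_⟩, ?_⟩, ?_⟩
    · exact LinearMap.mem_ker.2 (by rw [map_sub, M.aq, e, sub_self])
    · exact LinearMap.mem_ker.2 (by rw [map_sub, M.qq, hq, sub_zero])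
    · rw [LinearMap.id_apply, sub_sub_cancel]; exact ⟨w, M.g_mem hw (by lia), rfl⟩

/-- One end of the correspondence `Sq¹ z ↦ Q₁ z`: it is defined on all of `U`. -/
theorem corr_VH_U (hM : M.Acyclic) (d : ℤ) :
    Corr M.a (M.VH d) (M.IH d) (M.ZU (d - 2)) (M.BU (d - 2)) where
  le x hx := by
    obtain ⟨w, hw, e⟩ := (mem_BU hM).1 hx.2
    refine ⟨hx.1, ?_⟩
    exact LinearMap.mem_ker.2 (by rw [LinearMap.comp_apply, M.aq, ← M.qa, ← e, ← M.qa, M.qq])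
  le' := BU_le_ZU hM _
  map x hx := by
    have h2 : M.a (M.q x) = 0 := hx.2
    refine ⟨⟨M.a_mem hx.1 (by lia), M.aa x⟩, ?_⟩
    exact LinearMap.mem_ker.2 (by rw [M.qa, ← M.aq, h2])
  iff x hx := ⟨fun h => ⟨hx.1, h⟩, fun h => h.2⟩
  surj x hx := by
    obtain ⟨s, hs, rfl⟩ := hM hx.1.1 hx.1.2
    have h2 : M.q (M.a s) = 0 := hx.2
    refine ⟨s, ⟨M.g_mem hs (by lia), ?_⟩, ?_⟩
    · exact LinearMap.mem_ker.2 (by rw [LinearMap.comp_apply, M.aq, ← M.qa, h2])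
    · rw [sub_self]; exact zero_mem _

/-- The other end of the correspondence `Sq¹ z ↦ Q₁ z`: its image is the kernel of the map from `U`
to `Q₁`-homology, and it is injective if `Q₁`-homology vanishes in degree `d - 3`. -/
theorem corr_VH_H (hM : M.Acyclic) {d : ℤ} (hd : M.ZH (d - 3) ≤ M.BH (d - 3)) :
    Corr M.q (M.VH d) (M.IH d) (M.ZU d ⊓ M.BH d) (M.BU d) where
  le := (corr_VH_U hM d).le
  le' x hx := by
    refine ⟨BU_le_ZU hM d hx, ?_⟩
    obtain ⟨y, hy, rfl⟩ := hx
    exact ⟨y, hy.1, rfl⟩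
  map x hx := ⟨⟨⟨M.q_mem hx.1 (by lia), hx.2⟩, M.qq x⟩, x, hx.1, rfl⟩
  iff x hx := by
    constructor
    · intro h
      obtain ⟨w, hw, e⟩ := (mem_BU hM).1 h
      rw [← M.qa] at e
      have h1 : x - M.a w ∈ M.ZH (d - 3) :=
        ⟨sub_mem hx.1 (M.a_mem hw (by lia)), LinearMap.mem_ker.2 (by rw [map_sub, e, sub_self])⟩
      obtain ⟨r, hr, e'⟩ := hd h1
      refine ⟨hx.1, (mem_BU hM).2 ⟨r, M.g_mem hr (by lia), ?_⟩⟩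
      rw [← M.aq, e', map_sub, M.aa, sub_zero]
    · rintro ⟨-, h⟩
      obtain ⟨w, hw, e⟩ := (mem_BU hM).1 h
      rw [← M.aq] at e
      obtain ⟨v, hv, e'⟩ := hM (sub_mem hx.1 (M.q_mem hw (by lia)))
        (by rw [map_sub, e, sub_self])
      refine (mem_BU hM).2 ⟨v, M.g_mem hv (by lia), ?_⟩
      rw [← M.qa, e', map_sub, M.qq, sub_zero]
  surj x hx := by
    obtain ⟨h1, s, hs, rfl⟩ := hx
    refine ⟨s, ⟨hs, h1.1.2⟩, ?_⟩
    rw [sub_self]; exact zero_mem _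

theorem VanishesBelow.eq_zero {c d : ℤ} (h : M.VanishesBelow c) {x : X} (hx : x ∈ M.g d)
    (hd : d ≤ c) : x = 0 := by
  rw [h d hd] at hx
  exact hx

/-- If `Q₁` is exact in the degrees `d, d - 2, d - 4, …`, then `U` vanishes in degree `d`. -/
theorem ZU_le_BU (hM : M.Acyclic) {c : ℤ} (hc : M.VanishesBelow c) (P : ℤ → Prop)
    (hP : ∀ d, P d → P (d - 2)) (hH : ∀ d, P d → M.ZH d ≤ M.BH d) {d : ℤ} (hd : P d) :
    M.ZU d ≤ M.BU d := by
  obtain ⟨n, hn⟩ : ∃ n : ℕ, d ≤ c + n := ⟨(d - c).toNat, by lia⟩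
  induction n using Nat.strong_induction_on generalizing d with
  | _ n ih =>
    intro x hx
    by_cases h0 : d ≤ c
    · rw [hc.eq_zero hx.1.1 h0]; exact zero_mem _
    have h1 : M.ZU (d - 2) ≤ M.BU (d - 2) := by
      by_cases h1 : d - 2 ≤ c
      · intro y hy
        rw [hc.eq_zero hy.1.1 h1]; exact zero_mem _
      · exact ih (n - 2) (by lia) (hP d hd) (by lia)
    obtain ⟨z, hz, rfl⟩ := hH d hd ⟨hx.1.1, hx.2⟩
    have hz2 : M.a (M.q z) = 0 := hx.1.2
    have h2 : M.a z ∈ M.ZU (d - 2) :=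
      ⟨⟨M.a_mem hz (by lia), M.aa z⟩, LinearMap.mem_ker.2 (by rw [M.qa, ← M.aq, hz2])⟩
    obtain ⟨w, hw, e⟩ := (mem_BU hM).1 (h1 h2)
    rw [← M.aq] at e
    refine ⟨z - M.q w, ⟨sub_mem hz (M.q_mem hw (by lia)), ?_⟩, ?_⟩
    · exact LinearMap.mem_ker.2 (by rw [map_sub, e, sub_self])
    · rw [map_sub, M.qq, sub_zero]

/-! ### The complex, and its exactness -/

/-- The choice of one of four objects according to the residue of `s` modulo 4. -/
def _root_.A1Cohomology.byMod {α : Type*} (s : ℤ) (x₀ x₁ x₂ x₃ : α) : α :=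
  if s % 4 = 0 then x₀ else if s % 4 = 1 then x₁ else if s % 4 = 2 then x₂ else x₃

variable (M)

/-- The term of cohomological degree `s` of the complex; `t` is the difference of the internal and
the cohomological degrees. -/
def term (s t : ℤ) : Submodule 𝔽 X :=
  byMod s (M.K (t + 3 * s)) (M.g (t + 3 * s - 1)) (M.g (t + 3 * s - 2)) (M.K (t + 3 * s - 2))

/-- The differential out of the term of cohomological degree `s`. -/
def diff (s : ℤ) : X →ₗ[𝔽] X :=
  byMod s M.b M.b (M.a ∘ₗ M.b) (M.b ∘ₗ M.a ∘ₗ M.b)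

/-- The cycles in the term of cohomological degree `s`. -/
def Z (s t : ℤ) : Submodule 𝔽 X := M.term s t ⊓ LinearMap.ker (M.diff s)

/-- The boundaries in the term of cohomological degree `s`. -/
def B (s t : ℤ) : Submodule 𝔽 X := (M.term (s - 1) t).map (M.diff (s - 1))

/-- The kernel of the map `T → U` in cohomological degree `s`. -/
def J (s t : ℤ) : Submodule 𝔽 X :=
  byMod s (M.JA (t + 3 * s)) (M.JB (t + 3 * s - 1)) (M.JC (t + 3 * s - 2)) (M.JE (t + 3 * s - 2))

/-- The kernel of the map `T → T` in cohomological degree `s`. -/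
def L (s t : ℤ) : Submodule 𝔽 X :=
  byMod s (M.LA (t + 3 * s)) (M.LB (t + 3 * s - 1)) (M.LC (t + 3 * s - 2)) (M.LE (t + 3 * s - 2))

/-- The kernel of the map `U → T` to cohomological degree `s`. -/
def W (s d : ℤ) : Submodule 𝔽 X := byMod s (M.WA d) (M.WB d) (M.WC d) (M.WE d)

/-- The complex is exact in cohomological degree `s`. -/
def ExactAt (s t : ℤ) : Prop := M.Z s t ≤ M.B s t

theorem Z_eq (s t : ℤ) : M.Z s t = byMod s (M.ZA (t + 3 * s)) (M.ZB (t + 3 * s - 1))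
    (M.ZC (t + 3 * s - 2)) (M.ZE (t + 3 * s - 2)) := by
  unfold Z term diff byMod
  split_ifs <;> rfl

theorem _root_.A1Cohomology.mod_four_cases' (s : ℤ) :
    (s % 4 = 0 ∧ (s - 1) % 4 = 3) ∨ (s % 4 = 1 ∧ (s - 1) % 4 = 0) ∨
      (s % 4 = 2 ∧ (s - 1) % 4 = 1) ∨ (s % 4 = 3 ∧ (s - 1) % 4 = 2) := by
  lia

theorem B_eq (s t : ℤ) : M.B s t = byMod s (M.BA (t + 3 * s)) (M.BB (t + 3 * s - 1))
    (M.BC (t + 3 * s - 2)) (M.BE (t + 3 * s - 2)) := by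
  unfold B term diff byMod BA BB BC BE
  rcases mod_four_cases' s with ⟨h, h'⟩ | ⟨h, h'⟩ | ⟨h, h'⟩ | ⟨h, h'⟩ <;>
    simp only [h, h'] <;> norm_num <;> congr 2 <;> lia

variable {M}

theorem exact_B (hM : M.Acyclic) (hU : ∀ d, M.ZU d ≤ M.BU d) {d : ℤ} (h : M.ZA d ≤ M.BA d) :
    M.ZB d ≤ M.BB d := by
  have h1 : M.BA d ≤ M.LA d := by simpa using (corr_U_A hM (d - 2)).le'
  exact ((corr_B_U hM d).le_of_le' ((corr_VB_U hM _).le'.trans (hU _))).trans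
    ((corr_A_B hM d).le'_of_le (h.trans h1))

theorem exact_C (hM : M.Acyclic) (hU : ∀ d, M.ZU d ≤ M.BU d) {d : ℤ} (h : M.ZB d ≤ M.BB d) :
    M.ZC d ≤ M.BC d := by
  have h1 : M.BB d ≤ M.LB d := by simpa using (corr_VB_B hM (d - 1)).le'
  exact ((corr_C_U hM d).le_of_le' ((M.corr_U_C _).le.trans (hU _))).trans
    ((corr_B_C hM d).le'_of_le (h.trans h1))

theorem exact_E (hM : M.Acyclic) (hU : ∀ d, M.ZU d ≤ M.BU d) {d : ℤ} (h : M.ZC d ≤ M.BC d) :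
    M.ZE (d + 1) ≤ M.BE (d + 1) :=
  ((corr_VE_E hM _).le'_of_le ((corr_VE_U hM _).le_of_le' ((corr_U_E hM _).le.trans (hU _)))).trans
    ((corr_C_E hM d).le'_of_le (h.trans (M.corr_U_C d).le'))

theorem exact_A (hM : M.Acyclic) (hU : ∀ d, M.ZU d ≤ M.BU d) {d : ℤ} (h : M.ZE d ≤ M.BE d) :
    M.ZA (d + 3) ≤ M.BA (d + 3) :=
  ((corr_A_U hM _).le_of_le' ((corr_U_A hM _).le.trans (hU _))).trans
    ((corr_E_A hM d).le'_of_le (h.trans (corr_U_E hM d).le'))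

/-- If `U` vanishes, then the map `T → T` is surjective. -/
theorem ExactAt.succ (hM : M.Acyclic) (hU : ∀ d, M.ZU d ≤ M.BU d) {s t : ℤ}
    (h : M.ExactAt s (t + 2)) : M.ExactAt (s + 1) t := by
  unfold ExactAt at *
  rw [Z_eq, B_eq] at *
  unfold byMod at *
  rcases mod_four_cases s with ⟨e, e'⟩ | ⟨e, e'⟩ | ⟨e, e'⟩ | ⟨e, e'⟩ <;>
    simp only [e, e'] at h ⊢ <;> norm_num at h ⊢
  · rw [show t + 3 * (s + 1) - 1 = t + 2 + 3 * s by ring]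
    exact exact_B hM hU h
  · rw [show t + 3 * (s + 1) - 2 = t + 2 + 3 * s - 1 by ring]
    exact exact_C hM hU h
  · rw [show t + 3 * (s + 1) - 2 = t + 2 + 3 * s - 2 + 1 by ring]
    exact exact_E hM hU h
  · rw [show t + 3 * (s + 1) = t + 2 + 3 * s - 2 + 3 by ring]
    exact exact_A hM hU h

theorem term_le {s t : ℤ} {x : X} (h : x ∈ M.term s t) : ∃ d ≤ t + 3 * s, x ∈ M.g d := by
  unfold term byMod at h
  split_ifs at h
  exacts [⟨_, le_rfl, h.1⟩, ⟨_, by lia, h⟩, ⟨_, by lia, h⟩, ⟨_, by lia, h.1⟩]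

/-- The complex is exact in low degrees. -/
theorem exactAt_of_le {c : ℤ} (hc : M.VanishesBelow c) {s t : ℤ} (h : t + 3 * s ≤ c) :
    M.ExactAt s t := by
  rintro x ⟨hx, -⟩
  obtain ⟨d, hd, hx⟩ := term_le hx
  rw [hc.eq_zero hx (hd.trans h)]
  exact zero_mem _

/-- If `U` vanishes, then the complex is exact. -/
theorem exactAt_of_ZU_le_BU (hM : M.Acyclic) {c : ℤ} (hc : M.VanishesBelow c)
    (hU : ∀ d, M.ZU d ≤ M.BU d) (s t : ℤ) : M.ExactAt s t := by
  have key : ∀ (n : ℕ) (s t : ℤ), t + 3 * s ≤ c + n → M.ExactAt s t := by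
    intro n
    induction n with
    | zero => exact fun s t h => exactAt_of_le hc (by simpa using h)
    | succ n ih =>
      intro s t h
      rw [← sub_add_cancel s 1]
      exact ExactAt.succ hM hU (ih _ _ (by push_cast at h; lia))
  exact key (t + 3 * s - c).toNat s t (by lia)

end SqMod

/-! ### Tensor products with the cohomology of `B(ℤ/2)` -/

theorem cast_eq_ite (n : ℕ) : (n : 𝔽) = if n % 2 = 0 then 0 else 1 := by
  split_ifs with h
  · exact (ZMod.natCast_eq_zero_iff_even).2 (Nat.even_iff.2 h)
  · exact (ZMod.natCast_eq_one_iff_odd).2 (Nat.odd_iff.2 (by lia))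

theorem choose_two_cast (n : ℕ) :
    (n.choose 2 : 𝔽) = if n % 4 = 2 ∨ n % 4 = 3 then 1 else 0 := by
  induction n with
  | zero => simp
  | succ n ih =>
    rw [Nat.choose_succ_succ' n 1, Nat.choose_one_right, Nat.cast_add, ih, cast_eq_ite]
    have h : n % 4 = 0 ∨ n % 4 = 1 ∨ n % 4 = 2 ∨ n % 4 = 3 := by lia
    rcases h with h | h | h | h
    · simp [h, show (n + 1) % 4 = 1 by lia, show n % 2 = 0 by lia]
    · simp [h, show (n + 1) % 4 = 2 by lia, show n % 2 = 1 by lia]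
    · simp [h, show (n + 1) % 4 = 3 by lia, show n % 2 = 0 by lia]
    · simp [h, show (n + 1) % 4 = 0 by lia, show n % 2 = 1 by lia]
      decide

namespace SqMod

variable {X : Type*} [AddCommGroup X] [Module 𝔽 X] (M : SqMod X)

/-- `Sq¹` on `M ⊗ x 𝔽[x]`. -/
def tensA : (ℕ → X) →ₗ[𝔽] (ℕ → X) :=
  LinearMap.pi fun i => M.a ∘ₗ LinearMap.proj i + (i : 𝔽) • LinearMap.proj (i - 1)

/-- `Sq²` on `M ⊗ x 𝔽[x]`. -/
def tensB : (ℕ → X) →ₗ[𝔽] (ℕ → X) :=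
  LinearMap.pi fun i => M.b ∘ₗ LinearMap.proj i + (i : 𝔽) • (M.a ∘ₗ LinearMap.proj (i - 1)) +
    ((i - 1).choose 2 : 𝔽) • LinearMap.proj (i - 2)

theorem tensA_apply (f : ℕ → X) (i : ℕ) : M.tensA f i = M.a (f i) + (i : 𝔽) • f (i - 1) := rfl

theorem tensB_apply (f : ℕ → X) (i : ℕ) : M.tensB f i = M.b (f i) + (i : 𝔽) • M.a (f (i - 1)) +
    ((i - 1).choose 2 : 𝔽) • f (i - 2) := rfl

theorem tensA_tensA (f : ℕ → X) : M.tensA (M.tensA f) = 0 := by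
  funext i
  simp only [tensA_apply, map_add, map_smul, M.aa, Pi.zero_apply, smul_add, zero_add]
  rw [← add_assoc, ZModModule.add_self, zero_add, smul_smul, ← Nat.cast_mul, cast_eq_ite, if_pos,
    zero_smul]
  rcases i with _ | i
  · simp
  · rw [mul_comm, Nat.add_sub_cancel]; exact Nat.even_iff.1 (Nat.even_mul_succ_self i)

theorem eq_of_eq_add_self {x y : X} (z : X) (h : x = y + (z + z)) : x = y := by
  rw [h, ZModModule.add_self, add_zero]

theorem tensB_tensB (f : ℕ → X) : M.tensB (M.tensB f) = M.tensA (M.tensB (M.tensA f)) := by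
  have h2 : ∀ x : X, x + x = 0 := ZModModule.add_self
  funext i
  match i with
  | 0 => simp [tensA_apply, tensB_apply, M.bb]
  | 1 => simp [tensA_apply, tensB_apply, M.bb, M.aa]; abel
  | 2 =>
    simp only [tensA_apply, tensB_apply, map_add, map_smul, M.bb, M.aa, choose_two_cast]
    simp [show (2 : 𝔽) = 0 from rfl]
  | 3 =>
    simp only [tensA_apply, tensB_apply, map_add, map_smul, M.bb, M.aa, choose_two_cast]
    simp [show (2 : 𝔽) = 0 from rfl, show (3 : 𝔽) = 1 from rfl]
    refine eq_of_eq_add_self (M.b (f 1)) ?_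
    abel
  | k + 4 =>
    have h : k % 4 = 0 ∨ k % 4 = 1 ∨ k % 4 = 2 ∨ k % 4 = 3 := by lia
    simp only [tensA_apply, tensB_apply, map_add, map_smul, M.bb, M.aa,
      show k + 4 - 1 = k + 3 from rfl, show k + 4 - 2 = k + 2 from rfl,
      show k + 3 - 1 = k + 2 from rfl, show k + 3 - 2 = k + 1 from rfl,
      show k + 2 - 1 = k + 1 from rfl, show k + 2 - 2 = k from rfl,
      show k + 1 - 1 = k from rfl, choose_two_cast]
    simp only [cast_eq_ite]
    rcases h with h | h | h | h
    · simp [show (k + 1) % 2 = 1 by lia, show (k + 2) % 2 = 0 by lia,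
        show (k + 3) % 2 = 1 by lia, show (k + 4) % 2 = 0 by lia,
        show (k + 1) % 4 = 1 by lia, show (k + 2) % 4 = 2 by lia, show (k + 3) % 4 = 3 by lia]
      rw [add_assoc, h2, add_zero]
    · simp [show (k + 1) % 2 = 0 by lia, show (k + 2) % 2 = 1 by lia,
        show (k + 3) % 2 = 0 by lia, show (k + 4) % 2 = 1 by lia,
        show (k + 1) % 4 = 2 by lia, show (k + 2) % 4 = 3 by lia, show (k + 3) % 4 = 0 by lia]
      abel
    · simp [show (k + 1) % 2 = 1 by lia, show (k + 2) % 2 = 0 by lia,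
        show (k + 3) % 2 = 1 by lia, show (k + 4) % 2 = 0 by lia,
        show (k + 1) % 4 = 3 by lia, show (k + 2) % 4 = 0 by lia, show (k + 3) % 4 = 1 by lia]
    · simp [show (k + 1) % 2 = 0 by lia, show (k + 2) % 2 = 1 by lia,
        show (k + 3) % 2 = 0 by lia, show (k + 4) % 2 = 1 by lia,
        show (k + 1) % 4 = 0 by lia, show (k + 2) % 4 = 1 by lia, show (k + 3) % 4 = 2 by lia]
      refine eq_of_eq_add_self (M.b (f (k + 2))) ?_
      abel

/-- The tensor product of `M` with the reduced cohomology `x 𝔽[x]` of `B(ℤ/2)`: the value of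
`f : ℕ → X` at `i` is the coefficient of `x ^ (i + 1)`. -/
def tens : SqMod (ℕ → X) where
  a := M.tensA
  b := M.tensB
  g d := Submodule.pi Set.univ fun i => M.g (d - i - 1)
  a_mem' {d f} hf i _ := by
    refine add_mem (M.a_mem (hf i trivial) (by lia)) ?_
    rcases i with _ | i
    · simp
    · exact Submodule.smul_mem _ _ (M.g_mem (hf i trivial) (by push_cast; lia))
  b_mem' {d f} hf i _ := by
    refine add_mem (add_mem (M.b_mem (hf i trivial) (by lia)) ?_) ?_
    · rcases i with _ | i
      · simp
      · exact Submodule.smul_mem _ _ (M.a_mem (hf i trivial) (by push_cast; lia))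
    · rcases i with _ | _ | i
      · simp
      · simp
      · exact Submodule.smul_mem _ _ (M.g_mem (hf i trivial) (by push_cast; lia))
  aa := M.tensA_tensA
  bb := M.tensB_tensB

theorem mem_tens {d : ℤ} {f : ℕ → X} : f ∈ M.tens.g d ↔ ∀ i : ℕ, f i ∈ M.g (d - i - 1) :=
  ⟨fun h i => h i trivial, fun h i _ => h i⟩

theorem smul_even {Y : Type*} [AddCommGroup Y] [Module 𝔽 Y] {i : ℕ} (h : i % 2 = 0) (x : Y) :
    (i : 𝔽) • x = 0 := by
  rw [cast_eq_ite, if_pos h, zero_smul]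

theorem smul_odd {Y : Type*} [AddCommGroup Y] [Module 𝔽 Y] {i : ℕ} (h : i % 2 = 1) (x : Y) :
    (i : 𝔽) • x = x := by
  rw [cast_eq_ite, if_neg (by lia), one_smul]

/-- `Sq¹` is exact on the tensor product, since it is on `x 𝔽[x]`: the contracting homotopy sends
`x ^ (2k)` to `x ^ (2k - 1)`. -/
theorem tens_acyclic : M.tens.Acyclic := by
  intro d f hf h0
  have h1 : ∀ i, M.a (f i) + (i : 𝔽) • f (i - 1) = 0 := fun i => congrFun h0 i
  refine ⟨fun i => if i % 2 = 0 then f (i + 1) else 0, M.mem_tens.2 fun i => ?_, funext fun i => ?_⟩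
  · split_ifs with h
    · exact M.g_mem (M.mem_tens.1 hf (i + 1)) (by push_cast; lia)
    · exact zero_mem _
  · change M.a (if i % 2 = 0 then f (i + 1) else 0) +
      (i : 𝔽) • (if (i - 1) % 2 = 0 then f (i - 1 + 1) else 0) = f i
    by_cases h : i % 2 = 0
    · have h2 := h1 (i + 1)
      rw [smul_odd (by lia), Nat.add_sub_cancel] at h2
      rw [if_pos h, smul_even h, add_zero]
      rw [← sub_eq_zero, ZModModule.sub_eq_add, h2]
    · rw [if_neg h, map_zero, zero_add, smul_odd (by lia), if_pos (by lia),
        Nat.sub_add_cancel (by lia)]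

/-- The product with the class `x`. -/
def tensX : X →ₗ[𝔽] (ℕ → X) := LinearMap.single 𝔽 (fun _ => X) 0

theorem tensX_mem {d d' : ℤ} {x : X} (h : x ∈ M.g d) (e : d' = d + 1) :
    tensX x ∈ M.tens.g d' := M.mem_tens.2 fun i => by
  rcases i with _ | i
  · exact M.g_mem h (by push_cast; lia)
  · exact zero_mem _

theorem tensX_rel (x : X) : M.tensB (tensX x) + tensX (M.b x) = M.tensA (tensX (M.a x)) := by
  funext i
  have e : ∀ (y : X) (i : ℕ), (tensX y : ℕ → X) i = if i = 0 then y else 0 := by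
    intro y i
    rw [tensX, LinearMap.single_apply, Pi.single_apply]
  simp only [tensA_apply, tensB_apply, Pi.add_apply, e]
  match i with
  | 0 => simp [M.aa, ZModModule.add_self]
  | 1 => simp
  | 2 => simp
  | k + 3 => simp

/-- The extension of `M` by `M ⊗ x 𝔽[x]` obtained as the tensor product of `M` with the
module with basis `x⁻¹, x, x², …`, in which `Sq¹ x⁻¹ = 0` and `Sq² x⁻¹ = x`. The first component
is the coefficient of `x⁻¹`. -/
def ext : SqMod (X × (ℕ → X)) where
  a := M.a.prodMap M.tensA
  b := (M.b ∘ₗ LinearMap.fst 𝔽 X (ℕ → X)).prod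
    (M.tensB ∘ₗ LinearMap.snd 𝔽 X (ℕ → X) + tensX ∘ₗ LinearMap.fst 𝔽 X (ℕ → X))
  g d := (M.g (d + 1)).prod (M.tens.g d)
  a_mem' h := ⟨M.a_mem h.1 (by lia), M.tens.a_mem h.2 rfl⟩
  b_mem' h := ⟨M.b_mem h.1 (by lia),
    add_mem (M.tens.b_mem h.2 rfl) (M.tensX_mem h.1 (by lia))⟩
  aa x := Prod.ext (M.aa x.1) (M.tensA_tensA x.2)
  bb x := by
    refine Prod.ext (M.bb x.1) ?_
    change M.tensB (M.tensB x.2 + tensX x.1) + tensX (M.b x.1) =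
      M.tensA (M.tensB (M.tensA x.2) + tensX (M.a x.1))
    rw [map_add, map_add, add_assoc, M.tensX_rel, M.tensB_tensB]

theorem ext_a (x : X × (ℕ → X)) : M.ext.a x = (M.a x.1, M.tens.a x.2) := rfl

theorem ext_b (x : X × (ℕ → X)) : M.ext.b x = (M.b x.1, M.tens.b x.2 + tensX x.1) := rfl

theorem ext_acyclic (hM : M.Acyclic) : M.ext.Acyclic := by
  intro d x hx h0
  obtain ⟨y, hy, e⟩ := hM hx.1 (congrArg Prod.fst h0)
  obtain ⟨z, hz, e'⟩ := M.tens_acyclic hx.2 (congrArg Prod.snd h0)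
  exact ⟨(y, z), ⟨M.g_mem hy (by lia), hz⟩, Prod.ext e e'⟩

theorem vanishesBelow_tens {c : ℤ} (hc : M.VanishesBelow c) : M.tens.VanishesBelow c := by
  intro d hd
  refine (Submodule.eq_bot_iff _).2 fun f hf => funext fun i => ?_
  exact hc.eq_zero (M.mem_tens.1 hf i) (by lia)

theorem vanishesBelow_ext {c : ℤ} (hc : M.VanishesBelow c) : M.ext.VanishesBelow (c - 1) := by
  intro d hd
  refine (Submodule.eq_bot_iff _).2 fun f hf => Prod.ext (hc.eq_zero hf.1 (by lia)) ?_
  exact (M.vanishesBelow_tens hc).eq_zero hf.2 (by lia)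

theorem tens_q_apply (f : ℕ → X) (i : ℕ) :
    M.tens.q f i = M.q (f i) + if i % 2 = 1 ∧ i ≠ 1 then f (i - 3) else 0 := by
  have h2 : ∀ x : X, x + x = 0 := ZModModule.add_self
  change M.tensA (M.tensB f) i + M.tensB (M.tensA f) i = M.a (M.b (f i)) + M.b (M.a (f i)) + _
  match i with
  | 0 => simp [tensA_apply, tensB_apply]
  | 1 =>
    simp [tensA_apply, tensB_apply, M.aa]
    exact eq_of_eq_add_self (M.b (f 0)) (by abel)
  | 2 =>
    simp [tensA_apply, tensB_apply, M.aa, show (2 : 𝔽) = 0 from rfl]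
  | k + 3 =>
    have h : k % 4 = 0 ∨ k % 4 = 1 ∨ k % 4 = 2 ∨ k % 4 = 3 := by lia
    simp only [tensA_apply, tensB_apply, map_add, map_smul, M.aa,
      show k + 3 - 1 = k + 2 from rfl, show k + 3 - 2 = k + 1 from rfl,
      show k + 2 - 1 = k + 1 from rfl, show k + 2 - 2 = k from rfl,
      show k + 1 - 1 = k from rfl, show k + 3 - 3 = k from rfl, choose_two_cast]
    simp only [cast_eq_ite]
    rcases h with h | h | h | h
    · simp [show (k + 1) % 2 = 1 by lia, show (k + 2) % 2 = 0 by lia, show (k + 3) % 2 = 1 by lia,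
        show (k + 1) % 4 = 1 by lia, show (k + 2) % 4 = 2 by lia]
      refine eq_of_eq_add_self (M.b (f (k + 2)) + M.a (f (k + 1))) ?_
      abel
    · simp [show (k + 1) % 2 = 0 by lia, show (k + 2) % 2 = 1 by lia, show (k + 3) % 2 = 0 by lia,
        show (k + 1) % 4 = 2 by lia, show (k + 2) % 4 = 3 by lia]
      refine eq_of_eq_add_self (M.a (f (k + 1))) ?_
      abel
    · simp [show (k + 1) % 2 = 1 by lia, show (k + 2) % 2 = 0 by lia, show (k + 3) % 2 = 1 by lia,
        show (k + 1) % 4 = 3 by lia, show (k + 2) % 4 = 0 by lia]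
      refine eq_of_eq_add_self (M.b (f (k + 2))) ?_
      abel
    · simp [show (k + 1) % 2 = 0 by lia, show (k + 2) % 2 = 1 by lia, show (k + 3) % 2 = 0 by lia,
        show (k + 1) % 4 = 0 by lia, show (k + 2) % 4 = 1 by lia]

theorem ext_q_apply (x : X) (f : ℕ → X) (i : ℕ) :
    (M.ext.q (x, f)).2 i = M.tens.q f i + if i = 1 then x else 0 := by
  have e : ∀ (y : X) (i : ℕ), (tensX y : ℕ → X) i = if i = 0 then y else 0 := by
    intro y i
    rw [tensX, LinearMap.single_apply, Pi.single_apply]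
  change M.tensA (M.tensB f + tensX x) i + (M.tensB (M.tensA f) + tensX (M.a x)) i =
    M.tensA (M.tensB f) i + M.tensB (M.tensA f) i + _
  rw [map_add, Pi.add_apply, Pi.add_apply, tensA_apply M (tensX x), e, e, e]
  match i with
  | 0 =>
    simp
    exact eq_of_eq_add_self (M.a x) (by abel)
  | 1 => simp; abel
  | k + 2 => simp

/-- The module with basis `x⁻¹, x, x², …` is exact for `Q₁`, with contracting homotopy
`x ^ (2k + 2) ↦ x ^ (2k - 1)`, and hence so are its tensor products. -/
theorem ext_qAcyclic : M.ext.QAcyclic := by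
  intro d z hz h0
  obtain ⟨x, f⟩ := z
  have h1 : ∀ i, M.q (f i) + (if i % 2 = 1 ∧ i ≠ 1 then f (i - 3) else 0) +
      (if i = 1 then x else 0) = 0 := fun i => by
    rw [← tens_q_apply, ← ext_q_apply, h0]; rfl
  have h2 : ∀ {x y : X}, x + y = 0 → x = y := fun h => by
    rwa [← ZModModule.sub_eq_add, sub_eq_zero] at h
  refine ⟨(f 1, fun i => if i % 2 = 0 then f (i + 3) else 0), ⟨?_, ?_⟩, Prod.ext ?_ ?_⟩
  · exact M.g_mem (M.mem_tens.1 hz.2 1) (by push_cast; lia)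
  · refine M.mem_tens.2 fun i => ?_
    change (if i % 2 = 0 then f (i + 3) else 0) ∈ _
    split_ifs with h
    · exact M.g_mem (M.mem_tens.1 hz.2 (i + 3)) (by push_cast; lia)
    · exact zero_mem _
  · have := h1 1
    simp only [ne_eq, not_true_eq_false, and_false, if_false, if_true, add_zero] at this
    exact h2 this
  · funext i
    rw [ext_q_apply, tens_q_apply]
    by_cases h : i % 2 = 0
    · have := h1 (i + 3)
      rw [if_pos ⟨by lia, by lia⟩, if_neg (by lia), add_zero, Nat.add_sub_cancel] at this
      rw [if_pos h, if_neg (by lia), if_neg (by lia), add_zero, add_zero]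
      exact h2 this
    · rw [if_neg h, map_zero, zero_add]
      by_cases h3 : i = 1
      · subst h3; simp
      · rw [if_pos ⟨by lia, h3⟩, if_pos (by lia), if_neg h3, add_zero,
          Nat.sub_add_cancel (by lia)]

/-- The complex of the tensor product with the module with basis `x⁻¹, x, x², …` is exact. -/
theorem ext_exactAt (hM : M.Acyclic) {c : ℤ} (hc : M.VanishesBelow c) (s t : ℤ) :
    M.ext.ExactAt s t := by
  refine exactAt_of_ZU_le_BU (M.ext_acyclic hM) (M.vanishesBelow_ext hc) (fun d => ?_) s t
  exact ZU_le_BU (M.ext_acyclic hM) (M.vanishesBelow_ext hc) (fun _ => True) (fun _ h => h)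
    (fun d _ x hx => M.ext_qAcyclic hx.1 hx.2) trivial

theorem mem_term_ext {s t : ℤ} {x : X × (ℕ → X)} :
    x ∈ M.ext.term s t ↔ x.1 ∈ M.term s (t + 1) ∧ x.2 ∈ M.tens.term s t := by
  have hg : ∀ {d d' : ℤ} (_ : d' = d + 1), x ∈ M.ext.g d ↔ x.1 ∈ M.g d' ∧ x.2 ∈ M.tens.g d := by
    rintro d d' rfl
    exact Iff.rfl
  have hK : ∀ {d d' : ℤ} (_ : d' = d + 1), x ∈ M.ext.K d ↔ x.1 ∈ M.K d' ∧ x.2 ∈ M.tens.K d := by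
    rintro d d' rfl
    rw [mem_K, ext_a, Prod.mk_eq_zero, mem_K, mem_K, hg rfl]
    tauto
  unfold term byMod
  split_ifs
  exacts [hK (by lia), hg (by lia), hg (by lia), hK (by lia)]

theorem diff_mem {s t : ℤ} {x : X} (h : x ∈ M.term s t) : M.diff s x ∈ M.term (s + 1) t := by
  unfold term diff byMod at *
  rcases mod_four_cases s with ⟨e, e'⟩ | ⟨e, e'⟩ | ⟨e, e'⟩ | ⟨e, e'⟩ <;>
    simp only [e, e'] at h ⊢ <;> norm_num at h ⊢
  · exact M.b_mem h.1 (by lia)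
  · exact M.b_mem h (by lia)
  · exact ⟨M.a_mem (M.b_mem h rfl) (by lia), M.aa _⟩
  · refine ⟨M.b_mem (M.a_mem (M.b_mem h.1 rfl) rfl) (by lia), ?_⟩
    have h2 : M.a x = 0 := h.2
    exact LinearMap.mem_ker.2 (by rw [M.aba, M.bb x, h2,
      map_zero, map_zero, map_zero])

theorem diff_diff {s t : ℤ} {x : X} (h : x ∈ M.term s t) : M.diff (s + 1) (M.diff s x) = 0 := by
  unfold term diff byMod at *
  rcases mod_four_cases s with ⟨e, e'⟩ | ⟨e, e'⟩ | ⟨e, e'⟩ | ⟨e, e'⟩ <;>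
    simp only [e, e'] at h ⊢ <;> norm_num at h ⊢
  · rw [M.bb, h.2, map_zero, map_zero]
  · exact M.abb x
  · rw [M.aba, M.bbbb]
  · exact M.bba _

theorem ext_diff_fst (s : ℤ) (x : X × (ℕ → X)) : (M.ext.diff s x).1 = M.diff s x.1 := by
  unfold diff byMod
  split_ifs <;> rfl

theorem ext_diff_inr (s : ℤ) (f : ℕ → X) : M.ext.diff s (0, f) = (0, M.tens.diff s f) := by
  have ha : ∀ f, M.ext.a (0, f) = (0, M.tens.a f) := fun f => by
    rw [ext_a, map_zero]
  have hb : ∀ f, M.ext.b (0, f) = (0, M.tens.b f) := fun f => by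
    rw [ext_b, map_zero, map_zero, add_zero]
  unfold diff byMod
  split_ifs <;> simp only [LinearMap.comp_apply, ha, hb]

/-- The connecting map of the extension `ext` is surjective, as the complex of `ext` is exact. -/
theorem tens_exactAt (hM : M.Acyclic) {c : ℤ} (hc : M.VanishesBelow c) {s t : ℤ}
    (h : M.ExactAt s (t + 1)) : M.tens.ExactAt (s + 1) t := by
  rintro z ⟨hz, hz'⟩
  have hz' : M.tens.diff (s + 1) z = 0 := hz'
  obtain ⟨⟨m, y⟩, hw, e⟩ := M.ext_exactAt hM hc (s + 1) t
    (x := ((0, z) : X × (ℕ → X))) ⟨M.mem_term_ext.2 ⟨zero_mem _, hz⟩, by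
      rw [SetLike.mem_coe, LinearMap.mem_ker, ext_diff_inr, hz']; rfl⟩
  rw [add_sub_cancel_right] at e hw
  obtain ⟨hm, hy⟩ := M.mem_term_ext.1 hw
  obtain ⟨m', hm', e'⟩ := h ⟨hm, LinearMap.mem_ker.2 (by
    have := congrArg Prod.fst e
    rwa [ext_diff_fst] at this)⟩
  have h1 : (m', 0) ∈ M.ext.term (s - 1) t := M.mem_term_ext.2 ⟨hm', zero_mem _⟩
  have h2 := M.ext.diff_mem h1
  rw [sub_add_cancel] at h2
  refine ⟨y - (M.ext.diff (s - 1) (m', 0)).2, ?_, ?_⟩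
  · rw [add_sub_cancel_right]
    exact sub_mem hy (M.mem_term_ext.1 h2).2
  · rw [add_sub_cancel_right]
    have h3 : M.ext.diff s (M.ext.diff (s - 1) (m', 0)) = 0 := by
      simpa using M.ext.diff_diff h1
    have h4 : ((m, y) : X × (ℕ → X)) - M.ext.diff (s - 1) (m', 0) =
        (0, y - (M.ext.diff (s - 1) (m', 0)).2) := by
      refine Prod.ext ?_ rfl
      rw [Prod.fst_sub, ext_diff_fst, e', sub_self]
    have h5 := M.ext_diff_inr s (y - (M.ext.diff (s - 1) (m', 0)).2)
    rw [← h4, map_sub, e, h3, sub_zero] at h5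
    exact (congrArg Prod.snd h5).symm

end SqMod

namespace SqMod

variable {X : Type*} [AddCommGroup X] [Module 𝔽 X] (M : SqMod X)
  {Y : Type*} [AddCommGroup Y] [Module 𝔽 Y] (N : SqMod Y)

/-- The product of two modules. -/
def prod : SqMod (X × Y) where
  a := M.a.prodMap N.a
  b := M.b.prodMap N.b
  g d := (M.g d).prod (N.g d)
  a_mem' h := ⟨M.a_mem' h.1, N.a_mem' h.2⟩
  b_mem' h := ⟨M.b_mem' h.1, N.b_mem' h.2⟩
  aa x := Prod.ext (M.aa x.1) (N.aa x.2)
  bb x := Prod.ext (M.bb x.1) (N.bb x.2)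

/-- A linear map which commutes with the operators and is bijective on homogeneous components. -/
structure GrEquiv (π : X →ₗ[𝔽] Y) : Prop where
  map_a : ∀ x, π (M.a x) = N.a (π x)
  map_b : ∀ x, π (M.b x) = N.b (π x)
  mem : ∀ {d x}, x ∈ M.g d → π x ∈ N.g d
  inj : ∀ {d x}, x ∈ M.g d → π x = 0 → x = 0
  surj : ∀ {d y}, y ∈ N.g d → ∃ x ∈ M.g d, π x = y

variable {M N}

theorem GrEquiv.acyclic {π : X →ₗ[𝔽] Y} (h : GrEquiv M N π) (hN : N.Acyclic) : M.Acyclic := by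
  intro d x hx h0
  obtain ⟨y, hy, e⟩ := hN (h.mem hx) (by rw [← h.map_a, h0, map_zero])
  obtain ⟨z, hz, rfl⟩ := h.surj hy
  refine ⟨z, hz, ?_⟩
  rw [← h.map_a, ← sub_eq_zero, ← map_sub] at e
  exact sub_eq_zero.1 (h.inj (sub_mem (M.a_mem hz (by lia)) hx) e)

theorem GrEquiv.map_q {π : X →ₗ[𝔽] Y} (h : GrEquiv M N π) (x : X) : π (M.q x) = N.q (π x) := by
  simp only [q_apply, map_add, h.map_a, h.map_b]

theorem GrEquiv.map_diff {π : X →ₗ[𝔽] Y} (h : GrEquiv M N π) (s : ℤ) (x : X) :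
    π (M.diff s x) = N.diff s (π x) := by
  unfold diff byMod
  split_ifs <;> simp only [LinearMap.comp_apply, h.map_a, h.map_b]

theorem GrEquiv.mem_term {π : X →ₗ[𝔽] Y} (h : GrEquiv M N π) {s t : ℤ} {x : X}
    (hx : x ∈ M.term s t) : π x ∈ N.term s t := by
  have hK : ∀ {d}, x ∈ M.K d → π x ∈ N.K d := fun hx =>
    N.mem_K.2 ⟨h.mem hx.1, by rw [← h.map_a, (M.mem_K.1 hx).2, map_zero]⟩
  unfold term byMod at *
  split_ifs at *
  exacts [hK hx, h.mem hx, h.mem hx, hK hx]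

theorem GrEquiv.surj_term {π : X →ₗ[𝔽] Y} (h : GrEquiv M N π) {s t : ℤ} {y : Y}
    (hy : y ∈ N.term s t) : ∃ x ∈ M.term s t, π x = y := by
  have hK : ∀ {d}, y ∈ N.K d → ∃ x ∈ M.K d, π x = y := fun {d} hy => by
    obtain ⟨x, hx, rfl⟩ := h.surj hy.1
    refine ⟨x, M.mem_K.2 ⟨hx, h.inj (M.a_mem hx rfl) ?_⟩, rfl⟩
    rw [h.map_a, (N.mem_K.1 hy).2]
  unfold term byMod at *
  split_ifs at *
  exacts [hK hy, h.surj hy, h.surj hy, hK hy]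

theorem GrEquiv.inj_term {π : X →ₗ[𝔽] Y} (h : GrEquiv M N π) {s t : ℤ} {x : X}
    (hx : x ∈ M.term s t) (e : π x = 0) : x = 0 := by
  unfold term byMod at *
  split_ifs at *
  exacts [h.inj hx.1 e, h.inj hx e, h.inj hx e, h.inj hx.1 e]

theorem GrEquiv.exactAt {π : X →ₗ[𝔽] Y} (h : GrEquiv M N π) {s t : ℤ} (hN : N.ExactAt s t) :
    M.ExactAt s t := by
  rintro x ⟨hx, h0⟩
  have h0 : M.diff s x = 0 := h0
  obtain ⟨y, hy, e⟩ := hN ⟨h.mem_term hx, LinearMap.mem_ker.2 (by rw [← h.map_diff, h0, map_zero])⟩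
  obtain ⟨z, hz, rfl⟩ := h.surj_term hy
  refine ⟨z, hz, ?_⟩
  rw [← h.map_diff, ← sub_eq_zero, ← map_sub] at e
  have h1 := M.diff_mem hz
  rw [sub_add_cancel] at h1
  exact sub_eq_zero.1 (h.inj_term (sub_mem h1 hx) e)

theorem GrEquiv.ZH_le_BH {π : X →ₗ[𝔽] Y} (h : GrEquiv M N π) {d : ℤ} (hN : N.ZH d ≤ N.BH d) :
    M.ZH d ≤ M.BH d := by
  rintro x ⟨hx, h0⟩
  have h0 : M.q x = 0 := h0
  obtain ⟨y, hy, e⟩ := hN ⟨h.mem hx, LinearMap.mem_ker.2 (by rw [← h.map_q, h0, map_zero])⟩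
  obtain ⟨z, hz, rfl⟩ := h.surj hy
  refine ⟨z, hz, ?_⟩
  rw [← h.map_q, ← sub_eq_zero, ← map_sub] at e
  exact sub_eq_zero.1 (h.inj (sub_mem (M.q_mem hz (by lia)) hx) e)

theorem prod_acyclic (hM : M.Acyclic) (hN : N.Acyclic) : (M.prod N).Acyclic := by
  intro d x hx h0
  obtain ⟨y, hy, e⟩ := hM hx.1 (congrArg Prod.fst h0)
  obtain ⟨z, hz, e'⟩ := hN hx.2 (congrArg Prod.snd h0)
  exact ⟨(y, z), ⟨hy, hz⟩, Prod.ext e e'⟩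

theorem prod_ZH_le_BH {d : ℤ} (hM : M.ZH d ≤ M.BH d) (hN : N.ZH d ≤ N.BH d) :
    (M.prod N).ZH d ≤ (M.prod N).BH d := by
  rintro x ⟨hx, h0⟩
  obtain ⟨y, hy, e⟩ := hM ⟨hx.1, congrArg Prod.fst h0⟩
  obtain ⟨z, hz, e'⟩ := hN ⟨hx.2, congrArg Prod.snd h0⟩
  exact ⟨(y, z), ⟨hy, hz⟩, Prod.ext e e'⟩

theorem prod_exactAt {s t : ℤ} (hM : M.ExactAt s t) (hN : N.ExactAt s t) :
    (M.prod N).ExactAt s t := by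
  have ht : ∀ {s x}, x ∈ (M.prod N).term s t ↔ x.1 ∈ M.term s t ∧ x.2 ∈ N.term s t := by
    have hK : ∀ {d} {x : X × Y}, x ∈ (M.prod N).K d ↔ x.1 ∈ M.K d ∧ x.2 ∈ N.K d := by
      intro d x
      rw [mem_K, mem_K, mem_K]
      exact ⟨fun h => ⟨⟨h.1.1, congrArg Prod.fst h.2⟩, h.1.2, congrArg Prod.snd h.2⟩,
        fun h => ⟨⟨h.1.1, h.2.1⟩, Prod.ext h.1.2 h.2.2⟩⟩
    intro s x
    unfold term byMod
    split_ifs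
    exacts [hK, Iff.rfl, Iff.rfl, hK]
  have hd : ∀ s x, (M.prod N).diff s x = (M.diff s x.1, N.diff s x.2) := by
    intro s x
    unfold diff byMod
    split_ifs <;> rfl
  rintro x ⟨hx, h0⟩
  have h0 : (M.prod N).diff s x = 0 := h0
  rw [hd] at h0
  obtain ⟨y, hy, e⟩ := hM ⟨(ht.1 hx).1, congrArg Prod.fst h0⟩
  obtain ⟨z, hz, e'⟩ := hN ⟨(ht.1 hx).2, congrArg Prod.snd h0⟩
  exact ⟨(y, z), ht.2 ⟨hy, hz⟩, (hd _ _).trans (Prod.ext e e')⟩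

/-- A `Q₁`-cycle of `M ⊗ x 𝔽[x]` is homologous to its component in `M ⊗ x²`. -/
theorem exists_q_eq_sub {d : ℤ} {f : ℕ → X} (hf : f ∈ M.tens.ZH d) :
    M.q (f 1) = 0 ∧ ∃ h ∈ M.tens.g (d - 3), f - M.tens.q h = Pi.single 1 (f 1) := by
  obtain ⟨hf, h0⟩ := hf
  have h1 : ∀ i, M.q (f i) + (if i % 2 = 1 ∧ i ≠ 1 then f (i - 3) else 0) = 0 := fun i => by
    rw [← tens_q_apply]; exact congrFun h0 i
  have h2 : ∀ {x y : X}, x + y = 0 → x = y := fun h => by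
    rwa [← ZModModule.sub_eq_add, sub_eq_zero] at h
  refine ⟨by simpa using h1 1, fun i => if i % 2 = 0 then f (i + 3) else 0,
    M.mem_tens.2 fun i => ?_, funext fun i => ?_⟩
  · split_ifs with h
    · exact M.g_mem (M.mem_tens.1 hf (i + 3)) (by push_cast; lia)
    · exact zero_mem _
  · rw [Pi.sub_apply, tens_q_apply]
    by_cases h : i % 2 = 0
    · have := h1 (i + 3)
      rw [if_pos ⟨by lia, by lia⟩, Nat.add_sub_cancel] at this
      rw [if_pos h, if_neg (by lia), add_zero, h2 this, sub_self, Pi.single_eq_of_ne (by lia)]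
    · rw [if_neg h, map_zero, zero_add]
      by_cases h3 : i = 1
      · subst h3; simp
      · rw [if_pos ⟨by lia, h3⟩, if_pos (by lia), Nat.sub_add_cancel (by lia), sub_self,
          Pi.single_eq_of_ne h3]

theorem tens_q_single (x : X) : M.tens.q (Pi.single 1 x) = Pi.single 1 (M.q x) := by
  funext i
  rw [tens_q_apply]
  by_cases h : i = 1
  · subst h; simp
  · rw [Pi.single_eq_of_ne h, Pi.single_eq_of_ne h, map_zero, zero_add]
    split_ifs with h'
    · exact Pi.single_eq_of_ne (by lia) _
    · rfl

theorem single_mem_tens {d : ℤ} {x : X} {i : ℕ} (hx : x ∈ M.g (d - i - 1)) :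
    Pi.single i x ∈ M.tens.g d := M.mem_tens.2 fun j => by
  by_cases h : j = i
  · subst h; rwa [Pi.single_eq_same]
  · rw [Pi.single_eq_of_ne h]; exact zero_mem _

theorem tens_ZH_le_BH {d : ℤ} (hM : M.ZH (d - 2) ≤ M.BH (d - 2)) :
    M.tens.ZH d ≤ M.tens.BH d := by
  intro f hf
  obtain ⟨h0, h, hh, e⟩ := exists_q_eq_sub hf
  obtain ⟨y, hy, e'⟩ := hM ⟨M.g_mem (M.mem_tens.1 hf.1 1) (by push_cast; lia), h0⟩
  refine ⟨h + Pi.single 1 y, add_mem hh (single_mem_tens (M.g_mem hy (by push_cast; lia))), ?_⟩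
  rw [map_add, tens_q_single, e', ← e, add_sub_cancel]

end SqMod

/-! ### The cohomology of `B(ℤ/2)` -/

/-- The trivial module in degree zero. -/
def unitMod : SqMod 𝔽 where
  a := 0
  b := 0
  g d := if d = 0 then ⊤ else ⊥
  a_mem' _ := zero_mem _
  b_mem' _ := zero_mem _
  aa _ := rfl
  bb _ := rfl

theorem mem_unitMod {d : ℤ} {x : 𝔽} : x ∈ unitMod.g d ↔ d = 0 ∨ x = 0 := by
  change x ∈ (if d = 0 then ⊤ else ⊥ : Submodule 𝔽 𝔽) ↔ _
  split_ifs with h <;> simp [h]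

/-- The class `x ^ (n + 1)`. -/
def xpow (n : ℕ) : ℕ → 𝔽 := Pi.single n 1

theorem a_xpow (n : ℕ) : unitMod.tens.a (xpow n) = ((n + 1 : ℕ) : 𝔽) • xpow (n + 1) := by
  funext i
  change unitMod.tensA _ i = _
  rw [SqMod.tensA_apply, Pi.smul_apply, xpow, xpow]
  change 0 + _ = _
  rcases i with _ | i
  · simp
  · by_cases h : i = n
    · subst h; simp
    · simp [h]

theorem b_xpow (n : ℕ) : unitMod.tens.b (xpow n) = ((n + 1).choose 2 : 𝔽) • xpow (n + 2) := by
  funext i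
  change unitMod.tensB _ i = _
  rw [SqMod.tensB_apply, Pi.smul_apply, xpow, xpow]
  change 0 + _ • 0 + _ = _
  rcases i with _ | _ | i
  · simp
  · simp
  · by_cases h : i = n
    · subst h; simp
    · simp [h]

theorem xpow_mem {n : ℕ} {d : ℤ} (h : d = n + 1) : xpow n ∈ unitMod.tens.g d :=
  SqMod.single_mem_tens (mem_unitMod.2 (Or.inl (by lia)))

theorem xpow_ne_zero (n : ℕ) : xpow n ≠ 0 := fun h => by
  have := congrFun h n
  simp [xpow] at this

theorem eq_xpow {d : ℤ} {f : ℕ → 𝔽} (hf : f ∈ unitMod.tens.g d) :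
    f = 0 ∨ ∃ n : ℕ, d = n + 1 ∧ f = xpow n := by
  have h1 : ∀ i : ℕ, d - i - 1 = 0 ∨ f i = 0 := fun i => mem_unitMod.1 (unitMod.mem_tens.1 hf i)
  by_cases h : f = 0
  · exact Or.inl h
  · obtain ⟨n, hn⟩ := Function.ne_iff.1 h
    have hn' := (h1 n).resolve_right hn
    refine Or.inr ⟨n, by lia, funext fun i => ?_⟩
    by_cases hi : i = n
    · subst hi
      rw [xpow, Pi.single_eq_same]
      exact Fin.eq_one_of_ne_zero _ hn
    · rw [xpow, Pi.single_eq_of_ne hi]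
      exact (h1 i).resolve_left (by lia)

theorem unitMod_tens_ZH_le_BH {d : ℤ} (h : d ≠ 2) : unitMod.tens.ZH d ≤ unitMod.tens.BH d := by
  refine SqMod.tens_ZH_le_BH fun x hx => ?_
  rw [(mem_unitMod.1 hx.1).resolve_left (by lia)]
  exact zero_mem _

/-- The complex of the cohomology of `B(ℤ/2)` is exact in the internal degrees congruent to
1, 2, 3 or 5 modulo 8. -/
theorem unitMod_tens_exactAt {s t : ℤ} (h : (t + s) % 8 = 1 ∨ (t + s) % 8 = 2 ∨
    (t + s) % 8 = 3 ∨ (t + s) % 8 = 5) : unitMod.tens.ExactAt s t := by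
  have ha : ∀ {n : ℕ}, n % 2 = 1 → unitMod.tens.a (xpow n) = 0 := fun hn => by
    rw [a_xpow, SqMod.smul_even (by lia)]
  have ha' : ∀ {n : ℕ}, n % 2 = 0 → unitMod.tens.a (xpow n) = xpow (n + 1) := fun hn => by
    rw [a_xpow, SqMod.smul_odd (by lia)]
  have hb' : ∀ {n : ℕ}, n % 4 = 1 ∨ n % 4 = 2 → unitMod.tens.b (xpow n) = xpow (n + 2) :=
    fun hn => by rw [b_xpow, choose_two_cast, if_pos (by lia), one_smul]
  intro f hf
  rw [SqMod.Z_eq] at hf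
  rw [SqMod.B_eq]
  unfold byMod at *
  rcases mod_four_cases s with ⟨e, -⟩ | ⟨e, -⟩ | ⟨e, -⟩ | ⟨e, -⟩ <;>
    simp only [e] at hf ⊢ <;> norm_num at hf ⊢
  · obtain ⟨h1, h2, h3⟩ := (SqMod.mem_ZA _).1 hf
    obtain rfl | ⟨n, hn, rfl⟩ := eq_xpow h1
    · exact zero_mem _
    · by_cases hn2 : n % 2 = 0
      · rw [ha' hn2] at h2
        exact absurd h2 (xpow_ne_zero _)
      · rw [hb' (by lia)] at h3
        exact absurd h3 (xpow_ne_zero _)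
  · obtain ⟨h1, h3⟩ := (SqMod.mem_ZB _).1 hf
    obtain rfl | ⟨n, hn, rfl⟩ := eq_xpow h1
    · exact zero_mem _
    · by_cases hn2 : n % 4 = 3
      · obtain ⟨m, rfl⟩ : ∃ m, n = m + 2 := ⟨n - 2, by lia⟩
        exact ⟨xpow m, ⟨xpow_mem (by push_cast at hn; lia), ha (by lia)⟩, hb' (by lia)⟩
      · rw [hb' (by lia)] at h3
        exact absurd h3 (xpow_ne_zero _)
  · obtain ⟨h1, h3⟩ := (SqMod.mem_ZC _).1 hf
    obtain rfl | ⟨n, hn, rfl⟩ := eq_xpow h1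
    · exact zero_mem _
    · by_cases hn2 : n % 4 = 2
      · rw [hb' (by lia), ha' (by lia)] at h3
        exact absurd h3 (xpow_ne_zero _)
      · obtain ⟨m, rfl⟩ : ∃ m, n = m + 2 := ⟨n - 2, by lia⟩
        exact ⟨xpow m, xpow_mem (by push_cast at hn; lia), hb' (by lia)⟩
  · obtain ⟨h1, h2, -⟩ := (SqMod.mem_ZE _).1 hf
    obtain rfl | ⟨n, hn, rfl⟩ := eq_xpow h1
    · exact zero_mem _
    · by_cases hn2 : n % 2 = 0
      · rw [ha' hn2] at h2
        exact absurd h2 (xpow_ne_zero _)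
      · obtain ⟨m, rfl⟩ : ∃ m, n = m + 3 := ⟨n - 3, by lia⟩
        refine (SqMod.mem_BE _).2 ⟨xpow m, xpow_mem (by push_cast at hn; lia), ?_⟩
        rw [hb' (by lia), ha' (by lia)]

/-! ### The symmetric algebra as a module over `A(1)` -/

section

variable (V : Type) [AddCommGroup V] [Module 𝔽 V]

/-- The component of degree `d` of the unreduced cohomology. -/
def symGr (d : ℤ) : Submodule 𝔽 (Sym V) :=
  if 0 ≤ d then LinearMap.range (SymmetricAlgebra.ι 𝔽 V) ^ d.toNat else ⊥

variable {V}

theorem symGr_natCast (n : ℕ) : symGr V n = LinearMap.range (SymmetricAlgebra.ι 𝔽 V) ^ n := by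
  simp [symGr]

theorem symGr_of_neg {d : ℤ} (h : d < 0) : symGr V d = ⊥ := if_neg (by lia)

theorem ι_mem_symGr (v : V) : SymmetricAlgebra.ι 𝔽 V v ∈ symGr V 1 := by
  rw [← Nat.cast_one, symGr_natCast, pow_one]
  exact ⟨v, rfl⟩

theorem mul_mem_symGr {d e f : ℤ} {x y : Sym V} (hx : x ∈ symGr V d) (hy : y ∈ symGr V e)
    (h : f = d + e) : x * y ∈ symGr V f := by
  subst h
  by_cases hd : 0 ≤ d
  · by_cases he : 0 ≤ e
    · lift d to ℕ using hd
      lift e to ℕ using he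
      rw [← Nat.cast_add, symGr_natCast, pow_add]
      rw [symGr_natCast] at hx hy
      exact Submodule.mul_mem_mul hx hy
    · rw [symGr_of_neg (by lia)] at hy
      rw [(Submodule.mem_bot 𝔽).1 hy, mul_zero]
      exact zero_mem _
  · rw [symGr_of_neg (by lia)] at hx
    rw [(Submodule.mem_bot 𝔽).1 hx, zero_mul]
    exact zero_mem _

theorem pow_mem_symGr {x : Sym V} (hx : x ∈ symGr V 1) (n : ℕ) : x ^ n ∈ symGr V n := by
  induction n with
  | zero => simp [symGr, Submodule.one_le.1 le_rfl]
  | succ n ih => rw [pow_succ]; exact mul_mem_symGr ih hx (by push_cast; rfl)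

theorem algebraMap_mem_symGr (c : 𝔽) : algebraMap 𝔽 (Sym V) c ∈ symGr V 0 := by
  simp [symGr]

/-- An induction principle for homogeneous elements. -/
theorem symGr_induction {p : ℕ → Sym V → Prop}
    (one : p 0 1) (add : ∀ n x y, p n x → p n y → p n (x + y)) (zero : ∀ n, p n 0)
    (mul : ∀ (n : ℕ) x (v : V), x ∈ symGr V n → p n x → p (n + 1) (x * SymmetricAlgebra.ι 𝔽 V v))
    {n : ℕ} {x : Sym V} (hx : x ∈ symGr V n) : p n x := by
  induction n generalizing x with
  | zero =>
    rw [symGr_natCast, pow_zero, Submodule.mem_one] at hx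
    obtain ⟨c, rfl⟩ := hx
    have h : c = 0 ∨ c = 1 := by revert c; decide
    rcases h with rfl | rfl
    · rw [map_zero]; exact zero 0
    · rw [map_one]; exact one
  | succ n ih =>
    rw [symGr_natCast, pow_succ] at hx
    induction hx using Submodule.mul_induction_on' with
    | mem_mul_mem x hx y hy =>
      obtain ⟨v, rfl⟩ := hy
      rw [← symGr_natCast] at hx
      exact mul n x v hx (ih hx)
    | add x _ y _ hx hy => exact add _ _ _ hx hy

theorem Sq_mul_ι (k : ℕ) (x : Sym V) (v : V) :
    Sq V (k + 1) (x * SymmetricAlgebra.ι 𝔽 V v) =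
      Sq V (k + 1) x * SymmetricAlgebra.ι 𝔽 V v + Sq V k x * SymmetricAlgebra.ι 𝔽 V v ^ 2 := by
  rw [Sq_apply, map_mul, totalSq_ι, mul_add, Polynomial.coeff_add, Polynomial.coeff_mul_C,
    ← mul_assoc, Polynomial.coeff_mul_X, Polynomial.coeff_mul_C]
  rfl

theorem Sq_mem_symGr {d : ℤ} {x : Sym V} (hx : x ∈ symGr V d) (k : ℕ) :
    Sq V k x ∈ symGr V (d + k) := by
  by_cases hd : d < 0
  · rw [symGr_of_neg hd] at hx
    rw [(Submodule.mem_bot 𝔽).1 hx, map_zero]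
    exact zero_mem _
  lift d to ℕ using by lia
  refine symGr_induction (p := fun n x => ∀ k : ℕ, Sq V k x ∈ symGr V (n + k)) ?_ ?_ ?_ ?_ hx k
  · intro k
    rcases k with _ | k
    · rw [Sq_zero_eq]; exact pow_mem_symGr (x := 0) (zero_mem _) 0
    · have := Sq_algebraMap V (k + 1) (by lia) 1
      rw [map_one] at this
      rw [this]; exact zero_mem _
  · intro n x y hx hy k
    rw [map_add]; exact add_mem (hx k) (hy k)
  · intro n k
    rw [map_zero]; exact zero_mem _
  · intro n x v hx' hx k
    rcases k with _ | k
    · rw [Sq_zero_eq]; exact mul_mem_symGr hx' (ι_mem_symGr v) (by push_cast; ring)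
    · rw [Sq_mul_ι]
      refine add_mem (mul_mem_symGr (hx _) (ι_mem_symGr v) (by push_cast; ring))
        (mul_mem_symGr (hx k) (pow_mem_symGr (ι_mem_symGr v) 2) (by push_cast; ring))

theorem aug_eq_zero {d : ℤ} {x : Sym V} (hx : x ∈ symGr V d) (h : d ≠ 0) : aug V x = 0 := by
  by_cases hd : d < 0
  · rw [symGr_of_neg hd] at hx
    rw [(Submodule.mem_bot 𝔽).1 hx, map_zero]
  lift d to ℕ using by lia
  refine symGr_induction (p := fun n x => n ≠ 0 → aug V x = 0) ?_ ?_ ?_ ?_ hx (by lia)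
  · intro h; exact absurd rfl h
  · intro n x y hx hy h
    rw [map_add, hx h, hy h, add_zero]
  · intro n _
    rw [map_zero]
  · intro n x v _ _ _
    rw [map_mul, aug, SymmetricAlgebra.algebraMapInv_ι, mul_zero]

theorem algebraMap_aug {x : Sym V} (hx : x ∈ symGr V 0) : algebraMap 𝔽 _ (aug V x) = x := by
  rw [symGr, if_pos le_rfl, Int.toNat_zero, pow_zero, Submodule.mem_one] at hx
  obtain ⟨c, rfl⟩ := hx
  rw [AlgHom.commutes]
  rfl

variable (V)

/-- The symmetric algebra with the operators `Sq¹` and `Sq²`, graded by the components of positive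
degree: this is reduced cohomology. -/
def symMod : SqMod (Sym V) where
  a := Sq V 1
  b := Sq V 2
  g d := if 0 < d then symGr V d else ⊥
  a_mem' {d x} h := by
    split_ifs at h with hd
    · rw [if_pos (by lia)]; exact Sq_mem_symGr h 1
    · rw [(Submodule.mem_bot 𝔽).1 h, map_zero]; exact zero_mem _
  b_mem' {d x} h := by
    split_ifs at h with hd
    · rw [if_pos (by lia)]; exact Sq_mem_symGr h 2
    · rw [(Submodule.mem_bot 𝔽).1 h, map_zero]; exact zero_mem _
  aa := Sq_one_Sq_one V
  bb := Sq_two_Sq_two V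

variable {V}

theorem mem_symMod {d : ℤ} {x : Sym V} :
    x ∈ (symMod V).g d ↔ (0 < d ∧ x ∈ symGr V d) ∨ x = 0 := by
  change x ∈ (if 0 < d then symGr V d else ⊥) ↔ _
  split_ifs with h
  · simp only [h, true_and]
    exact ⟨Or.inl, fun h => h.elim id fun h => h ▸ zero_mem _⟩
  · simp [h]

theorem mem_symGr_of_mem {d : ℤ} {x : Sym V} (h : x ∈ (symMod V).g d) : x ∈ symGr V d := by
  rcases mem_symMod.1 h with h | rfl
  · exact h.2
  · exact zero_mem _

theorem mem_symMod_of_pos {d : ℤ} {x : Sym V} (hd : 0 < d) (h : x ∈ symGr V d) :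
    x ∈ (symMod V).g d := mem_symMod.2 (Or.inl ⟨hd, h⟩)

theorem symMod_vanishesBelow : (symMod V).VanishesBelow 0 := by
  intro d hd
  exact if_neg (by lia)

theorem symMod_a (x : Sym V) : (symMod V).a x = Sq V 1 x := rfl

theorem symMod_b (x : Sym V) : (symMod V).b x = Sq V 2 x := rfl

theorem Sym.map_mem_symGr {W : Type} [AddCommGroup W] [Module 𝔽 W] (f : V →ₗ[𝔽] W) {d : ℤ}
    {x : Sym V} (hx : x ∈ symGr V d) : Sym.map f x ∈ symGr W d := by
  by_cases hd : d < 0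
  · rw [symGr_of_neg hd] at hx
    rw [(Submodule.mem_bot 𝔽).1 hx, map_zero]
    exact zero_mem _
  lift d to ℕ using by lia
  refine symGr_induction (p := fun n x => Sym.map f x ∈ symGr W n) ?_ ?_ ?_ ?_ hx
  · rw [map_one]; exact pow_mem_symGr (x := 0) (zero_mem _) 0
  · intro n x y hx hy
    rw [map_add]; exact add_mem hx hy
  · intro n
    rw [map_zero]; exact zero_mem _
  · intro n x v _ hx
    rw [map_mul, Sym.map_ι]
    exact mul_mem_symGr hx (ι_mem_symGr _) (by push_cast; rfl)

theorem Sym.map_mem_symMod {W : Type} [AddCommGroup W] [Module 𝔽 W] (f : V →ₗ[𝔽] W) {d : ℤ}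
    {x : Sym V} (hx : x ∈ (symMod V).g d) : Sym.map f x ∈ (symMod W).g d := by
  rcases mem_symMod.1 hx with h | rfl
  · exact mem_symMod_of_pos h.1 (Sym.map_mem_symGr f h.2)
  · rw [map_zero]; exact zero_mem _

theorem grEquiv_of_linearEquiv {W : Type} [AddCommGroup W] [Module 𝔽 W] (e : V ≃ₗ[𝔽] W) :
    SqMod.GrEquiv (symMod V) (symMod W) (Sym.map e.toLinearMap).toLinearMap where
  map_a x := (Sq_map _ 1 x).symm
  map_b x := (Sq_map _ 2 x).symm
  mem h := Sym.map_mem_symMod _ h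
  inj {d x} _ h := by
    have h1 := congrArg (Sym.map e.symm.toLinearMap) h
    rw [map_zero, AlgHom.toLinearMap_apply, ← AlgHom.comp_apply, ← Sym.map_comp] at h1
    simpa [Sym.map_id] using h1
  surj {d y} hy := by
    refine ⟨Sym.map e.symm.toLinearMap y, Sym.map_mem_symMod _ hy, ?_⟩
    rw [AlgHom.toLinearMap_apply, ← AlgHom.comp_apply, ← Sym.map_comp]
    simp [Sym.map_id]

end

/-! ### Adding a direct summand of dimension one -/

section

variable (W : Type) [AddCommGroup W] [Module 𝔽 W]

open Polynomial

/-- The class in `S¹(W × 𝔽)` of the second summand. -/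
def lastVar : Sym (W × 𝔽) := SymmetricAlgebra.ι 𝔽 (W × 𝔽) (0, 1)

/-- The inclusion of `S(W)` in `S(W × 𝔽)`. -/
def symInl : Sym W →ₐ[𝔽] Sym (W × 𝔽) := Sym.map (LinearMap.inl 𝔽 W 𝔽)

/-- The isomorphism from `S(W × 𝔽)` to the polynomial ring `S(W)[x]`. -/
def toPoly : Sym (W × 𝔽) →ₐ[𝔽] (Sym W)[X] :=
  SymmetricAlgebra.lift
    ((CAlgHom.toLinearMap ∘ₗ SymmetricAlgebra.ι 𝔽 W).coprod
      (LinearMap.toSpanSingleton 𝔽 (Sym W)[X] X))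

/-- The inverse isomorphism, from `S(W)[x]` to `S(W × 𝔽)`. -/
def ofPoly : (Sym W)[X] →+* Sym (W × 𝔽) :=
  eval₂RingHom (symInl W).toRingHom (lastVar W)

variable {W}

theorem toPoly_ι (w : W) (c : 𝔽) :
    toPoly W (SymmetricAlgebra.ι 𝔽 _ (w, c)) = C (SymmetricAlgebra.ι 𝔽 W w) + c • X :=
  SymmetricAlgebra.lift_ι_apply _ _

theorem toPoly_lastVar : toPoly W (lastVar W) = X := by
  rw [lastVar, toPoly_ι]; simp

theorem toPoly_symInl (x : Sym W) : toPoly W (symInl W x) = C x := by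
  induction x using SymmetricAlgebra.induction with
  | algebraMap r => rw [AlgHom.commutes, AlgHom.commutes]; rfl
  | ι v => rw [symInl, Sym.map_ι, LinearMap.inl_apply, toPoly_ι]; simp
  | mul a b ha hb => rw [map_mul, map_mul, ha, hb, C_mul]
  | add a b ha hb => rw [map_add, map_add, ha, hb, C_add]

theorem ofPoly_C (x : Sym W) : ofPoly W (C x) = symInl W x := eval₂_C _ _

theorem ofPoly_X : ofPoly W X = lastVar W := eval₂_X _ _

theorem ofPoly_toPoly (z : Sym (W × 𝔽)) : ofPoly W (toPoly W z) = z := by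
  induction z using SymmetricAlgebra.induction with
  | algebraMap r =>
    rw [AlgHom.commutes, Polynomial.algebraMap_apply, ofPoly_C, AlgHom.commutes]
  | ι v =>
    obtain ⟨w, c⟩ := v
    have h : c = 0 ∨ c = 1 := by revert c; decide
    rw [toPoly_ι, map_add, ofPoly_C, symInl, Sym.map_ι]
    rcases h with rfl | rfl
    · rw [zero_smul, map_zero, add_zero, LinearMap.inl_apply]
    · rw [one_smul, ofPoly_X, lastVar, ← map_add, LinearMap.inl_apply, Prod.mk_add_mk, add_zero,
        zero_add]
  | mul a b ha hb => rw [map_mul, map_mul, ha, hb]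
  | add a b ha hb => rw [map_add, map_add, ha, hb]

theorem toPoly_ofPoly (p : (Sym W)[X]) : toPoly W (ofPoly W p) = p := by
  induction p using Polynomial.induction_on' with
  | add p q hp hq => rw [map_add, map_add, hp, hq]
  | monomial n x =>
    rw [← C_mul_X_pow_eq_monomial, map_mul, map_pow, ofPoly_C, ofPoly_X, map_mul, map_pow,
      toPoly_symInl, toPoly_lastVar]

theorem Sq_one_lastVar_pow (n : ℕ) :
    Sq _ 1 (lastVar W ^ n) = (n : Sym (W × 𝔽)) * lastVar W ^ (n + 1) := by
  induction n with
  | zero =>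
    have := Sq_algebraMap (W × 𝔽) 1 one_ne_zero 1
    rw [map_one] at this
    simp [this]
  | succ n ih =>
    rw [pow_succ, Sq_one_mul, ih, lastVar, Sq_one_ι]
    push_cast
    ring

theorem Sq_two_lastVar_pow (n : ℕ) :
    Sq _ 2 (lastVar W ^ n) = (n.choose 2 : Sym (W × 𝔽)) * lastVar W ^ (n + 2) := by
  induction n with
  | zero =>
    have := Sq_algebraMap (W × 𝔽) 2 two_ne_zero 1
    rw [map_one] at this
    simp [this]
  | succ n ih =>
    rw [pow_succ, Sq_two_mul, ih, Sq_one_lastVar_pow, lastVar, Sq_one_ι, Sq_two_ι,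
      Nat.choose_succ_succ' n 1, Nat.choose_one_right]
    push_cast
    ring

theorem toPoly_Sq_one_monomial (n : ℕ) (x : Sym W) :
    toPoly W (Sq _ 1 (ofPoly W (monomial n x))) =
      monomial n (Sq W 1 x) + monomial (n + 1) ((n : 𝔽) • x) := by
  rw [← C_mul_X_pow_eq_monomial, map_mul, map_pow, ofPoly_C, ofPoly_X, Sq_one_mul,
    Sq_one_lastVar_pow, symInl, Sq_map]
  change toPoly W (symInl W _ * _ + symInl W _ * _) = _
  rw [map_add, map_mul, map_mul, map_mul, toPoly_symInl, toPoly_symInl, map_pow, map_pow,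
    toPoly_lastVar, map_natCast, C_mul_X_pow_eq_monomial, Nat.cast_smul_eq_nsmul, nsmul_eq_mul]
  simp only [← C_mul_X_pow_eq_monomial, C_mul, C_eq_natCast]
  ring

theorem toPoly_Sq_two_monomial (n : ℕ) (x : Sym W) :
    toPoly W (Sq _ 2 (ofPoly W (monomial n x))) =
      monomial n (Sq W 2 x) + monomial (n + 1) ((n : 𝔽) • Sq W 1 x) +
        monomial (n + 2) ((n.choose 2 : 𝔽) • x) := by
  rw [← C_mul_X_pow_eq_monomial, map_mul, map_pow, ofPoly_C, ofPoly_X, Sq_two_mul,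
    Sq_one_lastVar_pow, Sq_two_lastVar_pow, symInl, Sq_map, Sq_map]
  change toPoly W (symInl W _ * _ + symInl W _ * _ + symInl W _ * _) = _
  rw [map_add, map_add, map_mul, map_mul, map_mul, map_mul, map_mul, toPoly_symInl, toPoly_symInl,
    toPoly_symInl, map_pow, map_pow, map_pow, toPoly_lastVar, map_natCast, map_natCast,
    C_mul_X_pow_eq_monomial, Nat.cast_smul_eq_nsmul, nsmul_eq_mul, Nat.cast_smul_eq_nsmul,
    nsmul_eq_mul]
  simp only [← C_mul_X_pow_eq_monomial, C_mul, C_eq_natCast]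
  ring

theorem coeff_toPoly_Sq_one (z : Sym (W × 𝔽)) (i : ℕ) :
    (toPoly W (Sq _ 1 z)).coeff 0 = Sq W 1 ((toPoly W z).coeff 0) ∧
    (toPoly W (Sq _ 1 z)).coeff (i + 1) =
      Sq W 1 ((toPoly W z).coeff (i + 1)) + (i : 𝔽) • (toPoly W z).coeff i := by
  obtain ⟨p, rfl⟩ : ∃ p, z = ofPoly W p := ⟨_, (ofPoly_toPoly z).symm⟩
  rw [toPoly_ofPoly]
  induction p using Polynomial.induction_on' with
  | add p q hp hq =>
    simp only [map_add, coeff_add, hp, hq, smul_add, true_and]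
    abel
  | monomial n x =>
    rw [toPoly_Sq_one_monomial]
    simp only [coeff_add, coeff_monomial, apply_ite (Sq W 1), map_zero, Nat.succ_ne_zero, if_false,
      add_zero, true_and, Nat.add_right_cancel_iff]
    congr 1
    by_cases h : n = i
    · subst h; simp
    · simp [h]

theorem coeff_toPoly_Sq_two (z : Sym (W × 𝔽)) (i : ℕ) :
    (toPoly W (Sq _ 2 z)).coeff 0 = Sq W 2 ((toPoly W z).coeff 0) ∧
    (toPoly W (Sq _ 2 z)).coeff (i + 1) =
      Sq W 2 ((toPoly W z).coeff (i + 1)) + (i : 𝔽) • Sq W 1 ((toPoly W z).coeff i) +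
        ((i - 1).choose 2 : 𝔽) • (toPoly W z).coeff (i - 1) := by
  obtain ⟨p, rfl⟩ : ∃ p, z = ofPoly W p := ⟨_, (ofPoly_toPoly z).symm⟩
  rw [toPoly_ofPoly]
  induction p using Polynomial.induction_on' with
  | add p q hp hq =>
    simp only [map_add, coeff_add, hp, hq, smul_add, true_and]
    abel
  | monomial n x =>
    rw [toPoly_Sq_two_monomial]
    simp only [coeff_add, coeff_monomial, apply_ite (Sq W 1), apply_ite (Sq W 2), map_zero,
      Nat.succ_ne_zero, if_false, add_zero, true_and, Nat.add_right_cancel_iff]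
    congr 1
    · congr 1
      by_cases h : n = i
      · subst h; simp
      · simp [h]
    · rcases i with _ | i
      · simp
      · by_cases h : n = i
        · subst h; simp
        · simp [h]

theorem coeff_toPoly_mem {d : ℤ} {z : Sym (W × 𝔽)} (hz : z ∈ symGr _ d) (i : ℕ) :
    (toPoly W z).coeff i ∈ symGr W (d - i) := by
  by_cases hd : d < 0
  · rw [symGr_of_neg hd] at hz
    rw [(Submodule.mem_bot 𝔽).1 hz, map_zero]
    exact zero_mem _
  lift d to ℕ using by lia
  refine symGr_induction (p := fun n z => ∀ i : ℕ, (toPoly W z).coeff i ∈ symGr W (n - i))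
    ?_ ?_ ?_ ?_ hz i
  · intro i
    rw [map_one, coeff_one]
    split_ifs with h
    · subst h; exact pow_mem_symGr (x := 0) (zero_mem _) 0
    · exact zero_mem _
  · intro n x y hx hy i
    rw [map_add, coeff_add]; exact add_mem (hx i) (hy i)
  · intro n i
    rw [map_zero]; exact zero_mem _
  · rintro n x ⟨w, c⟩ hx' hx i
    rw [map_mul, toPoly_ι, mul_add, coeff_add, coeff_mul_C, mul_smul_comm, coeff_smul]
    refine add_mem (mul_mem_symGr (hx i) (ι_mem_symGr w) (by push_cast; ring))
      (Submodule.smul_mem _ _ ?_)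
    rcases i with _ | i
    · rw [coeff_mul_X_zero]; exact zero_mem _
    · rw [coeff_mul_X]
      convert hx i using 1
      push_cast
      congr 1
      ring

theorem ofPoly_monomial_mem {d : ℤ} {x : Sym W} {i : ℕ} (hx : x ∈ symGr W (d - i)) :
    ofPoly W (monomial i x) ∈ symGr (W × 𝔽) d := by
  rw [← C_mul_X_pow_eq_monomial, map_mul, map_pow, ofPoly_C, ofPoly_X]
  exact mul_mem_symGr (Sym.map_mem_symGr _ hx) (pow_mem_symGr (ι_mem_symGr _) i) (by ring)

/-- The decomposition of `S(W × 𝔽)` into `S(W)`, `x 𝔽[x]` and the tensor product of the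
augmentation ideal of `S(W)` with `x 𝔽[x]`. -/
def split : Sym (W × 𝔽) →ₗ[𝔽] Sym W × ((ℕ → 𝔽) × (ℕ → Sym W)) where
  toFun z := ((toPoly W z).coeff 0, fun i => aug W ((toPoly W z).coeff (i + 1)),
    fun i => (toPoly W z).coeff (i + 1) -
      algebraMap 𝔽 _ (aug W ((toPoly W z).coeff (i + 1))))
  map_add' x y := by
    refine Prod.ext ?_ (Prod.ext (funext fun i => ?_) (funext fun i => ?_))
    · simp
    · simp
    · simp only [map_add, coeff_add, Prod.snd_add, Pi.add_apply]; abel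
  map_smul' c x := by
    refine Prod.ext ?_ (Prod.ext (funext fun i => ?_) (funext fun i => ?_))
    · simp
    · simp
    · simp only [map_smul, coeff_smul, Prod.smul_snd, Pi.smul_apply, RingHom.id_apply, smul_sub]
      rw [smul_eq_mul, map_mul, ← Algebra.smul_def]

theorem Sq_sub_algebraMap {k : ℕ} (hk : k ≠ 0) (x : Sym W) (c : 𝔽) :
    Sq W k (x - algebraMap 𝔽 _ c) = Sq W k x := by
  rw [map_sub, Sq_algebraMap W k hk, sub_zero]

theorem sub_algebraMap_aug_mem {d e : ℤ} {x : Sym W} (hx : x ∈ symGr W d) (h : e = d) :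
    x - algebraMap 𝔽 _ (aug W x) ∈ (symMod W).g e := by
  subst h
  rcases lt_trichotomy e 0 with h | h | h
  · rw [symGr_of_neg h] at hx
    rw [(Submodule.mem_bot 𝔽).1 hx, map_zero, map_zero, sub_zero]
    exact zero_mem _
  · subst h
    rw [algebraMap_aug hx, sub_self]
    exact zero_mem _
  · rw [aug_eq_zero hx (by lia), map_zero, sub_zero]
    exact mem_symMod_of_pos h hx

theorem split_grEquiv : SqMod.GrEquiv (symMod (W × 𝔽))
    ((symMod W).prod (unitMod.tens.prod (symMod W).tens)) split where
  map_a z := by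
    refine Prod.ext ?_ (Prod.ext (funext fun i => ?_) (funext fun i => ?_))
    · exact (coeff_toPoly_Sq_one z 0).1
    · change aug W ((toPoly W (Sq _ 1 z)).coeff (i + 1)) =
        0 + (i : 𝔽) • aug W ((toPoly W z).coeff (i - 1 + 1))
      rw [(coeff_toPoly_Sq_one z i).2, map_add, aug_Sq _ _ one_ne_zero, map_smul]
      rcases i with _ | i <;> simp
    · change (toPoly W (Sq _ 1 z)).coeff (i + 1) -
          algebraMap 𝔽 _ (aug W ((toPoly W (Sq _ 1 z)).coeff (i + 1))) =
        Sq W 1 ((toPoly W z).coeff (i + 1) - algebraMap 𝔽 _ (aug W ((toPoly W z).coeff (i + 1)))) +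
        (i : 𝔽) • ((toPoly W z).coeff (i - 1 + 1) -
          algebraMap 𝔽 _ (aug W ((toPoly W z).coeff (i - 1 + 1))))
      rw [(coeff_toPoly_Sq_one z i).2, map_add, aug_Sq _ _ one_ne_zero, map_smul,
        Sq_sub_algebraMap one_ne_zero]
      rcases i with _ | i
      · simp
      · rw [zero_add, smul_eq_mul, map_mul, ← Algebra.smul_def, smul_sub, Nat.add_sub_cancel]
        abel
  map_b z := by
    refine Prod.ext ?_ (Prod.ext (funext fun i => ?_) (funext fun i => ?_))
    · exact (coeff_toPoly_Sq_two z 0).1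
    · change aug W ((toPoly W (Sq _ 2 z)).coeff (i + 1)) =
        0 + (i : 𝔽) • 0 + ((i - 1).choose 2 : 𝔽) • aug W ((toPoly W z).coeff (i - 2 + 1))
      rw [(coeff_toPoly_Sq_two z i).2, map_add, map_add, aug_Sq _ _ two_ne_zero, map_smul,
        aug_Sq _ _ one_ne_zero, map_smul]
      rcases i with _ | _ | i <;> simp
    · change (toPoly W (Sq _ 2 z)).coeff (i + 1) -
          algebraMap 𝔽 _ (aug W ((toPoly W (Sq _ 2 z)).coeff (i + 1))) =
        Sq W 2 ((toPoly W z).coeff (i + 1) - algebraMap 𝔽 _ (aug W ((toPoly W z).coeff (i + 1)))) +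
        (i : 𝔽) • Sq W 1 ((toPoly W z).coeff (i - 1 + 1) -
          algebraMap 𝔽 _ (aug W ((toPoly W z).coeff (i - 1 + 1)))) +
        ((i - 1).choose 2 : 𝔽) • ((toPoly W z).coeff (i - 2 + 1) -
          algebraMap 𝔽 _ (aug W ((toPoly W z).coeff (i - 2 + 1))))
      rw [(coeff_toPoly_Sq_two z i).2, map_add (aug W), map_add (aug W), aug_Sq _ _ two_ne_zero,
        map_smul, aug_Sq _ _ one_ne_zero, map_smul, Sq_sub_algebraMap one_ne_zero,
        Sq_sub_algebraMap two_ne_zero]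
      rcases i with _ | _ | i
      · simp
      · simp
      · rw [zero_add, smul_zero, zero_add, smul_eq_mul, map_mul, ← Algebra.smul_def, smul_sub,
          show i + 1 + 1 - 1 + 1 = i + 1 + 1 by lia, show i + 1 + 1 - 2 + 1 = i + 1 + 1 - 1 by lia]
        abel
  mem {d z} hz := by
    rcases mem_symMod.1 hz with ⟨hd, hz⟩ | rfl
    · refine ⟨mem_symMod_of_pos hd ?_, unitMod.mem_tens.2 fun i => ?_,
        (symMod W).mem_tens.2 fun i => ?_⟩
      · change (toPoly W z).coeff 0 ∈ _
        simpa using coeff_toPoly_mem hz 0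
      · rw [mem_unitMod, or_iff_not_imp_left]
        exact fun h => aug_eq_zero (coeff_toPoly_mem hz (i + 1)) (by push_cast; lia)
      · exact sub_algebraMap_aug_mem (coeff_toPoly_mem hz (i + 1)) (by push_cast; lia)
    · rw [map_zero]; exact zero_mem _
  inj {d z} hz h := by
    have h0 : (toPoly W z).coeff 0 = 0 := congrArg Prod.fst h
    have h1 : toPoly W z = 0 := by
      ext i
      rcases i with _ | i
      · exact h0
      · have h2 : aug W ((toPoly W z).coeff (i + 1)) = 0 := congrFun (congrArg (·.2.1) h) i
        have h3 : (toPoly W z).coeff (i + 1) - algebraMap 𝔽 _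
            (aug W ((toPoly W z).coeff (i + 1))) = 0 :=
          congrFun (congrArg (·.2.2) h) i
        rwa [h2, map_zero, sub_zero] at h3
    rw [← ofPoly_toPoly z, h1, map_zero]
  surj {d y} hy := by
    obtain ⟨y, f, h⟩ := y
    obtain ⟨hy, hf, hh⟩ := hy
    have hy : y ∈ (symMod W).g d := hy
    have hf : ∀ i : ℕ, d - i - 1 = 0 ∨ f i = 0 := fun i => mem_unitMod.1 (unitMod.mem_tens.1 hf i)
    have hh : ∀ i : ℕ, h i ∈ (symMod W).g (d - i - 1) := (symMod W).mem_tens.1 hh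
    let c : ℕ → Sym W := fun i => Nat.casesOn i y fun i => algebraMap 𝔽 _ (f i) + h i
    have hc : ∀ i : ℕ, c i ∈ symGr W (d - i) := by
      intro i
      rcases i with _ | i
      · change y ∈ symGr W (d - (0 : ℕ))
        simpa using mem_symGr_of_mem hy
      · have e : d - ((i + 1 : ℕ) : ℤ) = d - i - 1 := by push_cast; ring
        rw [e]
        refine add_mem ?_ (mem_symGr_of_mem (hh i))
        rcases hf i with h | h
        · rw [h]; exact algebraMap_mem_symGr _
        · rw [h, map_zero]; exact zero_mem _
    have hc' : ∀ i : ℕ, d < i → c i = 0 := fun i hi => by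
      have := hc i
      rw [symGr_of_neg (by lia)] at this
      exact (Submodule.mem_bot 𝔽).1 this
    have hp : ∀ i, (toPoly W (ofPoly W
        (∑ j ∈ Finset.range (d.toNat + 1), monomial j (c j)))).coeff i = c i := by
      intro i
      rw [toPoly_ofPoly, finsetSum_coeff]
      simp only [coeff_monomial]
      rw [Finset.sum_ite_eq']
      split_ifs with hi
      · rfl
      · exact (hc' i (by rw [Finset.mem_range] at hi; lia)).symm
    have haug : ∀ i, aug W (h i) = 0 := fun i => by
      rcases mem_symMod.1 (hh i) with ⟨h1, h2⟩ | h1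
      · exact aug_eq_zero h2 (by lia)
      · rw [h1, map_zero]
    refine ⟨ofPoly W (∑ j ∈ Finset.range (d.toNat + 1), monomial j (c j)), ?_, ?_⟩
    · by_cases hd : 0 < d
      · refine mem_symMod_of_pos hd ?_
        rw [map_sum]
        exact sum_mem fun j _ => ofPoly_monomial_mem (hc j)
      · have h0 : c 0 = 0 := by
          rcases mem_symMod.1 hy with h1 | h1
          · exact absurd h1.1 hd
          · exact h1
        rw [show d.toNat = 0 by lia]
        simp [h0]
    · refine Prod.ext (hp 0) (Prod.ext (funext fun i => ?_) (funext fun i => ?_))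
      · change aug W (Polynomial.coeff _ (i + 1)) = f i
        rw [hp]
        change aug W (algebraMap 𝔽 _ (f i) + h i) = f i
        rw [map_add, haug, AlgHom.commutes, add_zero]
        rfl
      · change Polynomial.coeff _ (i + 1) - algebraMap 𝔽 _
            (aug W (Polynomial.coeff _ (i + 1))) = h i
        rw [hp]
        change algebraMap 𝔽 _ (f i) + h i - algebraMap 𝔽 _
            (aug W (algebraMap 𝔽 _ (f i) + h i)) = h i
        rw [map_add, haug, AlgHom.commutes, add_zero]
        exact add_sub_cancel_left _ _

end

/-! ### Exactness in finite dimension -/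

theorem finite_induction {p : ∀ (V : Type) [AddCommGroup V] [Module 𝔽 V], Prop}
    (equiv : ∀ (V W : Type) [AddCommGroup V] [Module 𝔽 V] [AddCommGroup W] [Module 𝔽 W]
      (_ : V ≃ₗ[𝔽] W), p W → p V)
    (zero : p (Fin 0 → 𝔽))
    (prod : ∀ (W : Type) [AddCommGroup W] [Module 𝔽 W], p W → p (W × 𝔽))
    (V : Type) [AddCommGroup V] [Module 𝔽 V] [Module.Finite 𝔽 V] : p V := by
  have h : ∀ n : ℕ, p (Fin n → 𝔽) := by
    intro n
    induction n with
    | zero => exact zero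
    | succ n ih =>
      refine equiv _ _ (LinearEquiv.ofFinrankEq (Fin (n + 1) → 𝔽) ((Fin n → 𝔽) × 𝔽) ?_) (prod _ ih)
      simp
  exact equiv _ _ (Module.finBasis 𝔽 V).equivFun (h _)

theorem symGr_eq_bot_of_subsingleton (V : Type) [AddCommGroup V] [Module 𝔽 V] [Subsingleton V]
    (d : ℤ) : (symMod V).g d = ⊥ := by
  refine (Submodule.eq_bot_iff _).2 fun x hx => ?_
  rcases mem_symMod.1 hx with ⟨hd, hx⟩ | hx
  · lift d to ℕ using hd.le
    refine symGr_induction (p := fun n x => n ≠ 0 → x = 0) (fun h => absurd rfl h) ?_ ?_ ?_ hx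
      (by lia)
    · intro n x y hx hy h
      rw [hx h, hy h, add_zero]
    · exact fun _ _ => rfl
    · intro n x v _ _ _
      rw [Subsingleton.elim v 0, map_zero, mul_zero]
  · exact hx

variable (V : Type) [AddCommGroup V] [Module 𝔽 V] [Module.Finite 𝔽 V]

theorem symMod_acyclic : (symMod V).Acyclic := by
  refine finite_induction (p := fun V _ _ => (symMod V).Acyclic) ?_ ?_ ?_ V
  · exact fun V W _ _ _ _ e h => (grEquiv_of_linearEquiv e).acyclic h
  · intro d x hx _
    rw [symGr_eq_bot_of_subsingleton] at hx
    exact ⟨0, zero_mem _, by rw [map_zero, (Submodule.mem_bot 𝔽).1 hx]⟩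
  · intro W _ _ h
    exact split_grEquiv.acyclic (SqMod.prod_acyclic h
      (SqMod.prod_acyclic unitMod.tens_acyclic (symMod W).tens_acyclic))

/-- The complex is exact in the internal degrees congruent to 1, 2, 3 or 5 modulo 8. -/
theorem symMod_exactAt {s t : ℤ} (h : (t + s) % 8 = 1 ∨ (t + s) % 8 = 2 ∨
    (t + s) % 8 = 3 ∨ (t + s) % 8 = 5) : (symMod V).ExactAt s t := by
  refine (finite_induction (p := fun V _ _ => (symMod V).Acyclic ∧ ∀ s t : ℤ, ((t + s) % 8 = 1 ∨
    (t + s) % 8 = 2 ∨ (t + s) % 8 = 3 ∨ (t + s) % 8 = 5) → (symMod V).ExactAt s t)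
    ?_ ?_ ?_ V).2 s t h
  · exact fun V W _ _ _ _ e h => ⟨(grEquiv_of_linearEquiv e).acyclic h.1,
      fun s t hst => (grEquiv_of_linearEquiv e).exactAt (h.2 s t hst)⟩
  · refine ⟨symMod_acyclic _, fun s t _ => ?_⟩
    exact SqMod.exactAt_of_le (c := t + 3 * s) (fun _ _ => symGr_eq_bot_of_subsingleton _ _) le_rfl
  · rintro W _ _ ⟨hW, h⟩
    refine ⟨split_grEquiv.acyclic (SqMod.prod_acyclic hW
      (SqMod.prod_acyclic unitMod.tens_acyclic (symMod W).tens_acyclic)), fun s t hst => ?_⟩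
    refine split_grEquiv.exactAt (SqMod.prod_exactAt (h s t hst)
      (SqMod.prod_exactAt (unitMod_tens_exactAt hst) ?_))
    rw [← sub_add_cancel s 1]
    refine (symMod W).tens_exactAt hW symMod_vanishesBelow (h _ _ ?_)
    rwa [show t + 1 + (s - 1) = t + s by ring]

theorem symMod_ZH_le_BH {d : ℤ} (hd : d % 2 = 1) : (symMod V).ZH d ≤ (symMod V).BH d := by
  refine finite_induction (p := fun V _ _ => ∀ d : ℤ, d % 2 = 1 →
    (symMod V).ZH d ≤ (symMod V).BH d) ?_ ?_ ?_ V d hd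
  · exact fun V W _ _ _ _ e h d hd => (grEquiv_of_linearEquiv e).ZH_le_BH (h d hd)
  · intro d _ x hx
    have := hx.1
    rw [symGr_eq_bot_of_subsingleton] at this
    rw [(Submodule.mem_bot 𝔽).1 this]
    exact zero_mem _
  · intro W _ _ h d hd
    exact split_grEquiv.ZH_le_BH (SqMod.prod_ZH_le_BH (h d hd)
      (SqMod.prod_ZH_le_BH (unitMod_tens_ZH_le_BH (by lia))
        (SqMod.tens_ZH_le_BH (h _ (by lia)))))

theorem symMod_ZU_le_BU {d : ℤ} (hd : d % 2 = 1) : (symMod V).ZU d ≤ (symMod V).BU d :=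
  SqMod.ZU_le_BU (symMod_acyclic V) symMod_vanishesBelow (fun d => d % 2 = 1)
    (fun _ _ => by lia) (fun _ hd => symMod_ZH_le_BH V hd) hd

/-! ### The homology of `Q₁` and exterior powers -/

section

variable (V : Type) [AddCommGroup V] [Module 𝔽 V]

/-- The Milnor operation `Q₁ = Sq¹ Sq² + Sq² Sq¹` is a derivation. -/
theorem q_mul (x y : Sym V) :
    (symMod V).q (x * y) = (symMod V).q x * y + x * (symMod V).q y := by
  have h2 := two_eq_zero' V
  simp only [SqMod.q_apply, symMod_a, symMod_b, Sq_two_mul, Sq_one_mul, map_add, Sq_one_Sq_one]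
  linear_combination (Sq V 2 x * Sq V 1 y + Sq V 1 x * Sq V 2 y) * h2

theorem q_algebraMap (r : 𝔽) : (symMod V).q (algebraMap 𝔽 _ r) = 0 := by
  simp [SqMod.q_apply, symMod_a, symMod_b, Sq_algebraMap V 1 one_ne_zero,
    Sq_algebraMap V 2 two_ne_zero]

theorem q_ι (v : V) : (symMod V).q (SymmetricAlgebra.ι 𝔽 V v) = SymmetricAlgebra.ι 𝔽 V v ^ 4 := by
  rw [SqMod.q_apply, symMod_a, symMod_b, Sq_two_ι, map_zero, zero_add, symMod_a, symMod_b,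
    Sq_one_ι, pow_two, Sq_two_mul, Sq_one_ι, Sq_two_ι]
  ring

theorem q_sq (x : Sym V) : (symMod V).q (x ^ 2) = 0 := by
  have h2 := two_eq_zero' V
  rw [pow_two, q_mul]
  linear_combination ((symMod V).q x * x) * h2

theorem q_mul_sq (x y : Sym V) : (symMod V).q (x * y ^ 2) = (symMod V).q x * y ^ 2 := by
  rw [q_mul, q_sq, mul_zero, add_zero]

/-- The multilinear map `(v₁, …, v_m) ↦ v₁² ⋯ v_m²`. -/
def sqProd (m : ℕ) : MultilinearMap 𝔽 (fun _ : Fin m => V) (Sym V) :=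
  (MultilinearMap.mkPiAlgebra 𝔽 (Fin m) (Sym V)).compLinearMap
    fun _ => Sq V 1 ∘ₗ SymmetricAlgebra.ι 𝔽 V

theorem sqProd_apply (m : ℕ) (v : Fin m → V) :
    sqProd V m v = (∏ i, SymmetricAlgebra.ι 𝔽 V (v i)) ^ 2 := by
  rw [← Finset.prod_pow]
  exact (MultilinearMap.mkPiAlgebra_apply (R := 𝔽) (ι := Fin m) (A := Sym V) _).trans
    (Finset.prod_congr rfl fun i _ => Sq_one_ι V _)

theorem prod_ι_mem (s : Finset ι) (v : ι → V) :
    ∏ i ∈ s, SymmetricAlgebra.ι 𝔽 V (v i) ∈ symGr V s.card := by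
  classical
  induction s using Finset.induction_on with
  | empty => simpa using algebraMap_mem_symGr (V := V) 1
  | insert a s ha ih =>
    rw [Finset.prod_insert ha, Finset.card_insert_of_notMem ha]
    exact mul_mem_symGr (ι_mem_symGr _) ih (by push_cast; ring)

theorem sqProd_mem {m : ℕ} (hm : 0 < m) (v : Fin m → V) :
    sqProd V m v ∈ (symMod V).ZH (2 * m) := by
  refine ⟨mem_symMod_of_pos (by lia) ?_, LinearMap.mem_ker.2 ?_⟩
  · rw [sqProd_apply, pow_two]
    have := prod_ι_mem V Finset.univ v
    rw [Finset.card_univ, Fintype.card_fin] at this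
    exact mul_mem_symGr this this (by ring)
  · rw [sqProd_apply, q_sq]

/-- If `v` occurs twice in the product `v₁² ⋯ v_m²`, the product is `v⁴ y² = Q₁ (v y²)`. -/
theorem sqProd_mem_BH {m : ℕ} (v : Fin m → V) {i j : Fin m} (h : v i = v j) (hij : i ≠ j) :
    sqProd V m v ∈ (symMod V).BH (2 * m) := by
  classical
  have e1 : j ∈ Finset.univ.erase i := Finset.mem_erase.2 ⟨hij.symm, Finset.mem_univ _⟩
  have hc : ((Finset.univ.erase i).erase j).card = m - 2 := by
    rw [Finset.card_erase_of_mem e1, Finset.card_erase_of_mem (Finset.mem_univ _),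
      Finset.card_univ, Fintype.card_fin]
    rfl
  have hm : 2 ≤ m := by
    have := i.2
    have := j.2
    have : (i : ℕ) ≠ j := fun h => hij (Fin.ext h)
    lia
  have := prod_ι_mem V ((Finset.univ.erase i).erase j) v
  rw [hc] at this
  refine ⟨SymmetricAlgebra.ι 𝔽 V (v i) *
    (∏ k ∈ (Finset.univ.erase i).erase j, SymmetricAlgebra.ι 𝔽 V (v k)) ^ 2,
    mem_symMod_of_pos (by lia) (mul_mem_symGr (e := 2 * (m - 2 : ℕ)) (ι_mem_symGr _) ?_ (by lia)),
    ?_⟩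
  · rw [pow_two]
    exact mul_mem_symGr this this (by ring)
  · rw [q_mul_sq, q_ι, sqProd_apply, ← Finset.mul_prod_erase _ _ (Finset.mem_univ i),
      ← Finset.mul_prod_erase _ _ e1, ← h]
    ring

/-- The alternating map `(v₁, …, v_m) ↦ v₁² ⋯ v_m²` with values in `Q₁`-homology. -/
def sqAlt (m : ℕ) : V [⋀^Fin m]→ₗ[𝔽] (Sym V ⧸ (symMod V).BH (2 * m)) where
  __ := ((symMod V).BH (2 * m)).mkQ.compMultilinearMap (sqProd V m)
  map_eq_zero_of_eq' v _ _ h hij :=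
    (Submodule.Quotient.mk_eq_zero _).2 (sqProd_mem_BH V v h hij)

/-- The linear map from the exterior power to `Q₁`-homology which sends `v₁ ∧ ⋯ ∧ v_m` to the class
of `v₁² ⋯ v_m²`. -/
def wedgeSq (m : ℕ) : ⋀[𝔽]^m V →ₗ[𝔽] Sym V ⧸ (symMod V).BH (2 * m) :=
  exteriorPower.alternatingMapLinearEquiv (sqAlt V m)

theorem wedgeSq_ιMulti (m : ℕ) (v : Fin m → V) :
    wedgeSq V m (exteriorPower.ιMulti 𝔽 m v) = Submodule.Quotient.mk (sqProd V m v) :=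
  exteriorPower.alternatingMapLinearEquiv_apply_ιMulti _ _

end

/-- A linear map out of an exterior power is injective if there are functionals which are dual to
the images of the standard basis vectors. -/
theorem injective_of_dual {K V N I : Type*} [Field K] [AddCommGroup V] [Module K V] [AddCommGroup N]
    [Module K N] [LinearOrder I] (b : Module.Basis I K V) {m : ℕ} (f : ⋀[K]^m V →ₗ[K] N)
    (c : Set.powersetCard I m → N →ₗ[K] K)
    (h1 : ∀ s, c s (f (exteriorPower.ιMulti_family K m b s)) = 1)
    (h0 : ∀ s t, s ≠ t → c s (f (exteriorPower.ιMulti_family K m b t)) = 0) :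
    Function.Injective f := by
  refine (injective_iff_map_eq_zero f).2 fun y hy => (b.exteriorPower m).ext_elem fun s => ?_
  have e : (b.exteriorPower m).coord s = c s ∘ₗ f := by
    refine (b.exteriorPower m).ext fun t => ?_
    rw [Module.Basis.coord_apply, Module.Basis.repr_self, LinearMap.comp_apply,
      exteriorPower.basis_apply]
    by_cases h : s = t
    · subst h; rw [h1, Finsupp.single_eq_same]
    · rw [h0 _ _ h, Finsupp.single_eq_of_ne h]
  have := LinearMap.congr_fun e y
  rw [LinearMap.comp_apply, hy, map_zero] at this
  rw [map_zero]
  exact this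

section

variable {V : Type} [AddCommGroup V] [Module 𝔽 V] {I : Type*} (b : Module.Basis I 𝔽 V)

/-- On polynomials, `Q₁` is the derivation which sends `X` to `X⁴` for each variable `X`. -/
theorem equivMvPolynomial_q (x : Sym V) :
    SymmetricAlgebra.equivMvPolynomial b ((symMod V).q x) =
      MvPolynomial.mkDerivation 𝔽 (fun i => (MvPolynomial.X i ^ 4 : MvPolynomial I 𝔽))
        (SymmetricAlgebra.equivMvPolynomial b x) := by
  obtain ⟨p, rfl⟩ := (SymmetricAlgebra.equivMvPolynomial b).symm.surjective x
  rw [AlgEquiv.apply_symm_apply]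
  induction p using MvPolynomial.induction_on with
  | C a =>
    rw [MvPolynomial.derivation_C, show MvPolynomial.C a =
      algebraMap 𝔽 (MvPolynomial I 𝔽) a from rfl,
      AlgEquiv.commutes, q_algebraMap, map_zero]
  | add p q hp hq => rw [map_add, map_add, map_add, map_add, hp, hq]
  | mul_X p i hp =>
    rw [map_mul, q_mul, map_add, map_mul, map_mul, hp, Derivation.leibniz,
      SymmetricAlgebra.equivMvPolynomial_symm_X, q_ι, map_pow,
      SymmetricAlgebra.equivMvPolynomial_ι_apply, MvPolynomial.mkDerivation_X,
      AlgEquiv.apply_symm_apply, smul_eq_mul, smul_eq_mul]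
    ring

/-- In a `Q₁`-boundary no monomial has all its exponents at most two. -/
theorem coeff_q_eq_zero (β : I →₀ ℕ) (hβ : ∀ i, β i ≤ 2) (x : Sym V) :
    (SymmetricAlgebra.equivMvPolynomial b ((symMod V).q x)).coeff β = 0 := by
  rw [equivMvPolynomial_q]
  generalize SymmetricAlgebra.equivMvPolynomial b x = p
  induction p using MvPolynomial.induction_on' with
  | add p q hp hq => rw [map_add, MvPolynomial.coeff_add, hp, hq, add_zero]
  | monomial α r =>
    classical
    rw [MvPolynomial.mkDerivation_monomial, MvPolynomial.coeff_smul, Finsupp.sum,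
      MvPolynomial.coeff_sum, Finset.sum_eq_zero, smul_zero]
    intro i _
    rw [MvPolynomial.X_pow_eq_monomial, smul_eq_mul, MvPolynomial.monomial_mul,
      MvPolynomial.coeff_monomial, if_neg]
    intro h
    have := hβ i
    rw [← h] at this
    simp at this

theorem wedgeSq_injective [Module.Finite 𝔽 V] (m : ℕ) : Function.Injective (wedgeSq V m) := by
  classical
  let b := Module.finBasis 𝔽 V
  let β : Finset (Fin (Module.finrank 𝔽 V)) → (Fin (Module.finrank 𝔽 V) →₀ ℕ) :=
    fun s => ∑ i ∈ s, Finsupp.single i 2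
  have hβ : ∀ s i, β s i = if i ∈ s then 2 else 0 := fun s i => by
    simp [β, Finsupp.finsetSum_apply, Finsupp.single_apply]
  let C : Set.powersetCard (Fin (Module.finrank 𝔽 V)) m → Sym V →ₗ[𝔽] 𝔽 := fun s =>
    MvPolynomial.lcoeff 𝔽 (β s.1) ∘ₗ (SymmetricAlgebra.equivMvPolynomial b).toLinearMap
  have hC : ∀ s x, C s x = (SymmetricAlgebra.equivMvPolynomial b x).coeff (β s.1) := fun s x => rfl
  have h0 : ∀ s, (symMod V).BH (2 * m) ≤ LinearMap.ker (C s) := by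
    rintro s _ ⟨r, -, rfl⟩
    rw [LinearMap.mem_ker, hC]
    exact coeff_q_eq_zero b _ (fun i => by rw [hβ]; split_ifs <;> simp) r
  have h1 : ∀ s t, Submodule.liftQ _ (C s) (h0 s)
      (wedgeSq V m (exteriorPower.ιMulti_family 𝔽 m b t)) = if β t.1 = β s.1 then 1 else 0 := by
    intro s t
    have e : ∏ i, SymmetricAlgebra.ι 𝔽 V (b (Set.powersetCard.ofFinEmbEquiv.symm t i)) =
        ∏ i ∈ t.1, SymmetricAlgebra.ι 𝔽 V (b i) := by
      refine Finset.prod_bij (fun i _ => Set.powersetCard.ofFinEmbEquiv.symm t i)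
        (fun i _ => ?_) (fun i _ j _ h => ?_) (fun i hi => ?_) (fun _ _ => rfl)
      · exact (Set.powersetCard.mem_range_ofFinEmbEquiv_symm_iff_mem t _).1 ⟨i, rfl⟩
      · exact (Set.powersetCard.ofFinEmbEquiv.symm t).injective h
      · obtain ⟨j, hj⟩ := (Set.powersetCard.mem_range_ofFinEmbEquiv_symm_iff_mem t i).2 hi
        exact ⟨j, Finset.mem_univ _, hj⟩
    rw [exteriorPower.ιMulti_family, wedgeSq_ιMulti, Submodule.liftQ_apply, hC, sqProd_apply]
    simp only [Function.comp_apply]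
    rw [e, map_pow, map_prod]
    simp only [SymmetricAlgebra.equivMvPolynomial_ι_apply]
    rw [← Finset.prod_pow]
    simp only [MvPolynomial.X_pow_eq_monomial]
    rw [← MvPolynomial.monomial_sum_one, MvPolynomial.coeff_monomial]
  refine injective_of_dual b _ (fun s => Submodule.liftQ _ (C s) (h0 s))
    (fun s => by rw [h1, if_pos rfl]) fun s t hst => ?_
  rw [h1, if_neg]
  intro h
  refine hst (Subtype.ext (Finset.ext fun i => ?_))
  have := DFunLike.congr_fun h i
  rw [hβ, hβ] at this
  by_cases h1 : i ∈ s.1 <;> by_cases h2 : i ∈ t.1 <;> simp_all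

end

section

variable {V W : Type} [AddCommGroup V] [Module 𝔽 V] [AddCommGroup W] [Module 𝔽 W]

theorem Sym.map_sqProd (f : V →ₗ[𝔽] W) {m : ℕ} (v : Fin m → V) :
    Sym.map f (sqProd V m v) = sqProd W m (f ∘ v) := by
  simp only [sqProd_apply, map_pow, map_prod, Sym.map_ι, Function.comp_apply]

theorem Sym.map_q (f : V →ₗ[𝔽] W) (x : Sym V) :
    Sym.map f ((symMod V).q x) = (symMod W).q (Sym.map f x) := by
  simp only [SqMod.q_apply, symMod_a, symMod_b, Sq_map, map_add]

theorem Sym.map_mem_BH (f : V →ₗ[𝔽] W) {d : ℤ} {x : Sym V} (hx : x ∈ (symMod V).BH d) :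
    Sym.map f x ∈ (symMod W).BH d := by
  obtain ⟨r, hr, rfl⟩ := hx
  exact ⟨Sym.map f r, Sym.map_mem_symMod f hr, (Sym.map_q f r).symm⟩

theorem Sym.map_mem_ZH (f : V →ₗ[𝔽] W) {d : ℤ} {x : Sym V} (hx : x ∈ (symMod V).ZH d) :
    Sym.map f x ∈ (symMod W).ZH d :=
  ⟨Sym.map_mem_symMod f hx.1, LinearMap.mem_ker.2 (by
    rw [← Sym.map_q, LinearMap.mem_ker.1 hx.2, map_zero])⟩

theorem Sym.map_mem_span_sqProd (f : V →ₗ[𝔽] W) {m : ℕ} {x : Sym V}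
    (hx : x ∈ Submodule.span 𝔽 (Set.range (sqProd V m))) :
    Sym.map f x ∈ Submodule.span 𝔽 (Set.range (sqProd W m)) := by
  have : Submodule.span 𝔽 (Set.range (sqProd V m)) ≤
      (Submodule.span 𝔽 (Set.range (sqProd W m))).comap (Sym.map f).toLinearMap := by
    rw [Submodule.span_le]
    rintro _ ⟨v, rfl⟩
    exact Submodule.subset_span ⟨_, (Sym.map_sqProd f v).symm⟩
  exact this hx

theorem mul_lastVar_sq_mem_span {m : ℕ} {x : Sym W}
    (hx : x ∈ Submodule.span 𝔽 (Set.range (sqProd W m))) :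
    symInl W x * lastVar W ^ 2 ∈ Submodule.span 𝔽 (Set.range (sqProd (W × 𝔽) (m + 1))) := by
  have : Submodule.span 𝔽 (Set.range (sqProd W m)) ≤
      (Submodule.span 𝔽 (Set.range (sqProd (W × 𝔽) (m + 1)))).comap
        (LinearMap.mulRight 𝔽 (lastVar W ^ 2) ∘ₗ (symInl W).toLinearMap) := by
    rw [Submodule.span_le]
    rintro _ ⟨v, rfl⟩
    refine Submodule.subset_span ⟨Fin.snoc (fun i => (v i, 0)) (0, 1), ?_⟩
    rw [sqProd_apply, Fin.prod_univ_castSucc, mul_pow]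
    simp only [Fin.snoc_castSucc, Fin.snoc_last]
    change _ = Sym.map (LinearMap.inl 𝔽 W 𝔽) (sqProd W m v) * lastVar W ^ 2
    rw [Sym.map_sqProd, sqProd_apply]
    rfl
  exact this hx

theorem split_symInl (x : Sym W) : split (symInl W x) = (x, 0, 0) := by
  refine Prod.ext ?_ (Prod.ext (funext fun i => ?_) (funext fun i => ?_))
  · change (toPoly W _).coeff 0 = x
    rw [toPoly_symInl, Polynomial.coeff_C_zero]
  · change aug W ((toPoly W _).coeff (i + 1)) = 0
    rw [toPoly_symInl, Polynomial.coeff_C_succ, map_zero]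
  · change (toPoly W _).coeff (i + 1) - algebraMap 𝔽 _ (aug W ((toPoly W _).coeff (i + 1))) = 0
    rw [toPoly_symInl, Polynomial.coeff_C_succ, map_zero, map_zero, sub_zero]

theorem split_mul_lastVar_sq (x : Sym W) : split (symInl W x * lastVar W ^ 2) =
    (0, Pi.single 1 (aug W x), Pi.single 1 (x - algebraMap 𝔽 _ (aug W x))) := by
  have e : toPoly W (symInl W x * lastVar W ^ 2) = Polynomial.monomial 2 x := by
    rw [map_mul, map_pow, toPoly_symInl, toPoly_lastVar, Polynomial.C_mul_X_pow_eq_monomial]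
  refine Prod.ext ?_ (Prod.ext (funext fun i => ?_) (funext fun i => ?_))
  · change (toPoly W _).coeff 0 = 0
    rw [e, Polynomial.coeff_monomial, if_neg (by lia)]
  · change aug W ((toPoly W _).coeff (i + 1)) = (Pi.single 1 (aug W x) : ℕ → 𝔽) i
    rw [e, Polynomial.coeff_monomial]
    by_cases h : i = 1
    · subst h; simp
    · rw [if_neg (by lia), Pi.single_eq_of_ne h, map_zero]
  · change (toPoly W _).coeff (i + 1) - algebraMap 𝔽 _ (aug W ((toPoly W _).coeff (i + 1))) =
      (Pi.single 1 (x - algebraMap 𝔽 _ (aug W x)) : ℕ → Sym W) i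
    rw [e, Polynomial.coeff_monomial]
    by_cases h : i = 1
    · subst h; simp
    · rw [if_neg (by lia), Pi.single_eq_of_ne h, map_zero, map_zero, sub_zero]

/-- Every `Q₁`-cycle of even degree is homologous to a sum of products of squares. -/
theorem ZH_le_span_sup_BH (V : Type) [AddCommGroup V] [Module 𝔽 V] [Module.Finite 𝔽 V] {m : ℕ}
    (hm : 0 < m) : (symMod V).ZH (2 * m) ≤
      Submodule.span 𝔽 (Set.range (sqProd V m)) ⊔ (symMod V).BH (2 * m) := by
  refine finite_induction (p := fun V _ _ => ∀ m : ℕ, 0 < m → (symMod V).ZH (2 * m) ≤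
      Submodule.span 𝔽 (Set.range (sqProd V m)) ⊔ (symMod V).BH (2 * m)) ?_ ?_ ?_ V m hm
  · intro V W _ _ _ _ e h m hm x hx
    obtain ⟨y, hy, z, hz, h⟩ := Submodule.mem_sup.1 (h m hm (Sym.map_mem_ZH e.toLinearMap hx))
    have h1 := congrArg (Sym.map e.symm.toLinearMap) h
    rw [← AlgHom.comp_apply, ← Sym.map_comp, LinearEquiv.comp_coe, LinearEquiv.self_trans_symm,
      LinearEquiv.refl_toLinearMap, Sym.map_id, AlgHom.id_apply, map_add] at h1
    rw [← h1]
    exact Submodule.add_mem_sup (Sym.map_mem_span_sqProd _ hy) (Sym.map_mem_BH _ hz)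
  · intro m _ x hx
    have := hx.1
    rw [symGr_eq_bot_of_subsingleton] at this
    rw [(Submodule.mem_bot 𝔽).1 this]
    exact zero_mem _
  · intro W _ _ ih m hm z hz
    have hs := split_grEquiv (W := W)
    have hq : ((symMod W).prod (unitMod.tens.prod (symMod W).tens)).q (split z) = 0 := by
      rw [← hs.map_q, LinearMap.mem_ker.1 hz.2, map_zero]
    have hq₀ : unitMod.tens.q (split z).2.1 = 0 ∧ (symMod W).tens.q (split z).2.2 = 0 :=
      Prod.mk.inj (congrArg Prod.snd hq)
    obtain ⟨g0, g1, g2⟩ := hs.mem hz.1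
    obtain ⟨y₀, hy₀, z₀, ⟨r₀, hr₀, rfl⟩, e₀⟩ :=
      Submodule.mem_sup.1 (ih m hm ⟨g0, congrArg Prod.fst hq⟩)
    obtain ⟨-, h₁, hh₁, e₁⟩ := SqMod.exists_q_eq_sub ⟨g1, hq₀.1⟩
    obtain ⟨hq₂, h₂, hh₂, e₂⟩ := SqMod.exists_q_eq_sub ⟨g2, hq₀.2⟩
    have k1 := mem_unitMod.1 (unitMod.mem_tens.1 g1 1)
    have k2 := (symMod W).mem_tens.1 g2 1
    -- the coefficient of `x²` is a constant for `m = 1` and a cycle of positive degree otherwise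
    obtain ⟨y₁, hy₁, r₁, hr₁, a₁, a₂⟩ : ∃ y₁ ∈ Submodule.span 𝔽 (Set.range (sqProd W (m - 1))),
        ∃ r₁ ∈ (symMod W).g (2 * m - 5), aug W y₁ = (split z).2.1 1 ∧
          y₁ - algebraMap 𝔽 _ (aug W y₁) + (symMod W).q r₁ = (split z).2.2 1 := by
      rcases Nat.lt_or_ge 1 m with h | h
      · obtain ⟨y₁, hy₁, z₁, ⟨r₁, hr₁, rfl⟩, e⟩ :=
          Submodule.mem_sup.1 (ih (m - 1) (by lia) (x := (split z).2.2 1)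
            ⟨(symMod W).g_mem k2 (by push_cast; lia), LinearMap.mem_ker.2 hq₂⟩)
        have ha : aug W y₁ = 0 := by
          have : y₁ = (split z).2.2 1 - (symMod W).q r₁ := by rw [← e]; abel
          rw [this]
          refine aug_eq_zero (d := 2 * m - 2) (mem_symGr_of_mem (sub_mem
            ((symMod W).g_mem k2 (by push_cast; lia)) ((symMod W).q_mem hr₁ (by lia))))
            (by lia)
        refine ⟨y₁, hy₁, r₁, (symMod W).g_mem hr₁ (by lia), ?_, ?_⟩
        · rw [ha]
          exact (k1.resolve_left (by push_cast; lia)).symm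
        · rw [ha, map_zero, sub_zero]; exact e
      · obtain rfl : m = 1 := by lia
        refine ⟨algebraMap 𝔽 _ ((split z).2.1 1), ?_, 0, zero_mem _, AlgHom.commutes _ _, ?_⟩
        · rw [Algebra.algebraMap_eq_smul_one]
          exact Submodule.smul_mem _ _ (Submodule.subset_span ⟨0, by simp [sqProd_apply]⟩)
        · rw [map_zero, add_zero, AlgHom.commutes]
          exact (sub_self _).trans (symMod_vanishesBelow.eq_zero k2 (by simp)).symm
    obtain ⟨r, hr, er⟩ := hs.surj (d := 2 * m - 3) (y := (r₀, h₁, h₂ + Pi.single 1 r₁))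
      ⟨hr₀, hh₁, add_mem hh₂ (SqMod.single_mem_tens ((symMod W).g_mem hr₁ (by push_cast; lia)))⟩
    have hy : symInl W y₀ + symInl W y₁ * lastVar W ^ 2 ∈
        Submodule.span 𝔽 (Set.range (sqProd (W × 𝔽) m)) := by
      refine add_mem (Sym.map_mem_span_sqProd _ hy₀) ?_
      have := mul_lastVar_sq_mem_span hy₁
      rwa [Nat.sub_add_cancel hm] at this
    have hy' : Submodule.span 𝔽 (Set.range (sqProd (W × 𝔽) m)) ≤ (symMod (W × 𝔽)).g (2 * m) := by
      rw [Submodule.span_le]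
      rintro _ ⟨v, rfl⟩
      exact (sqProd_mem _ hm v).1
    have key : z - (symInl W y₀ + symInl W y₁ * lastVar W ^ 2 + (symMod _).q r) = 0 := by
      refine hs.inj (sub_mem hz.1 (add_mem (hy' hy) ((symMod _).q_mem hr (by lia)))) ?_
      rw [map_sub, map_add, map_add, split_symInl, split_mul_lastVar_sq, hs.map_q, er, sub_eq_zero]
      refine Prod.ext ?_ (Prod.ext ?_ ?_)
      · change (split z).1 = y₀ + 0 + (symMod W).q r₀
        rw [add_zero]; exact e₀.symm
      · change (split z).2.1 = 0 + Pi.single 1 (aug W y₁) + unitMod.tens.q h₁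
        rw [zero_add, a₁]
        exact sub_eq_iff_eq_add.1 e₁
      · change (split z).2.2 = 0 + Pi.single 1 (y₁ - algebraMap 𝔽 _ (aug W y₁)) +
          (symMod W).tens.q (h₂ + Pi.single 1 r₁)
        rw [zero_add, map_add, SqMod.tens_q_single, sub_eq_iff_eq_add.1 e₂, ← a₂, Pi.single_add]
        abel
    rw [sub_eq_zero.1 key]
    exact Submodule.add_mem_sup hy ⟨r, hr, rfl⟩

theorem range_wedgeSq (V : Type) [AddCommGroup V] [Module 𝔽 V] [Module.Finite 𝔽 V] {m : ℕ}
    (hm : 0 < m) : LinearMap.range (wedgeSq V m) =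
      ((symMod V).ZH (2 * m)).map ((symMod V).BH (2 * m)).mkQ := by
  have e : LinearMap.range (wedgeSq V m) = (Submodule.span 𝔽 (Set.range (sqProd V m))).map
      ((symMod V).BH (2 * m)).mkQ := by
    rw [LinearMap.range_eq_map, ← exteriorPower.ιMulti_span, Submodule.map_span, Submodule.map_span,
      ← Set.range_comp, ← Set.range_comp]
    congr 2
    funext v
    exact wedgeSq_ιMulti V m v
  rw [e]
  refine le_antisymm (Submodule.map_mono (Submodule.span_le.2 ?_)) ?_
  · rintro _ ⟨v, rfl⟩
    exact sqProd_mem V hm v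
  · refine (Submodule.map_mono (ZH_le_span_sup_BH V hm)).trans ?_
    rw [Submodule.map_sup, Submodule.mkQ_map_self, sup_bot_eq]

end

/-! ### A finiteness criterion for functors -/

/-- `F` is determined by its value at `E`: each `x ∈ F(V)` is a linear combination of elements
`F(g) F(h) x` with `h : V ⟶ E` and `g : E ⟶ V`. -/
def DeterminedBy (F : Fct) (E : FGModuleCat.{0} 𝔽) : Prop :=
  ∀ (V : FGModuleCat.{0} 𝔽) (x : F.obj V),
    x ∈ Submodule.span 𝔽 {y | ∃ (h : V ⟶ E) (g : E ⟶ V), y = F.map g (F.map h x)}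

/-- `F` is determined by a finite-dimensional value. -/
def IsSmall (F : Fct) : Prop :=
  ∃ E : FGModuleCat.{0} 𝔽, Module.Finite 𝔽 (F.obj E) ∧ DeterminedBy F E

theorem injective_app {F G : Fct} (α : F ⟶ G) [Mono α] (V : FGModuleCat.{0} 𝔽) :
    Function.Injective (α.app V) := by
  rw [← ModuleCat.mono_iff_injective]
  infer_instance

theorem naturality_apply' {F G : Fct} (α : F ⟶ G) {V W : FGModuleCat.{0} 𝔽} (f : V ⟶ W)
    (x : F.obj V) : α.app W (F.map f x) = G.map f (α.app V x) := by
  rw [← ModuleCat.comp_apply, α.naturality, ModuleCat.comp_apply]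

theorem IsSmall.of_injective {F G : Fct} (α : F ⟶ G) (hα : ∀ V, Function.Injective (α.app V))
    (hG : IsSmall G) : IsSmall F := by
  obtain ⟨E, _, hE⟩ := hG
  refine ⟨E, Module.Finite.of_injective (α.app E).hom (hα E), fun V x => ?_⟩
  have h := hE V (α.app V x)
  have e : {y | ∃ (h : V ⟶ E) (g : E ⟶ V), y = G.map g (G.map h (α.app V x))} =
      (α.app V).hom '' {y | ∃ (h : V ⟶ E) (g : E ⟶ V), y = F.map g (F.map h x)} := by
    ext y
    constructor
    · rintro ⟨h, g, rfl⟩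
      exact ⟨_, ⟨h, g, rfl⟩, by
        change α.app V _ = _
        rw [naturality_apply', naturality_apply']⟩
    · rintro ⟨_, ⟨h, g, rfl⟩, rfl⟩
      refine ⟨h, g, ?_⟩
      change α.app V _ = _
      rw [naturality_apply', naturality_apply']
  rw [e, ← Submodule.map_span] at h
  obtain ⟨y, hy, h⟩ := h
  obtain rfl := hα V h
  exact hy

theorem IsSmall.of_surjective {F G : Fct} (α : F ⟶ G) (hα : ∀ V, Function.Surjective (α.app V))
    (hF : IsSmall F) : IsSmall G := by
  obtain ⟨E, _, hE⟩ := hF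
  refine ⟨E, Module.Finite.of_surjective (α.app E).hom (hα E), fun V x => ?_⟩
  obtain ⟨x, rfl⟩ := hα V x
  have h := Submodule.mem_map_of_mem (f := (α.app V).hom) (hE V x)
  rw [Submodule.map_span] at h
  refine Submodule.span_mono ?_ h
  rintro _ ⟨_, ⟨h, g, rfl⟩, rfl⟩
  refine ⟨h, g, ?_⟩
  change α.app V _ = _
  rw [naturality_apply', naturality_apply']

/-- The value at `E` of a subobject. -/
def evalSub (F : Fct) (E : FGModuleCat.{0} 𝔽) (P : Subobject F) : Submodule 𝔽 (F.obj E) :=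
  LinearMap.range (P.arrow.app E).hom

theorem evalSub_mono (F : Fct) (E : FGModuleCat.{0} 𝔽) : Monotone (evalSub F E) := by
  rintro P Q h _ ⟨x, rfl⟩
  refine ⟨(Subobject.ofLE P Q h).app E x, ?_⟩
  change ((Subobject.ofLE P Q h) ≫ Q.arrow).app E x = _
  rw [Subobject.ofLE_arrow]

/-- If `F` is determined by its value at `E`, then a subfunctor of `F` is determined by its value at
`E`. -/
theorem evalSub_strictMono {F : Fct} {E : FGModuleCat.{0} 𝔽} (hE : DeterminedBy F E) :
    StrictMono (evalSub F E) := by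
  intro P Q h
  refine lt_of_le_not_ge (evalSub_mono F E h.le) fun h' => h.not_ge ?_
  have key : ∀ (V : FGModuleCat.{0} 𝔽) (x : (Q : Fct).obj V),
      x ∈ LinearMap.range ((Subobject.ofLE P Q h.le).app V).hom := by
    intro V x
    have h1 : ∀ y : (Q : Fct).obj E, ∃ z, (Subobject.ofLE P Q h.le).app E z = y := by
      intro y
      obtain ⟨z, hz⟩ := h' ⟨y, rfl⟩
      refine ⟨z, injective_app Q.arrow E ?_⟩
      change ((Subobject.ofLE P Q h.le) ≫ Q.arrow).app E z = _
      rw [Subobject.ofLE_arrow]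
      exact hz
    have h2 := hE V (Q.arrow.app V x)
    have h3 : Submodule.span 𝔽
        {y | ∃ (h : V ⟶ E) (g : E ⟶ V), y = F.map g (F.map h (Q.arrow.app V x))} ≤
        (LinearMap.range ((Subobject.ofLE P Q h.le).app V).hom).map (Q.arrow.app V).hom := by
      rw [Submodule.span_le]
      rintro _ ⟨f, g, rfl⟩
      obtain ⟨z, hz⟩ := h1 ((Q : Fct).map f x)
      refine ⟨_, ⟨(P : Fct).map g z, rfl⟩, ?_⟩
      change Q.arrow.app V ((Subobject.ofLE P Q h.le).app V ((P : Fct).map g z)) = _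
      rw [naturality_apply', hz, naturality_apply', naturality_apply']
    obtain ⟨y, hy, e⟩ := h3 h2
    rwa [← injective_app Q.arrow V e]
  have : ∀ V, Epi ((Subobject.ofLE P Q h.le).app V) := fun V =>
    (ModuleCat.epi_iff_surjective _).2 fun x => key V x
  have : Epi (Subobject.ofLE P Q h.le) := NatTrans.epi_of_epi_app _
  have : IsIso (Subobject.ofLE P Q h.le) := isIso_of_mono_of_epi _
  exact Subobject.le_of_comm (inv (Subobject.ofLE P Q h.le)) (by
    rw [IsIso.inv_comp_eq, Subobject.ofLE_arrow])

theorem IsSmall.isFinite {F : Fct} (hF : IsSmall F) : IsFinite F := by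
  obtain ⟨E, _, hE⟩ := hF
  have : WellFoundedLT (Subobject F) := (evalSub_strictMono hE).wellFoundedLT
  have : WellFoundedGT (Subobject F) := (evalSub_strictMono hE).wellFoundedGT
  obtain ⟨t, -, -, h⟩ := LTSeries.exists_relSeries_covBy_and_head_eq_bot_and_last_eq_bot
    (RelSeries.singleton {(a, b) : Subobject F × Subobject F | a < b} ⊥)
  exact ⟨t, h⟩

/-! ### Classes in the Grothendieck group -/

theorem jointlyReflectIsomorphisms_evaluation :
    JointlyReflectIsomorphisms
      fun V : FGModuleCat.{0} 𝔽 => (evaluation (FGModuleCat.{0} 𝔽) (ModuleCat.{0} 𝔽)).obj V where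
  isIso f h := (NatTrans.isIso_iff_isIso_app f).2 h

theorem cls_eq_add {A B C : Fct} (α : A ⟶ B) (β : B ⟶ C) (hA : IsFinite A) (hB : IsFinite B)
    (hC : IsFinite C) (h1 : ∀ V, Function.Injective (α.app V))
    (h2 : ∀ V, LinearMap.range (α.app V).hom = LinearMap.ker (β.app V).hom)
    (h3 : ∀ V, Function.Surjective (β.app V)) : cls B hB = cls A hA + cls C hC := by
  have h0 : α ≫ β = 0 := by
    refine NatTrans.ext (funext fun V => ModuleCat.hom_ext (LinearMap.ext fun x => ?_))
    have : α.app V x ∈ LinearMap.ker (β.app V).hom := by rw [← h2]; exact ⟨x, rfl⟩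
    exact this
  have hS : (ShortComplex.mk α β h0).ShortExact := by
    rw [jointlyReflectIsomorphisms_evaluation.shortExact_iff]
    intro V
    exact { exact := (ShortComplex.moduleCat_exact_iff_range_eq_ker _).2 (h2 V)
            mono_f := (ModuleCat.mono_iff_injective _).2 (h1 V)
            epi_g := (ModuleCat.epi_iff_surjective _).2 (h3 V) }
  rw [← sub_eq_zero]
  change QuotientAddGroup.mk (s := AddSubgroup.closure exactRelations)
    (FreeAbelianGroup.of ⟨B, hB⟩ -
    (FreeAbelianGroup.of ⟨A, hA⟩ + FreeAbelianGroup.of ⟨C, hC⟩)) = 0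
  exact (QuotientAddGroup.eq_zero_iff _).2
    (AddSubgroup.subset_closure ⟨ShortComplex.mk α β h0, hA, hB, hC, hS, rfl⟩)

theorem cls_eq_zero {A : Fct} (hA : IsFinite A) (h : ∀ V, Subsingleton (A.obj V)) :
    cls A hA = 0 := by
  have := cls_eq_add (𝟙 A) (𝟙 A) hA hA hA (fun V _ _ _ => Subsingleton.elim _ _)
    (fun V => Subsingleton.elim _ _) (fun V x => ⟨x, Subsingleton.elim _ _⟩)
  simpa using this

/-! ### Subfunctors, quotients and their classes -/

/-- The inclusion of a subfunctor. -/
def Subfct.incl {F : Fct} (G : Subfct F) : G.toFct ⟶ F where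
  app V := ModuleCat.ofHom (G.obj V).subtype

theorem Subfct.incl_injective {F : Fct} (G : Subfct F) (V : FGModuleCat.{0} 𝔽) :
    Function.Injective (G.incl.app V) := Subtype.val_injective

theorem Subfct.isSmall {F : Fct} (G : Subfct F) (hF : IsSmall F) : IsSmall G.toFct :=
  hF.of_injective G.incl G.incl_injective

/-- The quotient of a functor by a subfunctor. -/
def Subfct.quot {F : Fct} (G : Subfct F) : Fct where
  obj V := ModuleCat.of 𝔽 (F.obj V ⧸ G.obj V)
  map {V W} f := ModuleCat.ofHom
    (Submodule.mapQ (G.obj V) (G.obj W) (F.map f).hom fun x hx => G.map_mem f x hx)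
  map_id V := by
    refine ModuleCat.hom_ext (Submodule.linearMap_qext _ (LinearMap.ext fun x => ?_))
    change Submodule.Quotient.mk (F.map (𝟙 V) x) = Submodule.Quotient.mk x
    rw [F.map_id]
    rfl
  map_comp f g := by
    refine ModuleCat.hom_ext (Submodule.linearMap_qext _ (LinearMap.ext fun x => ?_))
    change Submodule.Quotient.mk (F.map (f ≫ g) x) = Submodule.Quotient.mk (F.map g (F.map f x))
    rw [F.map_comp]
    rfl

/-- The projection to the quotient. -/
def Subfct.proj {F : Fct} (G : Subfct F) : F ⟶ G.quot where
  app V := ModuleCat.ofHom (G.obj V).mkQ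

theorem Subfct.proj_eq_zero {F : Fct} (G : Subfct F) {V : FGModuleCat.{0} 𝔽} (x : F.obj V) :
    G.proj.app V x = 0 ↔ x ∈ G.obj V := Submodule.Quotient.mk_eq_zero _

/-- The image of a morphism of functors. -/
def image {F G : Fct} (α : F ⟶ G) : Subfct G where
  obj V := LinearMap.range (α.app V).hom
  map_mem {V W} f x hx := by
    obtain ⟨x, rfl⟩ := hx
    exact ⟨F.map f x, naturality_apply' α f x⟩

/-- The corestriction of a morphism of functors to its image. -/
def toImage {F G : Fct} (α : F ⟶ G) : F ⟶ (image α).toFct where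
  app V := ModuleCat.ofHom (LinearMap.rangeRestrict (α.app V).hom)
  naturality _ _ f := ModuleCat.hom_ext (LinearMap.ext fun x =>
    Subtype.ext (naturality_apply' α f x))

theorem toImage_surjective {F G : Fct} (α : F ⟶ G) (V : FGModuleCat.{0} 𝔽) :
    Function.Surjective ((toImage α).app V) := LinearMap.surjective_rangeRestrict _

theorem image_isSmall {F G : Fct} (α : F ⟶ G) (hF : IsSmall F) : IsSmall (image α).toFct :=
  hF.of_surjective _ (toImage_surjective α)

/-- The class of a functor is the sum of those of the kernel and the image of a morphism. -/
theorem cls_eq_add_image {A F G : Fct} (ι : A ⟶ F) (α : F ⟶ G) (hA : IsFinite A) (hF : IsSmall F)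
    (hι : ∀ V, Function.Injective (ι.app V))
    (h : ∀ V, LinearMap.range (ι.app V).hom = LinearMap.ker (α.app V).hom) :
    cls F hF.isFinite = cls A hA + cls (image α).toFct (image_isSmall α hF).isFinite :=
  cls_eq_add ι (toImage α) _ _ _ hι
    (fun V => (h V).trans (LinearMap.ker_rangeRestrict (α.app V).hom).symm) (toImage_surjective α)

theorem cls_congr_image {F F' G : Fct} (α : F ⟶ G) (α' : F' ⟶ G) (h : IsFinite (image α).toFct)
    (h' : IsFinite (image α').toFct)
    (e : ∀ V, LinearMap.range (α.app V).hom = LinearMap.range (α'.app V).hom) :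
    cls _ h = cls _ h' := by
  have : image α = image α' := by
    unfold image
    congr
    exact funext e
  congr 1
  rw [this]

/-! ### Polynomial functors are finite -/

theorem neg_one_pow_smul {M : Type*} [AddCommGroup M] [Module 𝔽 M] (k : ℕ) (x : M) :
    (-1 : ℤ) ^ k • x = x := by
  rcases neg_one_pow_eq_or ℤ k with h | h <;> rw [h]
  · rw [one_smul]
  · rw [neg_smul, one_smul, ZModModule.neg_eq_self]

theorem hasPolyDegreeLE_iff {F : Fct} {n : ℕ} : HasPolyDegreeLE F n ↔
    ∀ (V W : FGModuleCat.{0} 𝔽) (f : Fin (n + 1) → (V ⟶ W)) (x : F.obj V),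
      ∑ S : Finset (Fin (n + 1)), F.map (∑ i ∈ S, f i) x = 0 := by
  have e : ∀ (V W : FGModuleCat.{0} 𝔽) (f : Fin (n + 1) → (V ⟶ W)) (x : F.obj V),
      (∑ S : Finset (Fin (n + 1)), (-1 : ℤ) ^ S.card • F.map (∑ i ∈ S, f i)).hom x =
        ∑ S : Finset (Fin (n + 1)), F.map (∑ i ∈ S, f i) x := by
    intro V W f x
    rw [ModuleCat.hom_sum, LinearMap.sum_apply]
    refine Finset.sum_congr rfl fun S _ => ?_
    rw [ModuleCat.hom_zsmul, LinearMap.smul_apply, neg_one_pow_smul]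
  constructor
  · intro h V W f x
    rw [← e, h V W f]
    rfl
  · intro h V W f
    refine ModuleCat.hom_ext (LinearMap.ext fun x => ?_)
    rw [e, h]
    rfl

theorem Subfct.hasPolyDegreeLE_iff {F : Fct} {G : Subfct F} {n : ℕ} :
    HasPolyDegreeLE G.toFct n ↔
      ∀ (V W : FGModuleCat.{0} 𝔽) (f : Fin (n + 1) → (V ⟶ W)), ∀ x ∈ G.obj V,
        ∑ S : Finset (Fin (n + 1)), F.map (∑ i ∈ S, f i) x = 0 := by
  have e : ∀ (V W : FGModuleCat.{0} 𝔽) (f : Fin (n + 1) → (V ⟶ W)) (x : G.obj V),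
      (G.obj W).subtype (∑ S : Finset (Fin (n + 1)), G.toFct.map (∑ i ∈ S, f i) x) =
        ∑ S : Finset (Fin (n + 1)), F.map (∑ i ∈ S, f i) x.1 := fun V W f x => map_sum _ _ _
  rw [A1Cohomology.hasPolyDegreeLE_iff]
  refine ⟨fun h V W f x hx => ?_, fun h V W f x => Subtype.ext ?_⟩
  · exact (e V W f ⟨x, hx⟩).symm.trans
      ((congrArg (G.obj W).subtype (h V W f ⟨x, hx⟩)).trans (map_zero _))
  · exact (e V W f x).trans (h V W f x.1 x.2)

theorem map_sum_mem_span {F : Fct} {n : ℕ} (hF : HasPolyDegreeLE F n) {V W : FGModuleCat.{0} 𝔽}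
    {I : Type*} [Finite I] (e : I → (V ⟶ W)) (x : F.obj V) (S : Finset I) :
    F.map (∑ i ∈ S, e i) x ∈
      Submodule.span 𝔽 {y | ∃ T : Finset I, T.card ≤ n ∧ y = F.map (∑ i ∈ T, e i) x} := by
  classical
  rw [hasPolyDegreeLE_iff] at hF
  induction S using Finset.strongInduction with
  | H S ih =>
    by_cases hS : S.card ≤ n
    · exact Submodule.subset_span ⟨S, hS, rfl⟩
    -- partition `S` into `n + 1` non-empty blocks
    obtain ⟨σ⟩ : Nonempty (Fin (n + 1) ↪ S) :=
      Function.Embedding.nonempty_of_card_le (by simp; lia)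
    let c : I → Fin (n + 1) := Function.invFun fun k => (σ k : I)
    have hc : ∀ k, c (σ k) = k :=
      Function.leftInverse_invFun fun k l h => σ.injective (Subtype.ext h)
    have h := hF V W (fun k => ∑ i ∈ S with c i = k, e i) x
    rw [Fintype.sum_eq_add_sum_compl Finset.univ, add_eq_zero_iff_eq_neg] at h
    simp only [Finset.sum_fiberwise_eq_sum_filter, Finset.mem_univ, Finset.filter_true] at h
    rw [h]
    refine neg_mem (sum_mem fun U hU => ih _ ?_)
    obtain ⟨k, hk⟩ : ∃ k, k ∉ U := by
      by_contra! h
      simp [Finset.eq_univ_iff_forall.2 h] at hU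
    refine Finset.filter_ssubset.2 ⟨σ k, (σ k).2, ?_⟩
    rwa [hc]

/-- A polynomial functor of degree at most `n` is determined by its value at `𝔽ⁿ`. -/
theorem isSmall_of_hasPolyDegreeLE {F : Fct} {n : ℕ} (hF : HasPolyDegreeLE F n)
    (h : Module.Finite 𝔽 (F.obj (FGModuleCat.of 𝔽 (Fin n → 𝔽)))) : IsSmall F := by
  classical
  refine ⟨_, h, fun V x => ?_⟩
  let b := Module.finBasis 𝔽 V
  let e : Fin (Module.finrank 𝔽 V) → (V ⟶ V) := fun i =>
    FGModuleCat.ofHom ((b.coord i).smulRight (b i))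
  have he : ∀ (S : Finset _) (v : V), (∑ i ∈ S, e i).hom.hom v = ∑ i ∈ S, b.coord i v • b i := by
    intro S v
    induction S using Finset.induction_on with
    | empty => rfl
    | insert a S ha ih => rw [Finset.sum_insert ha, Finset.sum_insert ha, ← ih]; rfl
  have h1 : ∑ i, e i = 𝟙 V := FGModuleCat.hom_ext (LinearMap.ext fun v => by
    rw [he]; exact b.sum_repr v)
  have h2 := map_sum_mem_span hF e x Finset.univ
  rw [h1, F.map_id] at h2
  refine Submodule.span_mono ?_ h2
  rintro _ ⟨T, hT, rfl⟩
  obtain ⟨σ⟩ : Nonempty (T ↪ Fin n) := Function.Embedding.nonempty_of_card_le (by simpa using hT)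
  let f : V →ₗ[𝔽] (Fin n → 𝔽) := ∑ i : T, (b.coord i).smulRight (Pi.single (σ i) 1)
  let g : (Fin n → 𝔽) →ₗ[𝔽] V := ∑ i : T, (LinearMap.proj (σ i)).smulRight (b i)
  have hfg : (FGModuleCat.ofHom f : V ⟶ FGModuleCat.of 𝔽 (Fin n → 𝔽)) ≫
      (FGModuleCat.ofHom g : FGModuleCat.of 𝔽 (Fin n → 𝔽) ⟶ V) = ∑ i ∈ T, e i := by
    refine FGModuleCat.hom_ext (LinearMap.ext fun v => ?_)
    rw [he]
    change g (f v) = _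
    simp only [f, g, LinearMap.sum_apply, LinearMap.smulRight_apply, LinearMap.proj_apply,
      Finset.sum_apply, Pi.smul_apply, Pi.single_apply, σ.injective.eq_iff, smul_eq_mul, mul_ite,
      mul_one, mul_zero, Finset.sum_ite_eq, Finset.mem_univ, if_true]
    exact Finset.sum_coe_sort T fun i => b.coord i v • b i
  refine ⟨FGModuleCat.ofHom f, FGModuleCat.ofHom g, ?_⟩
  rw [← hfg, F.map_comp]
  rfl

/-! ### The functors `S^d` -/

/-- The functor `V ↦ S^*(V)`. -/
def symF : Fct where
  obj V := ModuleCat.of 𝔽 (Sym V)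
  map f := ModuleCat.ofHom (Sym.map f.hom.hom).toLinearMap
  map_id V := by
    refine ModuleCat.hom_ext (LinearMap.ext fun x => ?_)
    change Sym.map LinearMap.id x = x
    rw [Sym.map_id]
    rfl
  map_comp f g := by
    refine ModuleCat.hom_ext (LinearMap.ext fun x => ?_)
    change Sym.map (g.hom.hom ∘ₗ f.hom.hom) x = Sym.map g.hom.hom (Sym.map f.hom.hom x)
    rw [Sym.map_comp]
    rfl

/-- The functor `S^d`. -/
def symPow (d : ℤ) : Subfct symF where
  obj V := symGr V d
  map_mem f _ hx := Sym.map_mem_symGr f.hom.hom hx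

/-- The functor `S^n` has polynomial degree at most `n`. -/
theorem sum_powerset_map_eq_zero {V W : Type} [AddCommGroup V] [Module 𝔽 V] [AddCommGroup W]
    [Module 𝔽 W] {I : Type*} (f : I → (V →ₗ[𝔽] W)) {n : ℕ} {x : Sym V} (hx : x ∈ symGr V n)
    (T : Finset I) (hT : n < T.card) : ∑ S ∈ T.powerset, Sym.map (∑ i ∈ S, f i) x = 0 := by
  classical
  refine symGr_induction (p := fun n x => ∀ T : Finset I, n < T.card →
    ∑ S ∈ T.powerset, Sym.map (∑ i ∈ S, f i) x = 0) ?_ ?_ ?_ ?_ hx T hT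
  · intro T hT
    simp only [map_one, Finset.sum_const, Finset.card_powerset]
    obtain ⟨k, hk⟩ : ∃ k, T.card = k + 1 := ⟨T.card - 1, by lia⟩
    rw [hk, pow_succ, mul_comm, mul_smul, two_smul, ZModModule.add_self]
  · intro n x y hx hy T hT
    simp only [map_add, Finset.sum_add_distrib, hx T hT, hy T hT, add_zero]
  · intro n T _
    simp
  · intro n x v _ hx T hT
    have h1 : ∀ i ∈ T, ∑ S ∈ T.powerset with i ∈ S, Sym.map (∑ j ∈ S, f j) x = 0 := by
      intro i hi
      have h2 := Finset.sum_filter_add_sum_filter_not T.powerset (fun S => i ∈ S)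
        fun S => Sym.map (∑ j ∈ S, f j) x
      rw [hx T (by lia)] at h2
      have h3 : T.powerset.filter (fun S => i ∉ S) = (T.erase i).powerset := by
        ext S
        simp [Finset.subset_erase]
      rw [h3, hx _ (by rw [Finset.card_erase_of_mem hi]; lia), add_zero] at h2
      exact h2
    have h2 : ∀ S ∈ T.powerset, Sym.map (∑ i ∈ S, f i) (x * SymmetricAlgebra.ι 𝔽 V v) =
        ∑ i ∈ T, if i ∈ S then
          Sym.map (∑ i ∈ S, f i) x * SymmetricAlgebra.ι 𝔽 W (f i v) else 0 := by
      intro S hS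
      rw [map_mul, Sym.map_ι, LinearMap.sum_apply, map_sum, Finset.mul_sum, ← Finset.sum_filter,
        Finset.filter_mem_eq_inter, Finset.inter_eq_right.2 (Finset.mem_powerset.1 hS)]
    rw [Finset.sum_congr rfl h2, Finset.sum_comm]
    refine Finset.sum_eq_zero fun i hi => ?_
    rw [← Finset.sum_filter, ← Finset.sum_mul, h1 i hi, zero_mul]

theorem FGModuleCat.hom_hom_sum {V W : FGModuleCat.{0} 𝔽} {I : Type*} (S : Finset I)
    (f : I → (V ⟶ W)) : (∑ i ∈ S, f i).hom.hom = ∑ i ∈ S, (f i).hom.hom := by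
  classical
  induction S using Finset.induction_on with
  | empty => rfl
  | insert a S ha ih => rw [Finset.sum_insert ha, Finset.sum_insert ha, ← ih]; rfl

theorem symPow_isSmall (d : ℤ) : IsSmall (symPow d).toFct := by
  refine isSmall_of_hasPolyDegreeLE (n := d.toNat) (Subfct.hasPolyDegreeLE_iff.2 ?_) ?_
  · intro V W f (x : Sym V) (hx : x ∈ symGr V d)
    have hx' : x ∈ symGr V d.toNat := by
      by_cases h : 0 ≤ d
      · rwa [Int.toNat_of_nonneg h]
      · rw [symGr_of_neg (by lia)] at hx
        rw [(Submodule.mem_bot 𝔽).1 hx]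
        exact zero_mem _
    have := sum_powerset_map_eq_zero (fun i => (f i).hom.hom) hx' Finset.univ (by simp)
    rw [Finset.powerset_univ] at this
    refine Eq.trans (Finset.sum_congr rfl fun S _ => ?_) this
    rw [← FGModuleCat.hom_hom_sum]
    rfl
  · change Module.Finite 𝔽 (symGr (Fin d.toNat → 𝔽) d)
    rw [Module.Finite.iff_fg]
    by_cases h : 0 ≤ d
    · rw [symGr, if_pos h]
      refine Submodule.FG.pow ?_ _
      rw [LinearMap.range_eq_map]
      exact Submodule.FG.map _ Module.Finite.fg_top
    · rw [symGr_of_neg (by lia)]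
      exact Submodule.fg_bot

/-! ### Natural families of subspaces -/

/-- A family of subspaces of the spaces `S^*(V)` which defines a subfunctor of some `S^d`. -/
structure IsNatFamily (P : ∀ V : FGModuleCat.{0} 𝔽, Submodule 𝔽 (Sym V)) : Prop where
  map_mem : ∀ {V W : FGModuleCat.{0} 𝔽} (f : V ⟶ W) (x : Sym V), x ∈ P V → Sym.map f.hom.hom x ∈ P W
  bounded : ∃ d, ∀ V, P V ≤ symGr V d

/-- The subfunctor defined by a family of subspaces. -/
def IsNatFamily.subfct {P : ∀ V : FGModuleCat.{0} 𝔽, Submodule 𝔽 (Sym V)} (h : IsNatFamily P) :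
    Subfct symF where
  obj := P
  map_mem := h.map_mem

theorem IsNatFamily.isSmall {P : ∀ V : FGModuleCat.{0} 𝔽, Submodule 𝔽 (Sym V)} (h : IsNatFamily P) :
    IsSmall h.subfct.toFct := by
  obtain ⟨d, hd⟩ := h.bounded
  let α : h.subfct.toFct ⟶ (symPow d).toFct :=
    { app := fun V => ModuleCat.ofHom (Submodule.inclusion (hd V)) }
  exact (symPow_isSmall d).of_injective α fun V => Submodule.inclusion_injective (hd V)

open Classical in
/-- The class of the functor defined by a family of subspaces, and zero if the family does not
define a subfunctor of some `S^d`. -/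
def val (P : ∀ V : FGModuleCat.{0} 𝔽, Submodule 𝔽 (Sym V)) : K₀ :=
  if h : IsNatFamily P then cls h.subfct.toFct h.isSmall.isFinite else 0

theorem IsNatFamily.val_eq {P : ∀ V : FGModuleCat.{0} 𝔽, Submodule 𝔽 (Sym V)} (h : IsNatFamily P) :
    val P = cls h.subfct.toFct h.isSmall.isFinite := dif_pos h

/-- The morphism of functors defined by a natural family of linear maps on a subfunctor. -/
def IsNatFamily.toQuot {P I' : ∀ V : FGModuleCat.{0} 𝔽, Submodule 𝔽 (Sym V)} (hP : IsNatFamily P)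
    (hI' : IsNatFamily I') (φ : ∀ V : FGModuleCat.{0} 𝔽, Sym V →ₗ[𝔽] Sym V)
    (hφ : ∀ {V W : FGModuleCat.{0} 𝔽} (f : V ⟶ W) (x : Sym V),
      φ W (Sym.map f.hom.hom x) = Sym.map f.hom.hom (φ V x)) :
    hP.subfct.toFct ⟶ hI'.subfct.quot where
  app V := ModuleCat.ofHom ((I' V).mkQ ∘ₗ φ V ∘ₗ (P V).subtype)
  naturality _ _ f := ModuleCat.hom_ext (LinearMap.ext fun x =>
    congrArg Submodule.Quotient.mk (hφ f x.1))

theorem val_eq_add_image {P I I' : ∀ V : FGModuleCat.{0} 𝔽, Submodule 𝔽 (Sym V)}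
    (hP : IsNatFamily P)
    (hI : IsNatFamily I) (hI' : IsNatFamily I') (φ : ∀ V : FGModuleCat.{0} 𝔽, Sym V →ₗ[𝔽] Sym V)
    (hφ : ∀ {V W : FGModuleCat.{0} 𝔽} (f : V ⟶ W) (x : Sym V),
      φ W (Sym.map f.hom.hom x) = Sym.map f.hom.hom (φ V x))
    (hle : ∀ V, I V ≤ P V) (h : ∀ V, ∀ x ∈ P V, φ V x ∈ I' V ↔ x ∈ I V) :
    val P = val I + cls (image (hP.toQuot hI' φ hφ)).toFct
      (image_isSmall _ hP.isSmall).isFinite := by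
  let ι : hI.subfct.toFct ⟶ hP.subfct.toFct :=
    { app := fun V => ModuleCat.ofHom (Submodule.inclusion (hle V)) }
  rw [hP.val_eq, hI.val_eq]
  refine cls_eq_add_image ι _ _ hP.isSmall (fun V => Submodule.inclusion_injective (hle V))
    fun V => ?_
  ext x
  constructor
  · rintro ⟨y, rfl⟩
    exact (Submodule.Quotient.mk_eq_zero _).2 ((h V _ (hle V y.2)).2 y.2)
  · intro hx
    exact ⟨⟨x.1, (h V x.1 x.2).1 ((Submodule.Quotient.mk_eq_zero _).1 hx)⟩, rfl⟩

/-- Subquotients which correspond to each other by natural isomorphisms have the same class. -/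
theorem val_sub_eq {P I P' I' : ∀ V : FGModuleCat.{0} 𝔽, Submodule 𝔽 (Sym V)} (hP : IsNatFamily P)
    (hI : IsNatFamily I) (hP' : IsNatFamily P') (hI' : IsNatFamily I')
    (φ : ∀ V : FGModuleCat.{0} 𝔽, Sym V →ₗ[𝔽] Sym V)
    (hφ : ∀ {V W : FGModuleCat.{0} 𝔽} (f : V ⟶ W) (x : Sym V),
      φ W (Sym.map f.hom.hom x) = Sym.map f.hom.hom (φ V x))
    (h : ∀ V, Corr (φ V) (P V) (I V) (P' V) (I' V)) : val P - val I = val P' - val I' := by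
  rw [val_eq_add_image hP hI hI' φ hφ (fun V => (h V).le) (fun V => (h V).iff),
    val_eq_add_image hP' hI' hI' (fun V => LinearMap.id) (fun _ _ => rfl) (fun V => (h V).le')
      (fun V x _ => Iff.rfl), add_sub_cancel_left, add_sub_cancel_left]
  refine cls_congr_image _ _ _ _ fun V => le_antisymm ?_ ?_
  · rintro _ ⟨x, rfl⟩
    exact ⟨⟨φ V x.1, (h V).map _ x.2⟩, rfl⟩
  · rintro _ ⟨y, rfl⟩
    obtain ⟨x, hx, e⟩ := (h V).surj _ y.2
    exact ⟨⟨x, hx⟩, ((Submodule.Quotient.eq _).2 e).symm⟩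

/-! ### Naturality of the cycles and boundaries -/

/-- A natural family of operators which are homogeneous of degree `k`. -/
structure IsNatOp (φ : ∀ V : FGModuleCat.{0} 𝔽, Sym V →ₗ[𝔽] Sym V) (k : ℤ) : Prop where
  natural : ∀ {V W : FGModuleCat.{0} 𝔽} (f : V ⟶ W) (x : Sym V),
    φ W (Sym.map f.hom.hom x) = Sym.map f.hom.hom (φ V x)
  mem : ∀ {V : FGModuleCat.{0} 𝔽} {d : ℤ} {x : Sym V}, x ∈ symGr V d → φ V x ∈ symGr V (d + k)

theorem natOp_a : IsNatOp (fun V => (symMod V).a) 1 :=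
  ⟨fun f x => Sq_map f.hom.hom 1 x, fun h => Sq_mem_symGr h 1⟩

theorem natOp_b : IsNatOp (fun V => (symMod V).b) 2 :=
  ⟨fun f x => Sq_map f.hom.hom 2 x, fun h => Sq_mem_symGr h 2⟩

theorem IsNatOp.comp {φ ψ : ∀ V : FGModuleCat.{0} 𝔽, Sym V →ₗ[𝔽] Sym V} {k l : ℤ} (hφ : IsNatOp φ k)
    (hψ : IsNatOp ψ l) : IsNatOp (fun V => φ V ∘ₗ ψ V) (l + k) where
  natural f x := by
    change φ _ (ψ _ _) = Sym.map f.hom.hom (φ _ (ψ _ _))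
    rw [hψ.natural, hφ.natural]
  mem h := by
    rw [← add_assoc]
    exact hφ.mem (hψ.mem h)

theorem natOp_q : IsNatOp (fun V => (symMod V).q) 3 where
  natural f x := (Sym.map_q f.hom.hom x).symm
  mem {V d x} h := by
    rw [SqMod.q_apply]
    exact add_mem ((natOp_a.comp natOp_b).mem h) ((natOp_b.comp natOp_a).mem h)

theorem natOp_id : IsNatOp (fun _ => LinearMap.id) 0 := ⟨fun _ _ => rfl, fun h => by rwa [add_zero]⟩

section

variable {P Q : ∀ V : FGModuleCat.{0} 𝔽, Submodule 𝔽 (Sym V)}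
  {φ : ∀ V : FGModuleCat.{0} 𝔽, Sym V →ₗ[𝔽] Sym V} {k : ℤ}

theorem IsNatFamily.inf (hP : IsNatFamily P) (hQ : IsNatFamily Q) :
    IsNatFamily fun V => P V ⊓ Q V where
  map_mem f x hx := ⟨hP.map_mem f x hx.1, hQ.map_mem f x hx.2⟩
  bounded := hP.bounded.imp fun _ hd V => inf_le_left.trans (hd V)

theorem IsNatFamily.inf_comap (hP : IsNatFamily P) (hQ : IsNatFamily Q) (hφ : IsNatOp φ k) :
    IsNatFamily fun V => P V ⊓ (Q V).comap (φ V) where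
  map_mem f x hx := ⟨hP.map_mem f x hx.1, by
    rw [SetLike.mem_coe, Submodule.mem_comap, hφ.natural]
    exact hQ.map_mem f _ hx.2⟩
  bounded := hP.bounded.imp fun _ hd V => inf_le_left.trans (hd V)

theorem IsNatFamily.inf_ker (hP : IsNatFamily P) (hφ : IsNatOp φ k) :
    IsNatFamily fun V => P V ⊓ LinearMap.ker (φ V) where
  map_mem f x hx := ⟨hP.map_mem f x hx.1, LinearMap.mem_ker.2 (by
    rw [hφ.natural, LinearMap.mem_ker.1 hx.2, map_zero])⟩
  bounded := hP.bounded.imp fun _ hd V => inf_le_left.trans (hd V)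

theorem IsNatFamily.map (hP : IsNatFamily P) (hφ : IsNatOp φ k) :
    IsNatFamily fun V => (P V).map (φ V) where
  map_mem f x hx := by
    obtain ⟨x, hx, rfl⟩ := hx
    exact ⟨_, hP.map_mem f x hx, hφ.natural f x⟩
  bounded := by
    obtain ⟨d, hd⟩ := hP.bounded
    refine ⟨d + k, fun V => ?_⟩
    rintro _ ⟨x, hx, rfl⟩
    exact hφ.mem (hd V hx)

theorem IsNatFamily.byMod {P₀ P₁ P₂ P₃ : ∀ V : FGModuleCat.{0} 𝔽, Submodule 𝔽 (Sym V)} (s : ℤ)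
    (h₀ : IsNatFamily P₀) (h₁ : IsNatFamily P₁) (h₂ : IsNatFamily P₂) (h₃ : IsNatFamily P₃) :
    IsNatFamily fun V => byMod s (P₀ V) (P₁ V) (P₂ V) (P₃ V) := by
  unfold A1Cohomology.byMod
  split_ifs
  exacts [h₀, h₁, h₂, h₃]

end

theorem natFamily_g (d : ℤ) : IsNatFamily fun V => (symMod V).g d where
  map_mem f _ hx := Sym.map_mem_symMod f.hom.hom hx
  bounded := ⟨d, fun _ _ hx => mem_symGr_of_mem hx⟩

theorem natFamily_K (d : ℤ) : IsNatFamily fun V => (symMod V).K d :=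
  (natFamily_g d).inf_ker natOp_a

theorem natFamily_ZA (d : ℤ) : IsNatFamily fun V => (symMod V).ZA d :=
  (natFamily_K d).inf_ker natOp_b

theorem natFamily_BA (d : ℤ) : IsNatFamily fun V => (symMod V).BA d :=
  (natFamily_K (d - 5)).map (natOp_b.comp (natOp_a.comp natOp_b))

theorem natFamily_ZB (d : ℤ) : IsNatFamily fun V => (symMod V).ZB d :=
  (natFamily_g d).inf_ker natOp_b

theorem natFamily_BB (d : ℤ) : IsNatFamily fun V => (symMod V).BB d :=
  (natFamily_K (d - 2)).map natOp_b

theorem natFamily_ZC (d : ℤ) : IsNatFamily fun V => (symMod V).ZC d :=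
  (natFamily_g d).inf_ker (natOp_a.comp natOp_b)

theorem natFamily_BC (d : ℤ) : IsNatFamily fun V => (symMod V).BC d :=
  (natFamily_g (d - 2)).map natOp_b

theorem natFamily_ZE (d : ℤ) : IsNatFamily fun V => (symMod V).ZE d :=
  (natFamily_K d).inf_ker (natOp_b.comp (natOp_a.comp natOp_b))

theorem natFamily_BE (d : ℤ) : IsNatFamily fun V => (symMod V).BE d :=
  (natFamily_g (d - 3)).map (natOp_a.comp natOp_b)

theorem natFamily_ZU (d : ℤ) : IsNatFamily fun V => (symMod V).ZU d :=
  (natFamily_K d).inf_ker natOp_q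

theorem natFamily_BU (d : ℤ) : IsNatFamily fun V => (symMod V).BU d :=
  (natFamily_K (d - 3)).map natOp_q

theorem natFamily_JA (d : ℤ) : IsNatFamily fun V => (symMod V).JA d :=
  (natFamily_ZA d).inf (natFamily_BU d)

theorem natFamily_LA (d : ℤ) : IsNatFamily fun V => (symMod V).LA d :=
  (natFamily_ZA d).inf (natFamily_BB d)

theorem natFamily_JB (d : ℤ) : IsNatFamily fun V => (symMod V).JB d :=
  (natFamily_ZB d).inf_comap (natFamily_BU (d + 1)) natOp_a

theorem natFamily_LB (d : ℤ) : IsNatFamily fun V => (symMod V).LB d :=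
  (natFamily_ZB d).inf (natFamily_BC d)

theorem natFamily_JC (d : ℤ) : IsNatFamily fun V => (symMod V).JC d :=
  (natFamily_ZC d).inf_comap (natFamily_BU (d + 2)) natOp_b

theorem natFamily_LC (d : ℤ) : IsNatFamily fun V => (symMod V).LC d :=
  (natFamily_ZC d).inf_comap (natFamily_BE (d + 1)) natOp_a

theorem natFamily_VE (d : ℤ) : IsNatFamily fun V => (symMod V).VE d :=
  (natFamily_g (d - 1)).inf_ker (natOp_b.comp (natOp_a.comp (natOp_b.comp natOp_a)))

theorem natFamily_IE (d : ℤ) : IsNatFamily fun V => (symMod V).IE d :=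
  (natFamily_g (d - 1)).inf_comap (natFamily_BU (d + 2)) (natOp_a.comp natOp_b)

theorem natFamily_JE (d : ℤ) : IsNatFamily fun V => (symMod V).JE d :=
  (natFamily_IE d).map natOp_a

theorem natFamily_LE (d : ℤ) : IsNatFamily fun V => (symMod V).LE d :=
  (natFamily_ZE d).inf_comap (natFamily_BA (d + 3)) (natOp_a.comp natOp_b)

theorem natFamily_WA (d : ℤ) : IsNatFamily fun V => (symMod V).WA d :=
  (natFamily_ZU d).inf_comap (natFamily_BA (d + 2)) natOp_b

theorem natFamily_VB (d : ℤ) : IsNatFamily fun V => (symMod V).VB d :=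
  (natFamily_g (d - 1)).inf_ker (natOp_a.comp (natOp_b.comp natOp_a))

theorem natFamily_IB (d : ℤ) : IsNatFamily fun V => (symMod V).IB d :=
  (natFamily_g (d - 1)).inf_comap (natFamily_BB (d + 1)) natOp_b

theorem natFamily_WB (d : ℤ) : IsNatFamily fun V => (symMod V).WB d :=
  (natFamily_IB d).map natOp_a

theorem natFamily_WC (d : ℤ) : IsNatFamily fun V => (symMod V).WC d :=
  (natFamily_ZU d).inf (natFamily_BC d)

theorem natFamily_WE (d : ℤ) : IsNatFamily fun V => (symMod V).WE d :=
  (natFamily_ZU d).inf (natFamily_BE d)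

theorem natFamily_ZH (d : ℤ) : IsNatFamily fun V => (symMod V).ZH d :=
  (natFamily_g d).inf_ker natOp_q

theorem natFamily_BH (d : ℤ) : IsNatFamily fun V => (symMod V).BH d :=
  (natFamily_g (d - 3)).map natOp_q

theorem natFamily_VH (d : ℤ) : IsNatFamily fun V => (symMod V).VH d :=
  (natFamily_g (d - 3)).inf_ker (natOp_a.comp natOp_q)

theorem natFamily_IH (d : ℤ) : IsNatFamily fun V => (symMod V).IH d :=
  (natFamily_g (d - 3)).inf_comap (natFamily_BU (d - 2)) natOp_a

theorem natFamily_Z (s t : ℤ) : IsNatFamily fun V => (symMod V).Z s t := by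
  simp only [SqMod.Z_eq]
  exact IsNatFamily.byMod s (natFamily_ZA _) (natFamily_ZB _) (natFamily_ZC _) (natFamily_ZE _)

theorem natFamily_B (s t : ℤ) : IsNatFamily fun V => (symMod V).B s t := by
  simp only [SqMod.B_eq]
  exact IsNatFamily.byMod s (natFamily_BA _) (natFamily_BB _) (natFamily_BC _) (natFamily_BE _)

/-! ### Relations between the classes of subquotients -/

/-- The class of the subquotient `Z / B`, in cohomological degree `s` and internal degree `d`. -/
def valT (s d : ℤ) : K₀ :=
  val (fun V => (symMod V).Z s (d - s)) - val fun V => (symMod V).B s (d - s)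

/-- The class of the subquotient `ZU / BU` in degree `N`. -/
def valU (N : ℤ) : K₀ := val (fun V => (symMod V).ZU N) - val fun V => (symMod V).BU N

/-- The class of the image of `T → U`, where `T` is in cohomological degree `s` and internal degree
`d`. -/
def valTU (s d : ℤ) : K₀ :=
  val (fun V => (symMod V).Z s (d - s)) - val fun V => (symMod V).J s (d - s)

/-- The class of the image of `U → T`, where `T` is in cohomological degree `s` and internal degree
`d + 2`. -/
def valUT (s d : ℤ) : K₀ :=
  val (fun V => (symMod V).ZU (d + 2 * s)) - val fun V => (symMod V).W s (d + 2 * s)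

/-- The class of the image of `T → T`, where the target is in cohomological degree `s` and internal
degree `d`. -/
def valTT (s d : ℤ) : K₀ :=
  val (fun V => (symMod V).J s (d - s)) - val fun V => (symMod V).B s (d - s)

theorem valTU_eq (s d : ℤ) : valTU s d =
    val (fun V => (symMod V).W s (d + 2 * s)) - val fun V => (symMod V).BU (d + 2 * s) := by
  have hA : ∀ V : FGModuleCat.{0} 𝔽, (symMod V).Acyclic := fun V => symMod_acyclic V
  unfold valTU
  simp only [SqMod.Z_eq, SqMod.J, SqMod.W, byMod]
  split_ifs
  · rw [show d - s + 3 * s = d + 2 * s by ring]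
    exact val_sub_eq (natFamily_ZA _) (natFamily_JA _) (natFamily_WA _) (natFamily_BU _)
      _ natOp_id.natural
      fun V => SqMod.corr_A_U (hA V) _
  · have e : d + 2 * s = d - s + 3 * s - 1 + 1 := by ring
    rw [e]
    exact val_sub_eq (natFamily_ZB _) (natFamily_JB _) (natFamily_WB _) (natFamily_BU _)
      _ natOp_a.natural
      fun V => SqMod.corr_B_U (hA V) _
  · have e : d + 2 * s = d - s + 3 * s - 2 + 2 := by ring
    rw [e]
    exact val_sub_eq (natFamily_ZC _) (natFamily_JC _) (natFamily_WC _) (natFamily_BU _)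
      _ natOp_b.natural
      fun V => SqMod.corr_C_U (hA V) _
  · have e : d + 2 * s = d - s + 3 * s - 2 + 2 := by ring
    rw [e]
    exact (val_sub_eq (natFamily_VE _) (natFamily_IE _) (natFamily_ZE _) (natFamily_JE _)
      _ natOp_a.natural
      fun V => SqMod.corr_VE_E (hA V) _).symm.trans
      (val_sub_eq (natFamily_VE _) (natFamily_IE _) (natFamily_WE _) (natFamily_BU _) _
        (natOp_a.comp natOp_b).natural
      fun V => SqMod.corr_VE_U (hA V) _)

theorem valUT_eq (s d : ℤ) : valUT s d =
    val (fun V => (symMod V).L s (d + 2 - s)) - val fun V => (symMod V).B s (d + 2 - s) := by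
  have hA : ∀ V : FGModuleCat.{0} 𝔽, (symMod V).Acyclic := fun V => symMod_acyclic V
  unfold valUT
  simp only [SqMod.B_eq, SqMod.L, SqMod.W, byMod]
  split_ifs
  · rw [show d + 2 - s + 3 * s = d + 2 * s + 2 by ring]
    exact val_sub_eq (natFamily_ZU _) (natFamily_WA _) (natFamily_LA _) (natFamily_BA _)
      _ natOp_b.natural
      fun V => SqMod.corr_U_A (hA V) _
  · rw [show d + 2 - s + 3 * s - 1 = d + 2 * s + 1 by ring]
    exact (val_sub_eq (natFamily_VB _) (natFamily_IB _) (natFamily_ZU _) (natFamily_WB _)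
      _ natOp_a.natural
      fun V => SqMod.corr_VB_U (hA V) _).symm.trans
      (val_sub_eq (natFamily_VB _) (natFamily_IB _) (natFamily_LB _) (natFamily_BB _)
        _ natOp_b.natural
      fun V => SqMod.corr_VB_B (hA V) _)
  · rw [show d + 2 - s + 3 * s - 2 = d + 2 * s by ring]
    exact val_sub_eq (natFamily_ZU _) (natFamily_WC _) (natFamily_LC _) (natFamily_BC _)
      _ natOp_id.natural
      fun V => SqMod.corr_U_C _ _
  · rw [show d + 2 - s + 3 * s - 2 = d + 2 * s by ring]
    exact val_sub_eq (natFamily_ZU _) (natFamily_WE _) (natFamily_LE _) (natFamily_BE _)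
      _ natOp_id.natural
      fun V => SqMod.corr_U_E (hA V) _

theorem valTT_eq (s d : ℤ) : valTT (s + 1) (d + 1) =
    val (fun V => (symMod V).Z s (d + 2 - s)) - val fun V => (symMod V).L s (d + 2 - s) := by
  have hA : ∀ V : FGModuleCat.{0} 𝔽, (symMod V).Acyclic := fun V => symMod_acyclic V
  unfold valTT
  rw [show d + 1 - (s + 1) = d - s by ring]
  simp only [SqMod.B_eq, SqMod.Z_eq, SqMod.L, SqMod.J, byMod]
  rcases mod_four_cases s with ⟨e, e'⟩ | ⟨e, e'⟩ | ⟨e, e'⟩ | ⟨e, e'⟩ <;>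
    simp only [e, e'] <;> norm_num
  · rw [show d - s + 3 * (s + 1) - 1 = d + 2 - s + 3 * s by ring]
    exact (val_sub_eq (natFamily_ZA _) (natFamily_LA _) (natFamily_JB _) (natFamily_BB _)
      _ natOp_id.natural
      fun V => SqMod.corr_A_B (hA V) _).symm
  · rw [show d - s + 3 * (s + 1) - 2 = d + 2 - s + 3 * s - 1 by ring]
    exact (val_sub_eq (natFamily_ZB _) (natFamily_LB _) (natFamily_JC _) (natFamily_BC _)
      _ natOp_id.natural
      fun V => SqMod.corr_B_C (hA V) _).symm
  · rw [show d - s + 3 * (s + 1) - 2 = d + 2 - s + 3 * s - 2 + 1 by ring]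
    exact (val_sub_eq (natFamily_ZC _) (natFamily_LC _) (natFamily_JE _) (natFamily_BE _)
      _ natOp_a.natural
      fun V => SqMod.corr_C_E (hA V) _).symm
  · rw [show d - s + 3 * (s + 1) = d + 2 - s + 3 * s - 2 + 3 by ring]
    exact (val_sub_eq (natFamily_ZE _) (natFamily_LE _) (natFamily_JA _) (natFamily_BA _) _
      (natOp_a.comp natOp_b).natural
      fun V => SqMod.corr_E_A (hA V) _).symm

/-- Exactness at `U`. -/
theorem valU_eq_add (s d : ℤ) : valU (d + 2 * s) = valTU s d + valUT s d := by
  rw [valTU_eq, valU, valUT]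
  abel

/-- Exactness at the middle term of `T → T → U`. -/
theorem valT_eq_add (s d : ℤ) : valT s d = valTU s d + valTT s d := by
  rw [valT, valTU, valTT]
  abel

/-- Exactness at the middle term of `U → T → T`. -/
theorem valT_eq_add' (s d : ℤ) : valT s (d + 2) = valUT s d + valTT (s + 1) (d + 1) := by
  rw [valT, valUT_eq, valTT_eq]
  abel

section

variable {V : Type} [AddCommGroup V] [Module 𝔽 V] [Module.Finite 𝔽 V]

theorem B_le_J_le_Z (s t : ℤ) :
    (symMod V).B s t ≤ (symMod V).J s t ∧ (symMod V).J s t ≤ (symMod V).Z s t := by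
  have hM : (symMod V).Acyclic := symMod_acyclic V
  rw [SqMod.B_eq, SqMod.Z_eq]
  unfold SqMod.J byMod
  split_ifs
  · exact ⟨by simpa using (SqMod.corr_E_A hM (t + 3 * s - 3)).le', (SqMod.corr_A_U hM _).le⟩
  · exact ⟨(SqMod.corr_A_B hM _).le', (SqMod.corr_B_U hM _).le⟩
  · exact ⟨(SqMod.corr_B_C hM _).le', (SqMod.corr_C_U hM _).le⟩
  · refine ⟨?_, (SqMod.corr_VE_E hM _).le'⟩
    have := (SqMod.corr_C_E hM (t + 3 * s - 2 - 1)).le'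
    rwa [sub_add_cancel] at this

theorem B_le_L_le_Z (s t : ℤ) :
    (symMod V).B s t ≤ (symMod V).L s t ∧ (symMod V).L s t ≤ (symMod V).Z s t := by
  have hM : (symMod V).Acyclic := symMod_acyclic V
  rw [SqMod.B_eq, SqMod.Z_eq]
  unfold SqMod.L byMod
  split_ifs
  · refine ⟨?_, (SqMod.corr_A_B hM _).le⟩
    have := (SqMod.corr_U_A hM (t + 3 * s - 2)).le'
    rwa [sub_add_cancel] at this
  · refine ⟨?_, (SqMod.corr_B_C hM _).le⟩
    have := (SqMod.corr_VB_B hM (t + 3 * s - 1 - 1)).le'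
    rwa [sub_add_cancel] at this
  · exact ⟨((symMod V).corr_U_C _).le', (SqMod.corr_C_E hM _).le⟩
  · exact ⟨(SqMod.corr_U_E hM _).le', (SqMod.corr_E_A hM _).le⟩

theorem BU_le_W_le_ZU (s d : ℤ) :
    (symMod V).BU d ≤ (symMod V).W s d ∧ (symMod V).W s d ≤ (symMod V).ZU d := by
  have hM : (symMod V).Acyclic := symMod_acyclic V
  unfold SqMod.W byMod
  split_ifs
  · exact ⟨(SqMod.corr_A_U hM _).le', (SqMod.corr_U_A hM _).le⟩
  · refine ⟨?_, (SqMod.corr_VB_U hM _).le'⟩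
    have := (SqMod.corr_B_U hM (d - 1)).le'
    rwa [sub_add_cancel] at this
  · refine ⟨?_, ((symMod V).corr_U_C _).le⟩
    have := (SqMod.corr_C_U hM (d - 2)).le'
    rwa [sub_add_cancel] at this
  · refine ⟨?_, (SqMod.corr_U_E hM _).le⟩
    have := (SqMod.corr_VE_U hM (d - 2)).le'
    rwa [sub_add_cancel] at this

end

theorem val_sub_eq_zero {P Q : ∀ V : FGModuleCat.{0} 𝔽, Submodule 𝔽 (Sym V)} (h : ∀ V, P V ≤ Q V)
    (h' : ∀ V, Q V ≤ P V) : val P - val Q = 0 := by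
  rw [funext fun V => le_antisymm (h V) (h' V), sub_self]

theorem valTU_odd (s : ℤ) {d : ℤ} (h : d % 2 = 1) : valTU s d = 0 := by
  rw [valTU_eq]
  exact val_sub_eq_zero
    (fun V => (BU_le_W_le_ZU s _).2.trans (symMod_ZU_le_BU V (by lia)))
    fun V => (BU_le_W_le_ZU s _).1

theorem valUT_odd (s : ℤ) {d : ℤ} (h : d % 2 = 1) : valUT s d = 0 :=
  val_sub_eq_zero (fun V => (symMod_ZU_le_BU V (by lia)).trans (BU_le_W_le_ZU s _).1)
    fun V => (BU_le_W_le_ZU s _).2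

theorem valT_of_exact {s d : ℤ} (h : ∀ V : FGModuleCat.{0} 𝔽, (symMod V).ExactAt s (d - s)) :
    valT s d = 0 :=
  val_sub_eq_zero h fun _ => (B_le_J_le_Z s _).1.trans (B_le_J_le_Z s _).2

section

variable {d : ℤ} (h : d % 8 = 1 ∨ d % 8 = 2 ∨ d % 8 = 3 ∨ d % 8 = 5) (s : ℤ)
include h

theorem exactAt_of_mod (V : FGModuleCat.{0} 𝔽) : (symMod V).ExactAt s (d - s) :=
  symMod_exactAt V (by rwa [sub_add_cancel])

theorem valTU_of_mod : valTU s d = 0 :=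
  val_sub_eq_zero (fun V => (exactAt_of_mod h s V).trans (B_le_J_le_Z s _).1)
    fun _ => (B_le_J_le_Z s _).2

theorem valTT_of_mod : valTT s d = 0 :=
  val_sub_eq_zero (fun V => (B_le_J_le_Z s _).2.trans (exactAt_of_mod h s V))
    fun _ => (B_le_J_le_Z s _).1

theorem valUT_of_mod : valUT s (d - 2) = 0 := by
  rw [valUT_eq, sub_add_cancel]
  exact val_sub_eq_zero (fun V => (B_le_L_le_Z s _).2.trans (exactAt_of_mod h s V))
    fun V => (B_le_L_le_Z s _).1

theorem valTT_of_mod' : valTT s (d - 1) = 0 := by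
  have e := valTT_eq (s - 1) (d - 2)
  rw [sub_add_cancel, sub_add_cancel, show d - 2 + 1 = d - 1 by ring] at e
  rw [e]
  exact val_sub_eq_zero (fun V => (exactAt_of_mod h (s - 1) V).trans (B_le_L_le_Z _ _).1)
    fun V => (B_le_L_le_Z _ _).2

end

/-! ### The classes of the cohomology in terms of those of `U` -/

theorem valT_zero_mod (s : ℤ) {d : ℤ} (h : d % 8 = 0) : valT s d = valU (d + 2 * s) := by
  have h1 := valTT_of_mod' (d := d + 1) (by lia) s
  have h2 := valUT_of_mod (d := d + 2) (by lia) s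
  rw [add_sub_cancel_right] at h1 h2
  rw [valT_eq_add, valU_eq_add, h1, h2]

theorem valT_four_mod (s : ℤ) {d : ℤ} (h : d % 8 = 4) : valT s d = valU (d - 2 + 2 * s) := by
  have h1 := valT_eq_add' s (d - 2)
  rw [sub_add_cancel, valTT_of_mod (by lia), add_zero] at h1
  rw [h1, valU_eq_add, valTU_of_mod (by lia), zero_add]

theorem valT_six_mod (s : ℤ) {d : ℤ} (h : d % 8 = 6) :
    valT s d = valU (d - 2 + 2 * s) - valU (d - 4 + 2 * s) := by
  have h1 := valT_eq_add' s (d - 2)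
  rw [sub_add_cancel, valTT_of_mod (by lia), add_zero] at h1
  have h2 := valT_four_mod s (d := d - 2) (by lia)
  have h3 := valTT_of_mod' (d := d - 1) (by lia) s
  rw [valT_eq_add, show d - 2 = d - 1 - 1 by ring, h3, add_zero,
    show d - 1 - 1 - 2 = d - 4 by ring] at h2
  rw [h1, valU_eq_add, ← h2, show d - 1 - 1 = d - 2 by ring]
  abel

/-- In these degrees the sequence only relates the classes in cohomological degrees `s + 1` and
`s - 1`; the class in degree `s` follows by induction, as it vanishes for small `s`. -/
theorem valT_seven_mod_succ (s : ℤ) {d : ℤ} (h : d % 8 = 7) :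
    valT (s + 1) d + valT (s - 1) d = (valU (d + 1 + 2 * s) - valU (d - 1 + 2 * s)) +
      (valU (d - 3 + 2 * s) - valU (d - 5 + 2 * s)) := by
  have h1 := valT_eq_add' s (d - 1)
  rw [show d - 1 + 2 = d + 1 by ring, sub_add_cancel, valT_zero_mod s (by lia)] at h1
  have h2 := valT_eq_add (s + 1) d
  rw [valTU_odd _ (by lia), zero_add] at h2
  have h3 := valU_eq_add s (d - 1)
  have h4 := valT_eq_add s (d - 1)
  rw [valT_six_mod s (by lia)] at h4
  have h5 := valT_eq_add' (s - 1) (d - 2)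
  rw [sub_add_cancel, sub_add_cancel, valUT_odd _ (by lia), zero_add,
    show d - 2 + 1 = d - 1 by ring] at h5
  rw [show d - 3 = d - 1 - 2 by ring, show d - 5 = d - 1 - 4 by ring, h2, h5, h4, h1, h3]
  abel

theorem valT_eq_zero_of_le {s d : ℤ} (h : d + 2 * s ≤ 0) : valT s d = 0 :=
  valT_of_exact fun V => SqMod.exactAt_of_le symMod_vanishesBelow (by lia)

theorem valU_eq_zero_of_le {N : ℤ} (h : N ≤ 0) : valU N = 0 :=
  val_sub_eq_zero (fun _ x hx => by
    rw [symMod_vanishesBelow.eq_zero hx.1.1 h]; exact zero_mem _)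
    fun V => SqMod.BU_le_ZU (symMod_acyclic V) N

theorem valT_seven_mod (s : ℤ) {d : ℤ} (h : d % 8 = 7) :
    valT s d = valU (d - 1 + 2 * s) - valU (d - 3 + 2 * s) := by
  have key : ∀ (n : ℕ) (s : ℤ), d + 2 * s ≤ n →
      valT s d = valU (d - 1 + 2 * s) - valU (d - 3 + 2 * s) := by
    intro n
    induction n using Nat.strong_induction_on with
    | _ n ih =>
      intro s hs
      by_cases h0 : d + 2 * s ≤ 0
      · rw [valT_eq_zero_of_le h0, valU_eq_zero_of_le (by lia), valU_eq_zero_of_le (by lia),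
          sub_zero]
      have h1 := valT_seven_mod_succ (s - 1) h
      have h2 : valT (s - 1 - 1) d = valU (d - 1 + 2 * (s - 1 - 1)) -
          valU (d - 3 + 2 * (s - 1 - 1)) := by
        by_cases h0 : d + 2 * (s - 1 - 1) ≤ 0
        · rw [valT_eq_zero_of_le h0, valU_eq_zero_of_le (by lia), valU_eq_zero_of_le (by lia),
            sub_zero]
        · exact ih (d + 2 * (s - 1 - 1)).toNat (by lia) _ (by lia)
      rw [h2, sub_add_cancel, show d - 1 + 2 * (s - 1 - 1) = d - 3 + 2 * (s - 1) by ring,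
        show d - 3 + 2 * (s - 1 - 1) = d - 5 + 2 * (s - 1) by ring, add_left_inj] at h1
      rw [h1, show d + 1 + 2 * (s - 1) = d - 1 + 2 * s by ring,
        show d - 1 + 2 * (s - 1) = d - 3 + 2 * s by ring]
  exact key (d + 2 * s).toNat s (by lia)

theorem valT_eq_zero_of_mod (s : ℤ) {d : ℤ} (h0 : d % 8 ≠ 0) (h4 : d % 8 ≠ 4) (h6 : d % 8 ≠ 6)
    (h7 : d % 8 ≠ 7) : valT s d = 0 :=
  valT_of_exact (exactAt_of_mod (by lia) s)

/-! ### The classes of `U` -/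

/-- The morphism from the exterior power to `Q₁`-homology. -/
def wedgeSqHom (m : ℕ) : extPower m ⟶ (natFamily_BH (2 * m)).subfct.quot where
  app V := ModuleCat.ofHom (wedgeSq V m)
  naturality V W f := by
    refine ModuleCat.hom_ext (exteriorPower.linearMap_ext (AlternatingMap.ext fun v => ?_))
    change wedgeSq W m (exteriorPower.map m f.hom.hom (exteriorPower.ιMulti 𝔽 m v)) =
      (natFamily_BH (2 * m)).subfct.quot.map f (wedgeSq V m (exteriorPower.ιMulti 𝔽 m v))
    rw [exteriorPower.map_apply_ιMulti, wedgeSq_ιMulti, wedgeSq_ιMulti, ← Sym.map_sqProd]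
    rfl

theorem sqProd_mem_symGr {V : Type} [AddCommGroup V] [Module 𝔽 V] {m : ℕ} (v : Fin m → V) :
    sqProd V m v ∈ symGr V (2 * m) := by
  have := prod_ι_mem V Finset.univ v
  rw [Finset.card_univ, Fintype.card_fin] at this
  rw [sqProd_apply, pow_two]
  exact mul_mem_symGr this this (by ring)

theorem extPower_isSmall (m : ℕ) : IsSmall (extPower m) := by
  have h := image_isSmall ((symPow (2 * m)).incl ≫ (natFamily_BH (2 * m)).subfct.proj)
    (symPow_isSmall (2 * m))
  have hle : ∀ V : FGModuleCat.{0} 𝔽, LinearMap.range (wedgeSq V m) ≤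
      LinearMap.range
        ((((symPow (2 * m)).incl ≫ (natFamily_BH (2 * m)).subfct.proj).app V).hom) := by
    intro V
    rw [LinearMap.range_eq_map, ← exteriorPower.ιMulti_span, Submodule.map_span]
    refine Submodule.span_le.2 ?_
    rintro _ ⟨_, ⟨v, rfl⟩, rfl⟩
    exact ⟨⟨sqProd V m v, sqProd_mem_symGr v⟩, (wedgeSq_ιMulti V m v).symm⟩
  let α : (image (wedgeSqHom m)).toFct ⟶
      (image ((symPow (2 * m)).incl ≫ (natFamily_BH (2 * m)).subfct.proj)).toFct :=
    { app := fun V => ModuleCat.ofHom (Submodule.inclusion (hle V)) }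
  have h' := h.of_injective α fun V => Submodule.inclusion_injective (hle V)
  refine h'.of_injective (toImage (wedgeSqHom m)) fun V x y e => ?_
  exact wedgeSq_injective (V := V) m (congrArg Subtype.val e)

theorem cls_eq_cls_image {F G : Fct} (α : F ⟶ G) (hF : IsSmall F)
    (h : ∀ V, Function.Injective (α.app V)) :
    cls F hF.isFinite = cls (image α).toFct (image_isSmall α hF).isFinite := by
  have h0 : ∀ V, Subsingleton ((image (0 : F ⟶ F)).toFct.obj V) := fun V => by
    refine ⟨fun x y => Subtype.ext ?_⟩
    obtain ⟨_, ⟨x, rfl⟩⟩ := x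
    obtain ⟨_, ⟨y, rfl⟩⟩ := y
    rfl
  rw [cls_eq_add_image (image (0 : F ⟶ F)).incl α (image_isSmall 0 hF).isFinite hF
    (Subfct.incl_injective _) fun V => ?_, cls_eq_zero _ h0, zero_add]
  rw [LinearMap.ker_eq_bot.2 (h V), eq_bot_iff]
  rintro _ ⟨x, rfl⟩
  rw [@Subsingleton.elim _ (h0 V) x 0]
  exact map_zero _

/-- The class of the homology of `Q₁` in degree `2 m` is that of `Λ^m`. -/
theorem val_ZH_sub_val_BH {m : ℕ} (hm : 0 < m) :
    val (fun V => (symMod V).ZH (2 * m)) - val (fun V => (symMod V).BH (2 * m)) =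
      cls (extPower m) (extPower_isSmall m).isFinite := by
  rw [val_eq_add_image (natFamily_ZH (2 * m)) (natFamily_BH (2 * m)) (natFamily_BH (2 * m))
    (fun V => LinearMap.id) natOp_id.natural ?_ (fun V x _ => Iff.rfl), add_sub_cancel_left,
    cls_eq_cls_image (wedgeSqHom m) (extPower_isSmall m) fun V => wedgeSq_injective (V := V) m]
  · refine cls_congr_image _ _ _ _ fun V => Eq.trans ?_ (range_wedgeSq V hm).symm
    refine le_antisymm ?_ ?_
    · rintro _ ⟨x, rfl⟩
      exact ⟨x.1, x.2, rfl⟩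
    · rintro _ ⟨x, hx, rfl⟩
      exact ⟨⟨x, hx⟩, rfl⟩
  · rintro V _ ⟨y, hy, rfl⟩
    exact ⟨(symMod V).q_mem hy (by lia), LinearMap.mem_ker.2 ((symMod V).qq y)⟩

theorem valU_sub_valU {m : ℕ} (hm : 0 < m) :
    valU (2 * m) - valU (2 * m - 2) = cls (extPower m) (extPower_isSmall m).isFinite := by
  have hA : ∀ V : FGModuleCat.{0} 𝔽, (symMod V).Acyclic := fun V => symMod_acyclic V
  have h1 := val_sub_eq (natFamily_ZU (2 * m)) ((natFamily_ZU (2 * m)).inf (natFamily_BH (2 * m)))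
    (natFamily_ZH (2 * m)) (natFamily_BH (2 * m)) _ natOp_id.natural
    fun V => SqMod.corr_U_H (hA V) (symMod_ZU_le_BU V (by lia))
  have h2 := val_sub_eq (natFamily_VH (2 * m)) (natFamily_IH (2 * m)) (natFamily_ZU (2 * m - 2))
    (natFamily_BU (2 * m - 2)) _ natOp_a.natural fun V => SqMod.corr_VH_U (hA V) _
  have h3 := val_sub_eq (natFamily_VH (2 * m)) (natFamily_IH (2 * m))
    ((natFamily_ZU (2 * m)).inf (natFamily_BH (2 * m))) (natFamily_BU (2 * m)) _ natOp_q.natural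
    fun V => SqMod.corr_VH_H (hA V) (symMod_ZH_le_BH V (by lia))
  rw [← val_ZH_sub_val_BH hm, ← h1, valU, valU, ← h2, h3]
  abel

/-! ### Deviations of functions on a vector space -/

section

variable {A : Type*} [AddCommGroup A]

/-- The deviation `∑_S φ(∑_{i ∈ S} ξ_i)`, the sum being over the subsets `S` of `T`. -/
def deviation (φ : A → 𝔽) {I : Type*} (ξ : I → A) (T : Finset I) : 𝔽 :=
  ∑ S ∈ T.powerset, φ (∑ i ∈ S, ξ i)

theorem deviation_insert (φ : A → 𝔽) {I : Type*} [DecidableEq I] (ξ : I → A) {T : Finset I} {a : I}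
    (ha : a ∉ T) : deviation φ ξ (insert a T) =
      deviation φ ξ T + ∑ S ∈ T.powerset, φ (ξ a + ∑ i ∈ S, ξ i) := by
  rw [deviation, Finset.sum_powerset_insert ha]
  refine congrArg₂ _ rfl (Finset.sum_congr rfl fun S hS => ?_)
  rw [Finset.sum_insert fun h => ha (Finset.mem_powerset.1 hS h)]

theorem deviation_eq_zero_of_fin {φ : A → 𝔽} {k : ℕ}
    (h : ∀ ξ : Fin k → A, ∑ S : Finset (Fin k), φ (∑ i ∈ S, ξ i) = 0) {I : Type*} (ξ : I → A)
    {T : Finset I} (hT : T.card = k) : deviation φ ξ T = 0 := by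
  classical
  let e : Fin k ≃ T := (T.equivFinOfCardEq hT).symm
  rw [← h fun i => ξ (e i)]
  refine (Finset.sum_nbij (fun S => S.map (e.toEmbedding.trans (Function.Embedding.subtype _)))
    (fun S _ => ?_) (fun S _ S' _ h => Finset.map_injective _ h) (fun S hS => ?_)
      fun S _ => ?_).symm
  · rw [Finset.mem_powerset]
    intro i hi
    obtain ⟨j, -, rfl⟩ := Finset.mem_map.1 hi
    exact (e j).2
  · refine ⟨Finset.univ.filter fun j => (e j : I) ∈ S, Finset.mem_coe.2 (Finset.mem_univ _), ?_⟩
    ext i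
    constructor
    · intro hi
      obtain ⟨j, hj, rfl⟩ := Finset.mem_map.1 hi
      exact (Finset.mem_filter.1 hj).2
    · intro hi
      refine Finset.mem_map.2 ⟨e.symm ⟨i, Finset.mem_powerset.1 hS hi⟩, ?_, ?_⟩
      · simpa using hi
      · simp
  · rw [Finset.sum_map]
    rfl

/-- If the deviations in `k + 1` arguments vanish, then so do those in more arguments. -/
theorem deviation_eq_zero_of_lt {φ : A → 𝔽} {k : ℕ} {I : Type*}
    (h : ∀ (ξ : I → A) (T : Finset I), T.card = k + 1 → deviation φ ξ T = 0) (ξ : I → A)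
    {T : Finset I} (hT : k < T.card) : deviation φ ξ T = 0 := by
  classical
  obtain ⟨l, hl⟩ := Nat.exists_eq_add_of_lt hT
  induction l generalizing ξ T with
  | zero => exact h ξ T (by lia)
  | succ l ih =>
    -- `Δ_a Δ_b φ = Δ_{a + b} φ - Δ_a φ - Δ_b φ` for the difference operators
    obtain ⟨a, T, ha, rfl, hT'⟩ := Finset.card_eq_succ.1 (show T.card = (k + l + 1) + 1 by lia)
    obtain ⟨b, T, hb, rfl, hT''⟩ := Finset.card_eq_succ.1 hT'
    have hab : a ≠ b := fun h => ha (h ▸ Finset.mem_insert_self _ _)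
    have ha' : a ∉ T := fun h => ha (Finset.mem_insert_of_mem h)
    have h1 := ih ξ (T := insert a T) (by rw [Finset.card_insert_of_notMem ha']; lia)
      (by rw [Finset.card_insert_of_notMem ha']; lia)
    have h2 := ih ξ (T := insert b T) (by lia) (by lia)
    have h3 := ih (Function.update ξ a (ξ a + ξ b)) (T := insert a T)
      (by rw [Finset.card_insert_of_notMem ha']; lia)
      (by rw [Finset.card_insert_of_notMem ha']; lia)
    have e : ∀ S ∈ T.powerset, ∑ i ∈ S, Function.update ξ a (ξ a + ξ b) i = ∑ i ∈ S, ξ i :=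
      fun S hS => Finset.sum_congr rfl fun i hi => Function.update_of_ne
        (by rintro rfl; exact ha' (Finset.mem_powerset.1 hS hi)) _ _
    have e' : deviation φ (Function.update ξ a (ξ a + ξ b)) T = deviation φ ξ T :=
      Finset.sum_congr rfl fun S hS => congrArg φ (e S hS)
    rw [deviation_insert _ _ ha', e', Function.update_self,
      Finset.sum_congr rfl fun S hS => congrArg (fun x => φ (ξ a + ξ b + x)) (e S hS)] at h3
    rw [deviation_insert _ _ ha'] at h1
    rw [deviation_insert _ _ ha, Finset.sum_powerset_insert hb, h2, zero_add,
      Finset.sum_congr rfl fun S hS => congrArg (fun x => φ (ξ a + x))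
        (Finset.sum_insert fun h => hb (Finset.mem_powerset.1 hS h))]
    simp only [← add_assoc]
    rw [← sub_eq_zero.2 (h1.trans h3.symm)]
    rw [deviation_insert _ _ hb] at h2
    have : (2 : 𝔽) = 0 := rfl
    linear_combination (∑ S ∈ T.powerset, φ (ξ a + ξ b + ∑ i ∈ S, ξ i)) * this

/-- Möbius inversion modulo two. -/
theorem sum_powerset_sum_powerset {I : Type*} (g : Finset I → 𝔽) (U : Finset I) :
    ∑ s ∈ U.powerset, ∑ S ∈ s.powerset, g S = g U := by
  classical
  induction U using Finset.induction_on generalizing g with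
  | empty => simp
  | insert a U ha ih =>
    rw [Finset.sum_powerset_insert ha, ← ih fun S => g (insert a S), ← Finset.sum_add_distrib]
    refine Finset.sum_congr rfl fun s hs => ?_
    rw [Finset.sum_powerset_insert fun h => ha (Finset.mem_powerset.1 hs h), ← add_assoc,
      ZModModule.add_self, zero_add]

end

/-! ### Polynomial functions on the dual of a vector space -/

section

variable (V : Type) [AddCommGroup V] [Module 𝔽 V]

/-- The function on the dual of `V` defined by an element of `S^*(V)`. -/
def polyFun : Sym V →ₐ[𝔽] (Module.Dual 𝔽 V → 𝔽) :=
  AlgHom.pi fun η => SymmetricAlgebra.lift η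

variable {V}

theorem polyFun_apply (x : Sym V) (η : Module.Dual 𝔽 V) :
    polyFun V x η = SymmetricAlgebra.lift η x := rfl

theorem polyFun_ι (v : V) (η : Module.Dual 𝔽 V) :
    polyFun V (SymmetricAlgebra.ι 𝔽 V v) η = η v := SymmetricAlgebra.lift_ι_apply _ _

theorem polyFun_prod {J : Type*} (s : Finset J) (v : J → V) (η : Module.Dual 𝔽 V) :
    polyFun V (∏ i ∈ s, SymmetricAlgebra.ι 𝔽 V (v i)) η = ∏ i ∈ s, η (v i) := by
  rw [map_prod, Finset.prod_apply]
  exact Finset.prod_congr rfl fun i _ => polyFun_ι _ _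

/-- An element of degree `n` defines a polynomial function of degree at most `n`. -/
theorem deviation_polyFun {n : ℕ} {x : Sym V} (hx : x ∈ symGr V n) {I : Type*}
    (ξ : I → Module.Dual 𝔽 V) {T : Finset I} (hT : n < T.card) :
    deviation (polyFun V x) ξ T = 0 := by
  have h := congrArg (SymmetricAlgebra.lift (LinearMap.id : 𝔽 →ₗ[𝔽] 𝔽))
    (sum_powerset_map_eq_zero ξ hx T hT)
  rw [map_sum, map_zero] at h
  rw [← h]
  refine Finset.sum_congr rfl fun S _ => ?_
  rw [polyFun_apply, ← AlgHom.comp_apply]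
  refine DFunLike.congr_fun (SymmetricAlgebra.algHom_ext (LinearMap.ext fun v => ?_)) x
  change SymmetricAlgebra.lift _ (SymmetricAlgebra.ι 𝔽 V v) =
    SymmetricAlgebra.lift _ (Sym.map _ (SymmetricAlgebra.ι 𝔽 V v))
  rw [Sym.map_ι, SymmetricAlgebra.lift_ι_apply, SymmetricAlgebra.lift_ι_apply]
  rfl

/-- Every function on the dual of `V` is a sum of products of distinct basis vectors, the
coefficients of which are the deviations at the dual basis. -/
theorem eq_sum_deviation_mul_prod {I : Type*} [Fintype I] (b : Module.Basis I 𝔽 V)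
    (φ : Module.Dual 𝔽 V → 𝔽) (η : Module.Dual 𝔽 V) :
    φ η = ∑ s : Finset I, deviation φ b.coord s * ∏ j ∈ s, η (b j) := by
  classical
  let U : Finset I := Finset.univ.filter fun j => η (b j) = 1
  have h01 : ∀ c : 𝔽, c = 1 ∨ c = 0 := by decide
  have hη : ∑ j ∈ U, b.coord j = η := by
    refine b.ext fun k => ?_
    rw [LinearMap.sum_apply]
    simp only [Module.Basis.coord_apply, Module.Basis.repr_self, Finsupp.single_apply]
    rw [Finset.sum_ite_eq]
    rcases h01 (η (b k)) with h | h <;> simp [U, h]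
  have h1 : ∀ s : Finset I, ∏ j ∈ s, η (b j) = if s ∈ U.powerset then 1 else 0 := by
    intro s
    split_ifs with hs
    · exact Finset.prod_eq_one fun j hj =>
        (Finset.mem_filter.1 (Finset.mem_powerset.1 hs hj)).2
    · rw [Finset.mem_powerset, Finset.not_subset] at hs
      obtain ⟨j, hj, hjU⟩ := hs
      refine Finset.prod_eq_zero hj ((h01 _).resolve_left fun h => hjU ?_)
      exact Finset.mem_filter.2 ⟨Finset.mem_univ _, h⟩
  simp only [h1, mul_ite, mul_one, mul_zero]
  rw [← Finset.sum_filter, Finset.filter_mem_eq_inter, Finset.univ_inter]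
  exact (congrArg φ hη).symm.trans
    (sum_powerset_sum_powerset (fun S => φ (∑ i ∈ S, b.coord i)) U).symm

end

/-! ### The polynomial filtration of `Ī` -/

/-- The subfunctor of `Ī` of functions whose deviations in `m + 1` arguments vanish. -/
def devSub (m : ℕ) : Subfct Ibar where
  obj V :=
    { carrier := {φ | ∀ ξ : Fin (m + 1) → Module.Dual 𝔽 V,
        ∑ S : Finset (Fin (m + 1)), φ.1 (∑ i ∈ S, ξ i) = 0}
      zero_mem' := fun _ => Finset.sum_const_zero
      add_mem' := fun {φ ψ} hφ hψ ξ => Finset.sum_add_distrib.trans (by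
        rw [hφ ξ, hψ ξ, add_zero])
      smul_mem' := fun c φ hφ ξ => (Finset.mul_sum _ _ _).symm.trans (by
        rw [hφ ξ, mul_zero]) }
  map_mem {V W} f φ hφ ξ := by
    refine Eq.trans (Finset.sum_congr rfl fun S _ => ?_) (hφ fun i => ξ i ∘ₗ f.hom.hom)
    refine congrArg φ.1 (LinearMap.ext fun v => ?_)
    simp only [map_sum, LinearMap.sum_apply]
    rfl

theorem coe_sum_map {V W : FGModuleCat.{0} 𝔽} {I : Type*} (A : Finset (Finset I))
    (f : I → (V ⟶ W)) (φ : Ibar.obj V) (η : Module.Dual 𝔽 W) :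
    (∑ S ∈ A, Ibar.map (∑ i ∈ S, f i) φ).1 η = ∑ S ∈ A, φ.1 (∑ i ∈ S, η ∘ₗ (f i).hom.hom) := by
  let ev : Ibar.obj W →ₗ[𝔽] 𝔽 := LinearMap.proj η ∘ₗ Submodule.subtype _
  change ev _ = _
  rw [map_sum]
  refine Finset.sum_congr rfl fun S _ => ?_
  change φ.1 (η ∘ₗ (∑ i ∈ S, f i).hom.hom) = _
  refine congrArg φ.1 (LinearMap.ext fun v => ?_)
  rw [FGModuleCat.hom_hom_sum, LinearMap.comp_apply, LinearMap.sum_apply, LinearMap.sum_apply,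
    map_sum]
  rfl

theorem devSub_hasPolyDegreeLE (m : ℕ) : HasPolyDegreeLE (devSub m).toFct m := by
  rw [Subfct.hasPolyDegreeLE_iff]
  intro V W f φ hφ
  refine Subtype.ext (funext fun η => ?_)
  rw [coe_sum_map]
  exact hφ _

theorem polyPart_obj (m : ℕ) (V : FGModuleCat.{0} 𝔽) :
    (polyPart Ibar m).obj V = (devSub m).obj V := by
  refine le_antisymm (iSup₂_le fun G hG φ hφ ξ => ?_)
    (le_iSup₂_of_le (f := fun (G : Subfct Ibar) (_ : G ∈ {G : Subfct Ibar |
      HasPolyDegreeLE G.toFct m}) => G.obj V) (devSub m) (devSub_hasPolyDegreeLE m) le_rfl)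
  have h := Subfct.hasPolyDegreeLE_iff.1 hG V (FGModuleCat.of 𝔽 𝔽)
    (fun i => FGModuleCat.ofHom (ξ i)) φ hφ
  have h1 := coe_sum_map Finset.univ (fun i => (FGModuleCat.ofHom (ξ i) : V ⟶ FGModuleCat.of 𝔽 𝔽)) φ
    LinearMap.id
  rw [h] at h1
  exact h1.symm

theorem polyPart_hasPolyDegreeLE (m : ℕ) : HasPolyDegreeLE (pIbar m) m := by
  rw [pIbar, Subfct.hasPolyDegreeLE_iff]
  intro V W f φ hφ
  rw [polyPart_obj] at hφ
  exact Subfct.hasPolyDegreeLE_iff.1 (devSub_hasPolyDegreeLE m) V W f φ hφ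

theorem pIbar_isSmall (m : ℕ) : IsSmall (pIbar m) := by
  refine isSmall_of_hasPolyDegreeLE (polyPart_hasPolyDegreeLE m) ?_
  have h1 : Finite (Module.Dual 𝔽 (Fin m → 𝔽)) := Module.finite_of_finite 𝔽
  have h2 : Module.Finite 𝔽 (Module.Dual 𝔽 (Fin m → 𝔽) → 𝔽) := inferInstance
  have h3 : Module.Finite 𝔽 (LinearMap.ker
    (LinearMap.proj 0 : (Module.Dual 𝔽 (Fin m → 𝔽) → 𝔽) →ₗ[𝔽] 𝔽)) := inferInstance
  have h4 : Module.Finite 𝔽 (Ibar.obj (FGModuleCat.of 𝔽 (Fin m → 𝔽))) := h3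
  exact Module.Finite.of_injective
    ((polyPart Ibar m).obj (FGModuleCat.of 𝔽 (Fin m → 𝔽))).subtype Subtype.val_injective

theorem cls_pIbar_zero (h : IsFinite (pIbar 0)) : cls (pIbar 0) h = 0 := by
  refine cls_eq_zero h fun V => ⟨fun φ ψ => ?_⟩
  have key : ∀ φ : (pIbar 0).obj V, φ = 0 := by
    rintro ⟨φ, hφ⟩
    rw [polyPart_obj] at hφ
    refine Subtype.ext (Subtype.ext (funext fun η => ?_))
    have h1 := deviation_eq_zero_of_fin hφ (fun _ : Unit => η) (T := {()}) rfl
    have h2 : φ.1 0 = 0 := φ.2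
    rw [← insert_empty_eq, deviation_insert _ _ (Finset.notMem_empty _), deviation,
      Finset.powerset_empty, Finset.sum_singleton, Finset.sum_singleton, Finset.sum_empty,
      add_zero, h2, zero_add] at h1
    exact h1
  rw [key φ, key ψ]

/-! ### The graded pieces of the polynomial filtration -/

section

variable (V : FGModuleCat.{0} 𝔽)

/-- The multilinear map which sends `(v₀, …, v_m)` to the function `v₀ ⋯ v_m` on the dual. -/
def funProd (m : ℕ) : MultilinearMap 𝔽 (fun _ : Fin (m + 1) => V) (Ibar.obj V) :=
  ((polyFun V).toLinearMap.compMultilinearMap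
    ((MultilinearMap.mkPiAlgebra 𝔽 (Fin (m + 1)) (Sym V)).compLinearMap
      fun _ => SymmetricAlgebra.ι 𝔽 V)).codRestrict
    (LinearMap.ker (LinearMap.proj 0 : (Module.Dual 𝔽 V → 𝔽) →ₗ[𝔽] 𝔽)) fun v => by
      refine LinearMap.mem_ker.2 ((polyFun_prod Finset.univ v 0).trans ?_)
      exact Finset.prod_eq_zero (Finset.mem_univ 0) rfl

theorem funProd_apply (m : ℕ) (v : Fin (m + 1) → V) (η : Module.Dual 𝔽 V) :
    (funProd V m v).1 η = ∏ i, η (v i) := polyFun_prod Finset.univ v η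

theorem funProd_mem (m : ℕ) (v : Fin (m + 1) → V) : funProd V m v ∈ (devSub (m + 1)).obj V := by
  intro ξ
  have h := prod_ι_mem V Finset.univ v
  rw [Finset.card_univ, Fintype.card_fin] at h
  have := deviation_polyFun h ξ (T := Finset.univ) (by simp)
  rwa [deviation, Finset.powerset_univ] at this

/-- Since `v² = v` as functions, a product with a repeated factor has smaller degree. -/
theorem funProd_mem_of_eq (m : ℕ) (v : Fin (m + 1) → V) {i j : Fin (m + 1)} (h : v i = v j)
    (hij : i ≠ j) : funProd V m v ∈ (devSub m).obj V := by
  classical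
  intro ξ
  have h1 := prod_ι_mem V (Finset.univ.erase j) v
  rw [Finset.card_erase_of_mem (Finset.mem_univ _), Finset.card_univ, Fintype.card_fin] at h1
  have h2 := deviation_polyFun h1 ξ (T := Finset.univ) (by simp)
  rw [deviation, Finset.powerset_univ] at h2
  refine Eq.trans (Finset.sum_congr rfl fun S _ => ?_) h2
  have h01 : ∀ c : 𝔽, c * c = c := by decide
  rw [funProd_apply, polyFun_prod, ← Finset.mul_prod_erase _ _ (Finset.mem_univ j),
    ← Finset.mul_prod_erase _ _ (Finset.mem_erase.2 ⟨hij, Finset.mem_univ i⟩), ← mul_assoc, h, h01]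

/-- The alternating map with values in the quotient of the polynomial filtration. -/
def funAlt (m : ℕ) : V [⋀^Fin (m + 1)]→ₗ[𝔽] (Ibar.obj V ⧸ (polyPart Ibar m).obj V) where
  __ := ((polyPart Ibar m).obj V).mkQ.compMultilinearMap (funProd V m)
  map_eq_zero_of_eq' v _ _ h hij := (Submodule.Quotient.mk_eq_zero _).2 (by
    rw [polyPart_obj]
    exact funProd_mem_of_eq V m v h hij)

/-- The linear map which sends `v₀ ∧ ⋯ ∧ v_m` to the class of the function `v₀ ⋯ v_m`. -/
def wedgeFun (m : ℕ) : ⋀[𝔽]^(m + 1) V →ₗ[𝔽] (Ibar.obj V ⧸ (polyPart Ibar m).obj V) :=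
  exteriorPower.alternatingMapLinearEquiv (funAlt V m)

theorem wedgeFun_ιMulti (m : ℕ) (v : Fin (m + 1) → V) :
    wedgeFun V m (exteriorPower.ιMulti 𝔽 (m + 1) v) = Submodule.Quotient.mk (funProd V m v) :=
  exteriorPower.alternatingMapLinearEquiv_apply_ιMulti _ _

theorem prod_ofFinEmbEquiv {I M : Type*} [LinearOrder I] [CommMonoid M] {n : ℕ}
    (s : Set.powersetCard I n) (f : I → M) :
    ∏ i, f (Set.powersetCard.ofFinEmbEquiv.symm s i) = ∏ i ∈ s.1, f i := by
  refine Finset.prod_bij (fun i _ => Set.powersetCard.ofFinEmbEquiv.symm s i)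
    (fun i _ => ?_) (fun i _ j _ h => ?_) (fun i hi => ?_) (fun _ _ => rfl)
  · exact (Set.powersetCard.mem_range_ofFinEmbEquiv_symm_iff_mem s _).1 ⟨i, rfl⟩
  · exact (Set.powersetCard.ofFinEmbEquiv.symm s).injective h
  · obtain ⟨j, hj⟩ := (Set.powersetCard.mem_range_ofFinEmbEquiv_symm_iff_mem s i).2 hi
    exact ⟨j, Finset.mem_univ _, hj⟩

theorem card_powersetCard {I : Type*} {n : ℕ} (s : Set.powersetCard I n) : s.1.card = n := s.2

theorem wedgeFun_injective (m : ℕ) : Function.Injective (wedgeFun V m) := by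
  classical
  let b := Module.finBasis 𝔽 V
  -- the deviation at the vectors of the dual basis in `s` is dual to the product of those in `s`
  let C : Set.powersetCard (Fin (Module.finrank 𝔽 V)) (m + 1) → Ibar.obj V →ₗ[𝔽] 𝔽 := fun s =>
    (∑ S ∈ s.1.powerset, LinearMap.proj (∑ i ∈ S, b.coord i)) ∘ₗ Submodule.subtype _
  have hC : ∀ s φ, C s φ = deviation φ.1 b.coord s.1 := fun s φ => by
    change (∑ S ∈ s.1.powerset, (LinearMap.proj (∑ i ∈ S, b.coord i) :
      (Module.Dual 𝔽 V → 𝔽) →ₗ[𝔽] 𝔽)) φ.1 = _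
    rw [LinearMap.sum_apply]
    rfl
  have h0 : ∀ s, (polyPart Ibar m).obj V ≤ LinearMap.ker (C s) := by
    intro s φ hφ
    rw [polyPart_obj] at hφ
    rw [LinearMap.mem_ker, hC]
    exact deviation_eq_zero_of_fin hφ _ (card_powersetCard s)
  have h1 : ∀ s t, Submodule.liftQ _ (C s) (h0 s)
      (wedgeFun V m (exteriorPower.ιMulti_family 𝔽 (m + 1) b t)) = if t = s then 1 else 0 := by
    intro s t
    rw [exteriorPower.ιMulti_family, wedgeFun_ιMulti, Submodule.liftQ_apply, hC, deviation]
    have e : ∀ S, (funProd V m (b ∘ Set.powersetCard.ofFinEmbEquiv.symm t)).1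
        (∑ i ∈ S, b.coord i) = if t.1 ⊆ S then 1 else 0 := by
      intro S
      rw [funProd_apply]
      refine (prod_ofFinEmbEquiv t fun j => (∑ i ∈ S, b.coord i) (b j)).trans ?_
      have e' : ∀ j, (∑ i ∈ S, b.coord i) (b j) = if j ∈ S then 1 else 0 := fun j => by
        rw [LinearMap.sum_apply]
        simp only [Module.Basis.coord_apply, Module.Basis.repr_self, Finsupp.single_apply]
        rw [Finset.sum_ite_eq]
      simp only [e', Finset.prod_ite_zero, Finset.prod_const_one, Finset.subset_iff]
    simp only [e]
    rw [← Finset.sum_filter, Finset.sum_const, nsmul_eq_mul, mul_one]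
    split_ifs with hst
    · subst hst
      have : t.1.powerset.filter (fun S => t.1 ⊆ S) = {t.1} := by
        ext S
        simp only [Finset.mem_filter, Finset.mem_powerset, Finset.mem_singleton]
        exact ⟨fun h => Finset.Subset.antisymm h.1 h.2, fun h => h ▸ ⟨subset_rfl, subset_rfl⟩⟩
      rw [this, Finset.card_singleton, Nat.cast_one]
    · have : s.1.powerset.filter (fun S => t.1 ⊆ S) = ∅ := by
        refine Finset.filter_eq_empty_iff.2 fun S hS h => hst (Subtype.ext ?_)
        exact Finset.eq_of_subset_of_card_le (h.trans (Finset.mem_powerset.1 hS))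
          (by rw [card_powersetCard, card_powersetCard])
      rw [this, Finset.card_empty, Nat.cast_zero]
  refine injective_of_dual b _ (fun s => Submodule.liftQ _ (C s) (h0 s))
    (fun s => by rw [h1, if_pos rfl]) fun s t hst => ?_
  rw [h1, if_neg hst.symm]

theorem range_wedgeFun (m : ℕ) : LinearMap.range (wedgeFun V m) =
    ((polyPart Ibar (m + 1)).obj V).map ((polyPart Ibar m).obj V).mkQ := by
  classical
  refine le_antisymm ?_ ?_
  · rw [LinearMap.range_eq_map, ← exteriorPower.ιMulti_span, Submodule.map_span]
    refine Submodule.span_le.2 ?_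
    rintro _ ⟨_, ⟨v, rfl⟩, rfl⟩
    refine ⟨funProd V m v, ?_, (wedgeFun_ιMulti V m v).symm⟩
    rw [polyPart_obj]
    exact funProd_mem V m v
  · rintro _ ⟨φ, hφ, rfl⟩
    rw [polyPart_obj] at hφ
    let b := Module.finBasis 𝔽 V
    let c : Finset (Fin (Module.finrank 𝔽 V)) → 𝔽 := deviation φ.1 b.coord
    let ψ : Ibar.obj V := ∑ t : Set.powersetCard (Fin (Module.finrank 𝔽 V)) (m + 1),
      c t.1 • funProd V m (b ∘ Set.powersetCard.ofFinEmbEquiv.symm t)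
    have hψ : ∀ η, ψ.1 η = ∑ s : Finset (Fin (Module.finrank 𝔽 V)),
        if s.card = m + 1 then c s * ∏ j ∈ s, η (b j) else 0 := by
      intro η
      let ev : Ibar.obj V →ₗ[𝔽] 𝔽 := LinearMap.proj η ∘ₗ Submodule.subtype _
      change ev ψ = _
      rw [map_sum, ← Finset.sum_filter, Finset.sum_subtype (p := (· ∈ Set.powersetCard _ (m + 1)))
        (Finset.univ.filter fun s => s.card = m + 1) (fun s => Finset.mem_filter.trans
          (and_iff_right (Finset.mem_univ s)))]
      refine Finset.sum_congr rfl fun t _ => ?_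
      rw [map_smul]
      exact congrArg (c t.1 * ·) ((funProd_apply V m _ η).trans
        (prod_ofFinEmbEquiv t fun j => η (b j)))
    -- the products of more than `m + 1` vectors do not occur in `φ`
    have hφψ : ∀ η, (φ - ψ).1 η = ∑ s : Finset (Fin (Module.finrank 𝔽 V)),
        if s.card ≤ m then c s * ∏ j ∈ s, η (b j) else 0 := by
      intro η
      change φ.1 η - ψ.1 η = _
      rw [hψ, eq_sum_deviation_mul_prod b φ.1 η, ← Finset.sum_sub_distrib]
      refine Finset.sum_congr rfl fun s _ => ?_
      rcases lt_trichotomy s.card (m + 1) with h | h | h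
      · rw [if_neg h.ne, if_pos (Nat.lt_succ_iff.1 h), sub_zero]
      · rw [if_pos h, if_neg (by lia), sub_self]
      · rw [if_neg h.ne', if_neg (by lia), deviation_eq_zero_of_lt
          (fun ξ T hT => deviation_eq_zero_of_fin hφ ξ hT) b.coord h, zero_mul, sub_zero]
    refine ⟨∑ t : Set.powersetCard (Fin (Module.finrank 𝔽 V)) (m + 1),
      c t.1 • exteriorPower.ιMulti_family 𝔽 (m + 1) b t, ?_⟩
    have h1 : wedgeFun V m (∑ t : Set.powersetCard (Fin (Module.finrank 𝔽 V)) (m + 1),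
        c t.1 • exteriorPower.ιMulti_family 𝔽 (m + 1) b t) =
        ((polyPart Ibar m).obj V).mkQ ψ := by
      rw [map_sum, map_sum]
      refine Finset.sum_congr rfl fun t _ => ?_
      rw [map_smul, map_smul, exteriorPower.ιMulti_family, wedgeFun_ιMulti]
      rfl
    rw [h1, eq_comm, ← sub_eq_zero, ← map_sub, Submodule.mkQ_apply, Submodule.Quotient.mk_eq_zero,
      polyPart_obj]
    intro ξ
    simp only [hφψ]
    rw [Finset.sum_comm]
    refine Finset.sum_eq_zero fun s _ => ?_
    split_ifs with hs
    · rw [← Finset.mul_sum]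
      have h2 := deviation_polyFun (prod_ι_mem V s b) ξ (T := Finset.univ) (by simpa using by lia)
      rw [deviation, Finset.powerset_univ] at h2
      simp only [polyFun_prod] at h2
      rw [h2, mul_zero]
    · exact Finset.sum_const_zero

end

/-- The morphism from the exterior power to the quotient of `Ī` by `p_m Ī`. -/
def wedgeFunHom (m : ℕ) : extPower (m + 1) ⟶ (polyPart Ibar m).quot where
  app V := ModuleCat.ofHom (wedgeFun V m)
  naturality V W f := by
    refine ModuleCat.hom_ext (exteriorPower.linearMap_ext (AlternatingMap.ext fun v => ?_))
    change wedgeFun W m (exteriorPower.map (m + 1) f.hom.hom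
        (exteriorPower.ιMulti 𝔽 (m + 1) v)) =
      (polyPart Ibar m).quot.map f (wedgeFun V m (exteriorPower.ιMulti 𝔽 (m + 1) v))
    rw [exteriorPower.map_apply_ιMulti, wedgeFun_ιMulti, wedgeFun_ιMulti]
    refine congrArg Submodule.Quotient.mk (Subtype.ext (funext fun η => ?_))
    rw [funProd_apply]
    exact (funProd_apply V m v (η ∘ₗ f.hom.hom)).symm

theorem polyPart_le_succ (m : ℕ) (V : FGModuleCat.{0} 𝔽) :
    (polyPart Ibar m).obj V ≤ (polyPart Ibar (m + 1)).obj V := by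
  rw [polyPart_obj, polyPart_obj]
  intro φ hφ ξ
  have h := deviation_eq_zero_of_lt (fun ξ T hT => deviation_eq_zero_of_fin hφ ξ hT) ξ
    (T := Finset.univ) (by simp)
  rwa [deviation, Finset.powerset_univ] at h

theorem Subfct.cls_eq_add {F : Fct} {G H : Subfct F} (h : ∀ V, G.obj V ≤ H.obj V)
    (hG : IsFinite G.toFct) (hH : IsSmall H.toFct) :
    cls H.toFct hH.isFinite =
      cls G.toFct hG + cls (image (H.incl ≫ G.proj)).toFct (image_isSmall _ hH).isFinite := by
  let ι : G.toFct ⟶ H.toFct := { app := fun V => ModuleCat.ofHom (Submodule.inclusion (h V)) }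
  refine cls_eq_add_image ι _ hG hH (fun V => Submodule.inclusion_injective (h V)) fun V => ?_
  refine le_antisymm ?_ ?_
  · rintro _ ⟨x, rfl⟩
    exact (G.proj_eq_zero _).2 x.2
  · intro x hx
    exact ⟨⟨x.1, (G.proj_eq_zero _).1 hx⟩, rfl⟩

theorem Subfct.range_incl_proj {F : Fct} (G H : Subfct F) (V : FGModuleCat.{0} 𝔽) :
    LinearMap.range ((H.incl ≫ G.proj).app V).hom = (H.obj V).map (G.obj V).mkQ := by
  refine le_antisymm ?_ ?_
  · rintro _ ⟨x, rfl⟩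
    exact ⟨x.1, x.2, rfl⟩
  · rintro _ ⟨x, hx, rfl⟩
    exact ⟨⟨x, hx⟩, rfl⟩

theorem cls_pIbar_succ (m : ℕ) :
    cls (pIbar (m + 1)) (pIbar_isSmall (m + 1)).isFinite =
      cls (pIbar m) (pIbar_isSmall m).isFinite +
        cls (extPower (m + 1)) (extPower_isSmall (m + 1)).isFinite := by
  rw [cls_eq_cls_image (wedgeFunHom m) (extPower_isSmall (m + 1)) fun V => wedgeFun_injective V m]
  refine (Subfct.cls_eq_add (polyPart_le_succ m) (pIbar_isSmall m).isFinite
    (pIbar_isSmall (m + 1))).trans ?_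
  refine congrArg _ (cls_congr_image _ _ _ _ fun V => ?_)
  exact (Subfct.range_incl_proj _ _ V).trans (range_wedgeFun V m).symm

theorem valU_eq_cls_pIbar (m : ℕ) :
    valU (2 * m) = cls (pIbar m) (pIbar_isSmall m).isFinite := by
  induction m with
  | zero => rw [cls_pIbar_zero, valU_eq_zero_of_le (by simp)]
  | succ m ih =>
    rw [cls_pIbar_succ, ← ih, ← valU_sub_valU (Nat.succ_pos m), show
      (2 * ((m + 1 : ℕ) : ℤ) - 2) = 2 * m by push_cast; ring, add_sub_cancel]

/-! ### Evaluation of morphisms at the generator -/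

section

variable {V : Type} [AddCommGroup V] [Module 𝔽 V]

theorem smul_mem_symMod {i d : ℤ} {a : A1} (ha : a ∈ A1.grading i) {x : Sym V}
    (hx : x ∈ (symMod V).g d) : a • x ∈ (symMod V).g (i + d) := by
  induction ha using Submodule.span_induction with
  | mem a h =>
    obtain ⟨w, hw, rfl⟩ := h
    induction w generalizing i with
    | nil =>
      obtain rfl : 0 = i := by simpa using hw
      simpa using hx
    | cons g w ih =>
      rw [List.map_cons, List.prod_cons, mul_smul]
      have h1 := ih (i := i - g.deg) (by rw [← hw]; simp)
      cases g with
      | sq1 =>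
        exact (sq1_smul V _).symm ▸ (symMod V).a_mem h1 (by simp only [Gen.deg]; push_cast; ring)
      | sq2 =>
        exact (sq2_smul V _).symm ▸ (symMod V).b_mem h1 (by simp only [Gen.deg]; push_cast; ring)
  | zero => rw [zero_smul]; exact zero_mem _
  | add a b _ _ ha hb => rw [add_smul]; exact add_mem ha hb
  | smul c a _ ha => rw [smul_assoc]; exact Submodule.smul_mem _ c ha

theorem aug_eq_zero_of_mem {d : ℤ} {x : Sym V} (hx : x ∈ (symMod V).g d) : aug V x = 0 := by
  rcases mem_symMod.1 hx with ⟨hd, hx⟩ | rfl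
  · exact aug_eq_zero hx hd.ne'
  · exact map_zero _

theorem mem_HF_grading {d : ℤ} {x : HF V} : x ∈ HF.grading V d ↔ x.1 ∈ (symMod V).g d := by
  rw [mem_symMod, HF.grading, symGr]
  split_ifs with h h'
  · simp only [h, true_and, Submodule.mem_comap]
    exact ⟨Or.inl, fun h => h.elim id fun h => (congrArg (· ∈ _) h).mpr (zero_mem _)⟩
  · lia
  all_goals simp [h]

end

section

variable (n d : ℤ) (V : Type) [AddCommGroup V] [Module 𝔽 V]

/-- The value of a morphism at the generator of the `n`th term of the complex. -/
def evalOne : gradedHom (fundGrading n) (HF.grading V) d →ₗ[𝔽] Sym V where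
  toFun φ := (φ.1 ((fundIdeal n).mkQ 1)).1
  map_add' _ _ := rfl
  map_smul' _ _ := rfl

variable {n d V}

theorem apply_mkQ (φ : gradedHom (fundGrading n) (HF.grading V) d) (a : A1) :
    (φ.1 ((fundIdeal n).mkQ a)).1 = a • evalOne n d V φ := by
  have : (fundIdeal n).mkQ a = a • (fundIdeal n).mkQ 1 := by
    rw [← map_smul, smul_eq_mul, mul_one]
  rw [this, map_smul]
  rfl

theorem evalOne_injective : Function.Injective (evalOne n d V) := by
  intro φ ψ h
  refine Subtype.ext (Submodule.linearMap_qext _ (LinearMap.ext fun a => Subtype.ext ?_))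
  exact (apply_mkQ φ a).trans ((congrArg (a • ·) h).trans (apply_mkQ ψ a).symm)

/-- Right multiplication by the element `fundElt n` corresponds to its action. -/
theorem evalOne_comp {d' : ℤ} (h : d' = d + 1)
    (φ : gradedHom (fundGrading n) (HF.grading V) d) :
    evalOne (n + 1) d' V (gradedHomPre (fundD n) (fun _ _ hx => fundD_mem hx) h φ) =
      (symMod V).diff n (evalOne n d V φ) := by
  change (φ.1 (fundD n ((fundIdeal (n + 1)).mkQ 1))).1 = _
  rw [fundD_mk, one_mul, apply_mkQ, fundElt, SqMod.diff, byMod]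
  split_ifs
  · exact sq2_smul V _
  · exact sq2_smul V _
  · rw [A1.sq3, mul_smul, sq1_smul, sq2_smul]
    rfl
  · rw [mul_smul, mul_smul, sq1_smul, sq2_smul, sq2_smul]
    rfl

theorem range_evalOne : LinearMap.range (evalOne n d V) = (symMod V).term n (d - n) := by
  have h : ∀ x : Sym V, x ∈ LinearMap.range (evalOne n d V) ↔
      x ∈ (symMod V).g (fundShift n + d) ∧ ∀ a ∈ fundIdeal n, a • x = 0 := by
    intro x
    constructor
    · rintro ⟨φ, rfl⟩
      refine ⟨mem_HF_grading.1 (φ.2 (fundShift n) _ ⟨1, ?_, rfl⟩), fun a ha => ?_⟩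
      · exact Submodule.subset_span ⟨[], by simp, rfl⟩
      · rw [← apply_mkQ, Submodule.mkQ_apply, (Submodule.Quotient.mk_eq_zero _).2 ha, map_zero]
        rfl
    · rintro ⟨hx, h⟩
      let f : A1 →ₗ[A1] HF V := LinearMap.toSpanSingleton A1 (HF V) ⟨x, aug_eq_zero_of_mem hx⟩
      have hf : ∀ a, (f a).1 = a • x := fun a => rfl
      refine ⟨⟨(fundIdeal n).liftQ f fun a ha => Subtype.ext ((hf a).trans (h a ha)), ?_⟩, ?_⟩
      · rintro i _ ⟨a, ha, rfl⟩
        refine mem_HF_grading.2 ?_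
        have h1 := smul_mem_symMod ha hx
        rwa [show i - fundShift n + (fundShift n + d) = i + d by ring] at h1
      · exact (hf 1).trans (one_smul _ _)
  have h' : ∀ x : Sym V, (∀ a ∈ Submodule.span A1 {A1.sq1}, a • x = 0) ↔ Sq V 1 x = 0 := by
    intro x
    rw [← sq1_smul]
    refine ⟨fun h => h _ (Submodule.mem_span_singleton_self _), fun h a ha => ?_⟩
    obtain ⟨c, rfl⟩ := Submodule.mem_span_singleton.1 ha
    rw [smul_eq_mul, mul_smul, h, smul_zero]
  ext x
  rw [h, SqMod.term, byMod, fundIdeal, fundShift]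
  rcases mod_four_cases n with ⟨e, -⟩ | ⟨e, -⟩ | ⟨e, -⟩ | ⟨e, -⟩
  · simp only [e, true_or, if_true]
    rw [h', show 8 * (n / 4) + 0 + d = d - n + 3 * n by lia]
    rfl
  · simp only [e]
    norm_num
    rw [show 8 * (n / 4) + 1 + d = d - n + 3 * n - 1 by lia]
  · simp only [e]
    norm_num
    rw [show 8 * (n / 4) + 2 + d = d - n + 3 * n - 2 by lia]
  · simp only [e, or_true, if_true]
    norm_num
    rw [h', show 8 * (n / 4) + 4 + d = d - n + 3 * n - 2 by lia]
    rfl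

end

/-- Evaluation at the generator, as a morphism of functors. -/
def evalHom (n d : ℤ) : homFunctor n d ⟶ symF where
  app V := ModuleCat.ofHom (evalOne n d V)

theorem evalHom_injective (n d : ℤ) (V : FGModuleCat.{0} 𝔽) :
    Function.Injective ((evalHom n d).app V) := evalOne_injective

/-! ### The class of cohomology -/

theorem isSmall_of_range {F : Fct} {P : ∀ V : FGModuleCat.{0} 𝔽, Submodule 𝔽 (Sym V)}
    (hP : IsNatFamily P)
    (α : F ⟶ symF) (hα : ∀ V, Function.Injective (α.app V))
    (h : ∀ V, LinearMap.range (α.app V).hom = P V) : IsSmall F := by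
  have hP' : P = fun V => LinearMap.range (α.app V).hom := funext fun V => (h V).symm
  subst hP'
  have : IsSmall (image α).toFct := hP.isSmall
  refine this.of_injective (toImage α) fun V x y e => hα V (congrArg Subtype.val e)

theorem cls_eq_val {F : Fct} {P : ∀ V : FGModuleCat.{0} 𝔽, Submodule 𝔽 (Sym V)} (hP : IsNatFamily P)
    (α : F ⟶ symF) (hα : ∀ V, Function.Injective (α.app V))
    (h : ∀ V, LinearMap.range (α.app V).hom = P V) (hF : IsFinite F) : cls F hF = val P := by
  rw [hP.val_eq, cls_eq_cls_image α (isSmall_of_range hP α hα h) hα,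
    cls_eq_cls_image hP.subfct.incl hP.isSmall hP.subfct.incl_injective]
  exact cls_congr_image _ _ _ _ fun V => (h V).trans (Submodule.range_subtype _).symm

theorem Exact.app {S : ShortComplex Fct} (h : S.Exact) (V : FGModuleCat.{0} 𝔽) :
    LinearMap.range (S.f.app V).hom = LinearMap.ker (S.g.app V).hom :=
  (ShortComplex.moduleCat_exact_iff_range_eq_ker _).1
    (h.map ((evaluation (FGModuleCat.{0} 𝔽) (ModuleCat.{0} 𝔽)).obj V))

section

variable (K : CochainComplex Fct ℤ) (V : FGModuleCat.{0} 𝔽)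

theorem range_iCycles_app {i j : ℤ} (h : i + 1 = j) :
    LinearMap.range ((K.iCycles i).app V).hom = LinearMap.ker ((K.d i j).app V).hom :=
  Exact.app ((ShortComplex.mk (K.iCycles i) (K.d i j) (by simp)).exact_of_f_is_kernel
    (K.cyclesIsKernel i j (by simpa using h))) V

theorem range_toCycles_app {i j : ℤ} (h : i + 1 = j) :
    LinearMap.range ((K.toCycles i j).app V).hom = LinearMap.ker ((K.homologyπ j).app V).hom :=
  Exact.app ((ShortComplex.mk (K.toCycles i j) (K.homologyπ j) (by simp)).exact_of_g_is_cokernel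
    (K.homologyIsCokernel i j (by simp; lia))) V

end

section

variable (e n : ℤ)

/-- Evaluation at the generator on the `n`th term of the complex of functors. -/
def evalX : (homComplex e).X n ⟶ symF := evalHom n (n + e)

theorem evalX_injective (V : FGModuleCat.{0} 𝔽) : Function.Injective ((evalX e n).app V) :=
  evalHom_injective n (n + e) V

theorem range_evalX (V : FGModuleCat.{0} 𝔽) :
    LinearMap.range ((evalX e n).app V).hom = (symMod V).term n e := by
  refine (range_evalOne (n := n) (d := n + e) (V := V)).trans ?_
  rw [add_sub_cancel_left]

variable {e n}

theorem evalX_d {m : ℤ} (h : n + 1 = m) (V : FGModuleCat.{0} 𝔽) (x : (homComplex e).X n |>.obj V) :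
    (evalX e m).app V (((homComplex e).d n m).app V x) =
      (symMod V).diff n ((evalX e n).app V x) := by
  subst h
  rw [show (homComplex e).d n (n + 1) = homD n (n + e) (n + 1 + e) (add_right_comm n 1 e) from
    CochainComplex.of_d (fun n => homFunctor n (n + e))
      (fun n => homD n (n + e) (n + 1 + e) (add_right_comm n 1 e)) n]
  exact evalOne_comp (add_right_comm n 1 e) _

variable (e n)

/-- The inclusion of the cocycles, in terms of the values at the generator. -/
def evalCycles : (homComplex e).cycles n ⟶ symF := (homComplex e).iCycles n ≫ evalX e n

theorem evalCycles_injective (V : FGModuleCat.{0} 𝔽) :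
    Function.Injective ((evalCycles e n).app V) :=
  (evalX_injective e n V).comp (injective_app ((homComplex e).iCycles n) V)

theorem range_evalCycles (V : FGModuleCat.{0} 𝔽) :
    LinearMap.range ((evalCycles e n).app V).hom = (symMod V).Z n e := by
  have h : LinearMap.range ((evalCycles e n).app V).hom =
      (LinearMap.range (((homComplex e).iCycles n).app V).hom).map ((evalX e n).app V).hom :=
    LinearMap.range_comp _ _
  rw [h, range_iCycles_app _ _ rfl, SqMod.Z, ← range_evalX]
  ext x
  constructor
  · rintro ⟨y, hy, rfl⟩
    refine ⟨⟨y, rfl⟩, ?_⟩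
    change (symMod V).diff n ((evalX e n).app V y) = 0
    rw [← evalX_d rfl, LinearMap.mem_ker.1 hy]
    exact ((evalX e (n + 1)).app V).hom.map_zero
  · rintro ⟨⟨y, rfl⟩, hy⟩
    refine ⟨y, LinearMap.mem_ker.2 (evalX_injective e (n + 1) V ?_), rfl⟩
    have hy' : (symMod V).diff n ((evalX e n).app V y) = 0 := hy
    exact ((evalX_d rfl V y).trans hy').trans ((evalX e (n + 1)).app V).hom.map_zero.symm

theorem range_evalCycles_toCycles (V : FGModuleCat.{0} 𝔽) :
    LinearMap.range ((((homComplex e).toCycles (n - 1) n ≫ evalCycles e n)).app V).hom =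
      (symMod V).B n e := by
  have h : (homComplex e).toCycles (n - 1) n ≫ evalCycles e n =
      (homComplex e).d (n - 1) n ≫ evalX e n := by
    rw [evalCycles, HomologicalComplex.toCycles_i_assoc]
  rw [h, SqMod.B, ← range_evalX]
  refine le_antisymm ?_ ?_
  · rintro _ ⟨y, rfl⟩
    exact ⟨_, ⟨y, rfl⟩, (evalX_d (sub_add_cancel n 1) V y).symm⟩
  · rintro _ ⟨_, ⟨y, rfl⟩, rfl⟩
    exact ⟨y, evalX_d (sub_add_cancel n 1) V y⟩

theorem cycles_isSmall : IsSmall ((homComplex e).cycles n) :=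
  isSmall_of_range (natFamily_Z n e) _ (evalCycles_injective e n) (range_evalCycles e n)

theorem homology_isSmall : IsSmall ((homComplex e).homology n) :=
  (cycles_isSmall e n).of_surjective ((homComplex e).homologyπ n) fun V => by
    rw [← ModuleCat.epi_iff_surjective]
    infer_instance

theorem cls_homology (h : IsFinite ((homComplex e).homology n)) :
    cls ((homComplex e).homology n) h =
      val (fun V => (symMod V).Z n e) - val fun V => (symMod V).B n e := by
  let I := image ((homComplex e).toCycles (n - 1) n)
  have hI : IsSmall I.toFct := I.isSmall (cycles_isSmall e n)
  have h1 := cls_eq_add I.incl ((homComplex e).homologyπ n) hI.isFinite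
    (cycles_isSmall e n).isFinite h I.incl_injective
    (fun V => (Submodule.range_subtype _).trans
      (range_toCycles_app (homComplex e) V (sub_add_cancel n 1)))
    fun V => by
      rw [← ModuleCat.epi_iff_surjective]
      infer_instance
  rw [cls_eq_val (natFamily_Z n e) _ (evalCycles_injective e n) (range_evalCycles e n),
    cls_eq_val (natFamily_B n e) (I.incl ≫ evalCycles e n)
      (fun V => (evalCycles_injective e n V).comp (I.incl_injective V)) fun V => ?_] at h1
  · rw [h1, add_sub_cancel_left]
  · rw [← range_evalCycles_toCycles]
    refine le_antisymm ?_ ?_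
    · rintro _ ⟨⟨_, ⟨y, rfl⟩⟩, rfl⟩
      exact ⟨y, rfl⟩
    · rintro _ ⟨y, rfl⟩
      exact ⟨⟨_, ⟨y, rfl⟩⟩, rfl⟩

end

theorem cohomologyFunctor_isFinite (n d : ℤ) : IsFinite (cohomologyFunctor n d) :=
  (homology_isSmall (d - n) n).isFinite

theorem cls_cohomologyFunctor (n d : ℤ) :
    cls (cohomologyFunctor n d) (cohomologyFunctor_isFinite n d) = valT n d :=
  cls_homology (d - n) n _

theorem valU_eq_atPos (m : ℤ) :
    valU (2 * m) = atPos (fun m => cls (pIbar m) (pIbar_isSmall m).isFinite) m := by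
  rw [atPos]
  split_ifs with h
  · rw [← valU_eq_cls_pIbar, Int.toNat_of_nonneg h.le]
  · exact valU_eq_zero_of_le (by lia)

theorem valU_sub_valU_eq_atPos (m : ℤ) :
    valU (2 * m) - valU (2 * m - 2) =
      atPos (fun m => cls (extPower m) (extPower_isSmall m).isFinite) m := by
  rw [atPos]
  split_ifs with h
  · rw [← valU_sub_valU (by lia), Int.toNat_of_nonneg h.le]
  · rw [valU_eq_zero_of_le (by lia), valU_eq_zero_of_le (by lia), sub_zero]

end A1Cohomology

end

theorem mainTheorem7 :
    ∃ (hp : ∀ m : ℕ, IsFinite (pIbar m)) (hΛ : ∀ m : ℕ, IsFinite (extPower m))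
      (hH : ∀ n d : ℤ, IsFinite (cohomologyFunctor n d)),
      (∀ n l : ℤ,
        cls (cohomologyFunctor n (8 * l)) (hH _ _) =
          atPos (fun m => cls (pIbar m) (hp m)) (n + 4 * l) ∧
        cls (cohomologyFunctor n (8 * l + 4)) (hH _ _) =
          atPos (fun m => cls (pIbar m) (hp m)) (n + 4 * l + 1) ∧
        cls (cohomologyFunctor n (8 * l + 6)) (hH _ _) =
          atPos (fun m => cls (extPower m) (hΛ m)) (n + 4 * l + 2) ∧
        cls (cohomologyFunctor n (8 * l + 7)) (hH _ _) =
          atPos (fun m => cls (extPower m) (hΛ m)) (n + 4 * l + 3)) ∧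
      (∀ n d : ℤ, d % 8 ≠ 0 → d % 8 ≠ 4 → d % 8 ≠ 6 → d % 8 ≠ 7 →
        cls (cohomologyFunctor n d) (hH _ _) = 0) := by
  refine ⟨fun m => (pIbar_isSmall m).isFinite, fun m => (extPower_isSmall m).isFinite,
    cohomologyFunctor_isFinite, fun n l => ⟨?_, ?_, ?_, ?_⟩, fun n d h0 h4 h6 h7 => ?_⟩
  · rw [cls_cohomologyFunctor, valT_zero_mod n (by lia), ← valU_eq_atPos]
    congr 1
    ring
  · rw [cls_cohomologyFunctor, valT_four_mod n (by lia), ← valU_eq_atPos]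
    congr 1
    ring
  · rw [cls_cohomologyFunctor, valT_six_mod n (by lia), ← valU_sub_valU_eq_atPos]
    congr 2 <;> ring
  · rw [cls_cohomologyFunctor, valT_seven_mod n (by lia), ← valU_sub_valU_eq_atPos]
    congr 2 <;> ring
  · rw [cls_cohomologyFunctor, valT_eq_zero_of_mod n h0 h4 h6 h7]
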